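/- Let $L,\rho_1,\rho_2,k_1,k_2,k_3>0$ satisfy the equal-speed conditions $\frac{k_1}{\rho_1}=\frac{k_2}{\rho_2}$ and $k_1=k_3$. Let $q>2$ and let $a>0$ be such that $g(t)=\frac{a}{(1+t)^q}$, $t\ge 0$, is a non-negative, non-increasing, differentiable and integrable function with $g(0)>0$ and $k_2-\int_0^\infty g(s)\,ds>0$ (that is, $\frac{a}{q-1}<k_2$). For $l>0$ consider on $(0,L)\times(0,\infty)$ the Bresse system with finite memory $$\begin{aligned} &\rho_1\varphi_{tt}-k_1(\varphi_x+\psi+lw)_x-lk_3(w_x-l\varphi)=0,\\ &\rho_2\psi_{tt}-k_2\psi_{xx}+k_1(\varphi_x+\psi+lw)+\int_0^t g(t-s)\psi_{xx}(s)\,ds=0,\\ &\rho_1w_{tt}-k_3(w_x-l\varphi)_x+lk_1(\varphi_x+\psi+lw)=0, \end{aligned}$$ with $\varphi=\psi_x=w_x=0$ at $x=0$ and $x=L$, and initial data $(\varphi,\varphi_t)(0)=(\varphi_0,\varphi_1)\in H^1_0(0,L)\times L^2(0,L)$, $(\psi,\psi_t)(0)=(\psi_0,\psi_1)$ and $(w,w_t)(0)=(w_0,w_1)$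 in $H^1_*(0,L)\times L^2_*(0,L)$, where the star denotes zero mean over $(0,L)$. A weak solution has $\varphi\in C([0,\infty);H^1_0)\cap C^1([0,\infty);L^2)$ and $\psi,w\in C([0,\infty);H^1_*)\cap C^1([0,\infty);L^2)$ and satisfies the equations tested in space against $H^1_0$ (first equation) and $H^1$ (second and third equations). Its energy is $$E(t)=\frac12\int_0^L\Big[\rho_1\varphi_t^2+\rho_2\psi_t^2+\rho_1w_t^2+\Big(k_2-\int_0^tg(s)\,ds\Big)\psi_x^2+k_3(w_x-l\varphi)^2+k_1(\varphi_x+\psi+lw)^2\Big]dx+\frac12\int_0^tg(t-s)\int_0^L(\psi_x(t)-\psi_x(s))^2\,dx\,ds .$$ Put $p=\frac{q+1}{q}$ and $\xi=\frac{q}{a^{1/q}}$. Then: 1. $1<p<\frac32$, $\xi>0$, and $g'(t)=-\xi\,g(t)^p$ for all $t\ge0$. 2. For every $t_0>0$, $\displaystyle\int_{t_0}^{\infty}\Big(\frac{1}{1+\int_{t_0}^t\xi^{2p-1}ds}\Big)^{\frac1{2p-2}}dt<\infty$. 3. There is $l_0>0$, depending only on $L,\rho_1,\rho_2,k_1,k_2,k_3,a,q$,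 such that for every $0<l<l_0$, all initial data as above and every $t_0>0$ there are constants $C,c>0$, independent of $t$ (they may depend on the initial data), such that the energy of the weak solution satisfies, for all $t>t_0$, $$E(t)\le C\Big(\frac{1}{1+\int_{t_0}^t\xi^{p}ds}\Big)^{\frac1{p-1}}\qquad\text{and}\qquad E(t)\le\frac{c}{(1+t)^q}.$$ This rate is exactly that of the relaxation function: if the initial data are not all zero, there is also a constant $c'>0$, independent of $t$, with $E(t)\ge\frac{c'}{(1+t)^q}$ for all $t>t_0$. -/

import Mathlib

open MeasureTheory Set Filter Topology
open scoped ContDiff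

noncomputable section

namespace Bresse

/-- The Hilbert space `L²(0,L)`; `‖v‖ ^ 2` is `∫₀ᴸ v² dx` and `inner ℝ u v` is `∫₀ᴸ u v dx`. -/
abbrev L2 (L : ℝ) : Type := Lp ℝ 2 (volume.restrict (Ioo (0 : ℝ) L))

/-- Test functions on the open interval: the members of `C_c^∞(0,L)`. -/
def IsTest (L : ℝ) (η : ℝ → ℝ) : Prop :=
  ContDiff ℝ ∞ η ∧ HasCompactSupport η ∧ tsupport η ⊆ Ioo 0 L

/-- `f'` is the weak derivative of `f` on `(0,L)`. -/
def IsWeakDeriv (L : ℝ) (f f' : L2 L) : Prop :=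
  ∀ η : ℝ → ℝ, IsTest L η →
    ∫ x in Ioo (0 : ℝ) L, f x * deriv η x = - ∫ x in Ioo (0 : ℝ) L, f' x * η x

theorem integrable_mul_of_compact {L : ℝ} (f : L2 L) {η : ℝ → ℝ} (hc : Continuous η)
    (hs : HasCompactSupport η) :
    IntegrableOn (fun x => f x * η x) (Ioo (0 : ℝ) L) := by
  obtain ⟨C, hC⟩ := hs.exists_bound_of_continuous hc
  exact ((Lp.memLp f).integrable (by norm_num)).mul_bdd (c := C)
    hc.aestronglyMeasurable (Eventually.of_forall hC)

theorem integrable_L2 {L : ℝ} (f : L2 L) : IntegrableOn (fun x => f x) (Ioo (0 : ℝ) L) :=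
  (Lp.memLp f).integrable (by norm_num)

theorem integral_mul_add {L : ℝ} (f g : L2 L) {η : ℝ → ℝ} (hc : Continuous η)
    (hs : HasCompactSupport η) :
    ∫ x in Ioo (0 : ℝ) L, (f + g : L2 L) x * η x =
      (∫ x in Ioo (0 : ℝ) L, f x * η x) + ∫ x in Ioo (0 : ℝ) L, g x * η x := by
  rw [← integral_add (integrable_mul_of_compact f hc hs) (integrable_mul_of_compact g hc hs)]
  refine integral_congr_ae ?_
  filter_upwards [Lp.coeFn_add f g] with x hx
  rw [hx, Pi.add_apply, add_mul]

theorem integral_mul_smul {L : ℝ} (c : ℝ) (f : L2 L) (η : ℝ → ℝ) :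
    ∫ x in Ioo (0 : ℝ) L, (c • f : L2 L) x * η x = c * ∫ x in Ioo (0 : ℝ) L, f x * η x := by
  rw [← integral_const_mul]
  refine integral_congr_ae ?_
  filter_upwards [Lp.coeFn_smul c f] with x hx
  rw [hx, Pi.smul_apply, smul_eq_mul, mul_assoc]

/-- The Sobolev space `H¹(0,L)`, as the space of pairs `(v, v_x)` inside `L² × L²`, with the
topology of `L²`-convergence of `v` and of `v_x`. -/
def H1 (L : ℝ) : Submodule ℝ (L2 L × L2 L) where
  carrier := {p | IsWeakDeriv L p.1 p.2}
  add_mem' := by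
    intro p r hp hr η hη
    have hd : Continuous (deriv η) := hη.1.continuous_deriv (by simp)
    rw [Prod.fst_add, Prod.snd_add, integral_mul_add _ _ hd hη.2.1.deriv,
      integral_mul_add _ _ hη.1.continuous hη.2.1, hp η hη, hr η hη]
    ring
  zero_mem' := by
    intro η _
    have h := integral_mul_smul (L := L) 0 0
    simp only [zero_smul, zero_mul] at h
    simp only [Prod.fst_zero, Prod.snd_zero, h, neg_zero]
  smul_mem' := by
    intro c p hp η hη
    rw [Prod.smul_fst, Prod.smul_snd, integral_mul_smul, integral_mul_smul, hp η hη]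
    ring

/-- The space `L²_*(0,L)` of square-integrable functions with zero mean. -/
def L2s (L : ℝ) : Submodule ℝ (L2 L) where
  carrier := {v | ∫ x in Ioo (0 : ℝ) L, v x = 0}
  add_mem' := by
    intro f g hf hg
    have h : ∫ x in Ioo (0 : ℝ) L, (f + g : L2 L) x =
        (∫ x in Ioo (0 : ℝ) L, f x) + ∫ x in Ioo (0 : ℝ) L, g x := by
      rw [← integral_add (integrable_L2 f) (integrable_L2 g)]
      exact integral_congr_ae (Lp.coeFn_add f g)
    simp only [mem_ofPred_eq] at hf hg ⊢
    rw [h, hf, hg, add_zero]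
  zero_mem' := by
    have h : ∫ x in Ioo (0 : ℝ) L, (0 : L2 L) x = ∫ x in Ioo (0 : ℝ) L, (0 : ℝ → ℝ) x :=
      integral_congr_ae (Lp.coeFn_zero _ _ _)
    simp only [mem_ofPred_eq]
    rw [h]
    simp
  smul_mem' := by
    intro c f hf
    have h := integral_mul_smul c f (fun _ => 1)
    simp only [mul_one] at h
    simp only [mem_ofPred_eq] at hf ⊢
    rw [h, hf, mul_zero]

/-- `H¹_*(0,L) = H¹(0,L) ∩ L²_*(0,L)`. -/
def H1s (L : ℝ) : Submodule ℝ (L2 L × L2 L) :=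
  H1 L ⊓ (L2s L).comap (LinearMap.fst ℝ (L2 L) (L2 L))

/-- `H¹₀(0,L)`: the closure of `C_c^∞(0,L)` in `H¹(0,L)`, again as pairs `(v, v_x)`. -/
def H10 (L : ℝ) : Submodule ℝ (L2 L × L2 L) :=
  (Submodule.span ℝ {p : L2 L × L2 L | ∃ η : ℝ → ℝ, IsTest L η ∧
    (∀ᵐ x ∂(volume.restrict (Ioo (0 : ℝ) L)), p.1 x = η x) ∧
    (∀ᵐ x ∂(volume.restrict (Ioo (0 : ℝ) L)), p.2 x = deriv η x)}).topologicalClosure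

/-- The function underlying an element of a Sobolev space. -/
def val {L : ℝ} {V : Submodule ℝ (L2 L × L2 L)} (v : V) : L2 L := (v : L2 L × L2 L).1

/-- The derivative `v_x` of an element of a Sobolev space. -/
def dx {L : ℝ} {V : Submodule ℝ (L2 L × L2 L)} (v : V) : L2 L := (v : L2 L × L2 L).2

/-- The time derivative, in `L²(0,L)`, of a function on `[0,∞)`; one-sided at time zero. -/
def dt {L : ℝ} {V : Submodule ℝ (L2 L × L2 L)} (u : ℝ → V) (t : ℝ) : L2 L :=
  derivWithin (fun s => val (u s)) (Ici 0) t

/-- `φ_x + ψ + l w`. -/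
def shear {L : ℝ} (l : ℝ) (φ : H10 L) (ψ w : H1s L) : L2 L := dx φ + val ψ + l • val w

/-- `w_x - l φ`. -/
def axial {L : ℝ} (l : ℝ) (φ : H10 L) (w : H1s L) : L2 L := dx w - l • val φ

/-- The class `C([0,∞); V) ∩ C¹([0,∞); L²(0,L))`. -/
def IsFiniteEnergy {L : ℝ} {V : Submodule ℝ (L2 L × L2 L)} (u : ℝ → V) : Prop :=
  ContinuousOn u (Ici 0) ∧ ContDiffOn ℝ 1 (fun t => val (u t)) (Ici 0)

/-- `(φ, ψ, w)` is a weak solution on `(0,L) × (0,∞)` of the Bresse system with finite memory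
```
ρ₁ φ_tt - k₁ (φ_x + ψ + l w)_x - l k₃ (w_x - l φ) = 0
ρ₂ ψ_tt - k₂ ψ_xx + k₁ (φ_x + ψ + l w) + ∫₀ᵗ g(t-s) ψ_xx(s) ds = 0
ρ₁ w_tt - k₃ (w_x - l φ)_x + l k₁ (φ_x + ψ + l w) = 0
```
with `φ = ψ_x = w_x = 0` at `x = 0, L` and the given initial data. Each equation is multiplied by
a test function and integrated by parts in space; the Neumann conditions are the natural ones for
test functions in `H¹`. All pairings are with continuous functions of time, so that the second
time derivative may be taken of the pairing in the classical sense. -/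
structure IsWeakSolution (L l ρ₁ ρ₂ k₁ k₂ k₃ : ℝ) (g : ℝ → ℝ)
    (φ₀ : H10 L) (φ₁ : L2 L) (ψ₀ : H1s L) (ψ₁ : L2s L) (w₀ : H1s L) (w₁ : L2s L)
    (φ : ℝ → H10 L) (ψ w : ℝ → H1s L) : Prop where
  φ_reg : IsFiniteEnergy φ
  ψ_reg : IsFiniteEnergy ψ
  w_reg : IsFiniteEnergy w
  φ_init : φ 0 = φ₀ ∧ dt φ 0 = φ₁
  ψ_init : ψ 0 = ψ₀ ∧ dt ψ 0 = (ψ₁ : L2 L)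
  w_init : w 0 = w₀ ∧ dt w 0 = (w₁ : L2 L)
  φ_eq : ∀ v : H10 L, ∀ t : ℝ, 0 ≤ t →
    HasDerivWithinAt (fun s => ρ₁ * inner ℝ (dt φ s) (val v))
      (-(k₁ * inner ℝ (shear l (φ t) (ψ t) (w t)) (dx v))
        + l * k₃ * inner ℝ (axial l (φ t) (w t)) (val v)) (Ici 0) t
  ψ_eq : ∀ v : H1 L, ∀ t : ℝ, 0 ≤ t →
    HasDerivWithinAt (fun s => ρ₂ * inner ℝ (dt ψ s) (val v))
      (-(k₂ * inner ℝ (dx (ψ t)) (dx v))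
        - k₁ * inner ℝ (shear l (φ t) (ψ t) (w t)) (val v)
        + ∫ s in (0 : ℝ)..t, g (t - s) * inner ℝ (dx (ψ s)) (dx v)) (Ici 0) t
  w_eq : ∀ v : H1 L, ∀ t : ℝ, 0 ≤ t →
    HasDerivWithinAt (fun s => ρ₁ * inner ℝ (dt w s) (val v))
      (-(k₃ * inner ℝ (axial l (φ t) (w t)) (dx v))
        - l * k₁ * inner ℝ (shear l (φ t) (ψ t) (w t)) (val v)) (Ici 0) t

/-- `(g ∘ v)(t) = ∫₀ᴸ ∫₀ᵗ g(t-s) (v(t) - v(s))² ds dx`, with the integral over `x` taken first. -/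
def memory {L : ℝ} (g : ℝ → ℝ) (v : ℝ → L2 L) (t : ℝ) : ℝ :=
  ∫ s in (0 : ℝ)..t, g (t - s) * ‖v t - v s‖ ^ 2

/-- The energy `E(t)`. -/
def energy {L : ℝ} (l ρ₁ ρ₂ k₁ k₂ k₃ : ℝ) (g : ℝ → ℝ)
    (φ : ℝ → H10 L) (ψ w : ℝ → H1s L) (t : ℝ) : ℝ :=
  1 / 2 * (ρ₁ * ‖dt φ t‖ ^ 2 + ρ₂ * ‖dt ψ t‖ ^ 2 + ρ₁ * ‖dt w t‖ ^ 2
      + (k₂ - ∫ s in (0 : ℝ)..t, g s) * ‖dx (ψ t)‖ ^ 2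
      + k₃ * ‖axial l (φ t) (w t)‖ ^ 2
      + k₁ * ‖shear l (φ t) (ψ t) (w t)‖ ^ 2)
    + 1 / 2 * memory g (fun s => dx (ψ s)) t

/-- The standing assumption on the relaxation function `g : [0,∞) → [0,∞)`: it is non-increasing
and differentiable with `g(0) > 0` and `k₂ - ∫₀^∞ g(s) ds > 0`. -/
structure IsRelaxation (k₂ : ℝ) (g : ℝ → ℝ) : Prop where
  nonneg : ∀ t, 0 ≤ t → 0 ≤ g t
  anti : AntitoneOn g (Ici 0)
  diff : DifferentiableOn ℝ g (Ici 0)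
  pos : 0 < g 0
  integrable : IntegrableOn g (Ioi 0)
  mass : 0 < k₂ - ∫ s in Ioi (0 : ℝ), g s

/-- The relaxation function `g(t) = a / (1+t)^q`. -/
def polyKernel (a q : ℝ) (t : ℝ) : ℝ := a / (1 + t) ^ q

end Bresse

end

/-! Expanding `φ` in sines and `ψ`, `w` in cosines of frequency `lam = (n+1)π/L` respects the
boundary conditions and decouples the system. There is no constant mode, because `ψ` and `w` have
zero mean. Each triple of coefficients solves a scalar system with memory (`IsWeakSolution.isMode`),
and by Parseval the energy is the sum of the mode energies (`IsWeakSolution.hasSum_energy`). So it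
suffices to estimate one mode with constants independent of `lam`. The smallness `l < π/(2L)` means
`2 l ≤ lam` for every mode, which keeps `lam² - l²` away from zero.

Upper bound. Along a mode only the memory dissipates energy. Four multipliers transfer this to the
other components: the memory deviation controls `Y`; a combination `σ` of `X` and `Z` whose
derivative is a multiple of the shear gives control of `lam y`; a product using the equality of the
wave speeds controls the shear; and an axial product using `k₁ = k₃` controls the axial force, `X`
and `Z`. A weighted sum of these and the energy is a functional `F` equivalent to the energy `e`
with `F' ≤ -m e + C Γ`, where `Γ` is the memory term (`exists_lyapunov`).

The dissipation contains the memory term only with the faster decaying kernel `g/(1+t)`. Splitting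
the history at age `τ` gives `Γ ≲ (1+τ)(-e') + g(τ) W`, where `W` is the unweighted integral of the
squared deviations (`quadMem_le_tail`). With `τ` proportional to `t`, a bound `W ≲ (1+t)^j` yields
`e ≲ (1+t)^(j-q)` (`exists_decay_of_tail`). This is used twice: monotonicity of `e` gives `j = 1`;
the resulting decay `(1+t)^(1-q)` is integrable because `q > 2`, so `W` is bounded and `j = 0`,
which is the rate of `g`.

Lower bound. Since `g` decreases, the memory term at time `t` is at least `g(t) W(t)`. As the mode
tends to zero, its deviation from a nonzero past does not, so a mode with `y` not identically zero
keeps energy of order `g(t)`. If `y` vanished identically, the energy would be conserved, against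
its decay. Modes are determined by their data, so the constant does not depend on the solution.

Since `ξ` is constant, the estimate with `1 + ∫ ξ^p` follows from the explicit one by comparing
affine functions of `t`. -/

noncomputable section
namespace Bresse

/-! ### Convolution on `[0,t]` -/

/-- The finite-memory convolution `∫₀ᵗ g(t-s) f(s) ds`. -/
def conv (g f : ℝ → ℝ) (t : ℝ) : ℝ := ∫ s in (0 : ℝ)..t, g (t - s) * f s

theorem continuousOn_conv_integrand {g f : ℝ → ℝ} (hg : ContinuousOn g (Ioi (-1)))
    (hf : ContinuousOn f (Ici 0)) (t : ℝ) :
    ContinuousOn (fun s => g (t - s) * f s) (Icc 0 t) := by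
  refine ContinuousOn.mul (hg.comp (by fun_prop) ?_) (hf.mono Icc_subset_Ici_self)
  intro s hs
  simp only [mem_Ioi, mem_Icc] at *
  linarith

theorem intervalIntegrable_conv {g f : ℝ → ℝ} (hg : ContinuousOn g (Ioi (-1)))
    (hf : ContinuousOn f (Ici 0)) {t : ℝ} (ht : 0 ≤ t) :
    IntervalIntegrable (fun s => g (t - s) * f s) volume 0 t :=
  (continuousOn_conv_integrand hg hf t).intervalIntegrable_of_Icc ht

/-- Cutting the integral at the fixed time `t` separates two effects: differentiation under the
integral over `[0,t]` gives the `g'` term, and the short piece from `t` to `u` gives the boundary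
term, by continuity of the integrand at the diagonal. -/
theorem hasDerivAt_conv_of_continuous {g g' f : ℝ → ℝ}
    (hg : ∀ t, -1 < t → HasDerivAt g (g' t) t) (hg' : ContinuousOn g' (Ioi (-1)))
    (hf : Continuous f) {t : ℝ} (ht : 0 ≤ t) :
    HasDerivAt (conv g f) (g 0 * f t + conv g' f t) t := by
  have hgc : ContinuousOn g (Ioi (-1)) := fun s hs => (hg s hs).continuousAt.continuousWithinAt
  -- For `u` slightly below `t` the argument `u - s` becomes negative; the margin `1/2` keeps it in
  -- `(-1, ∞)`, where the kernel is regular.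
  have hcont : ∀ u, -(1 / 2) < u → ∀ g₀ : ℝ → ℝ, ContinuousOn g₀ (Ioi (-1)) →
      ContinuousOn (fun s => g₀ (u - s) * f s) (Iic (u + 1 / 2)) := by
    intro u hu g₀ h₀
    refine ContinuousOn.mul (h₀.comp (by fun_prop) ?_) hf.continuousOn
    intro s hs
    simp only [mem_Ioi, mem_Iic] at *
    linarith
  have hball : ∀ u ∈ Metric.ball t (1 / 2), t - 1 / 2 < u ∧ u < t + 1 / 2 := by
    intro u hu
    rw [Metric.mem_ball, Real.dist_eq, abs_lt] at hu
    constructor <;> linarith [hu.1, hu.2]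
  have hInt : ∀ u ∈ Metric.ball t (1 / 2), ∀ a b, a ≤ t → b ≤ t → ∀ g₀ : ℝ → ℝ,
      ContinuousOn g₀ (Ioi (-1)) →
      IntervalIntegrable (fun s => g₀ (u - s) * f s) volume a b := by
    intro u hu a b ha hb g₀ h₀
    refine ((hcont u (by linarith [(hball u hu).1]) g₀ h₀).mono ?_).intervalIntegrable
    intro s hs
    have h1 := hs.2
    have h2 : max a b ≤ t := max_le ha hb
    have := (hball u hu).1
    simp only [mem_Iic]
    linarith
  have hInt' : ∀ u ∈ Metric.ball t (1 / 2),
      IntervalIntegrable (fun s => g (u - s) * f s) volume t u := by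
    intro u hu
    refine ((hcont u (by linarith [(hball u hu).1]) g hgc).mono ?_).intervalIntegrable
    intro s hs
    have h1 := hs.2
    have h2 : max t u ≤ u + 1 / 2 := max_le (by linarith [(hball u hu).1]) (by linarith)
    simp only [mem_Iic]
    linarith
  have hA : HasDerivAt (fun u => ∫ s in (0 : ℝ)..t, g (u - s) * f s) (conv g' f t) t := by
    obtain ⟨C, hC⟩ := (isCompact_Icc (a := -(1 / 2 : ℝ)) (b := t + 1 / 2)).exists_bound_of_continuousOn
      (hg'.mono (fun s hs => by simp only [mem_Ioi, mem_Icc] at *; linarith [hs.1]))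
    refine (intervalIntegral.hasDerivAt_integral_of_dominated_loc_of_deriv_le
      (F := fun u s => g (u - s) * f s) (F' := fun u s => g' (u - s) * f s)
      (bound := fun s => C * |f s|) (Metric.ball_mem_nhds t (by norm_num : (0 : ℝ) < 1 / 2))
      ?_ (hInt t (Metric.mem_ball_self (by norm_num)) 0 t ht le_rfl g hgc)
      (hInt t (Metric.mem_ball_self (by norm_num)) 0 t ht le_rfl g' hg').def'.1
      ?_ (by fun_prop : Continuous fun s => C * |f s|).continuousOn.intervalIntegrable ?_).2
    · filter_upwards [Metric.ball_mem_nhds t (by norm_num : (0 : ℝ) < 1 / 2)] with u hu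
      exact (hInt u hu 0 t ht le_rfl g hgc).def'.1
    · refine Eventually.of_forall fun s hs u hu => ?_
      rw [uIoc_of_le ht] at hs
      rw [norm_mul]
      refine mul_le_mul_of_nonneg_right (hC _ ⟨?_, ?_⟩) (norm_nonneg _)
      · linarith [(hball u hu).1, hs.2]
      · linarith [(hball u hu).2, hs.1]
    · refine Eventually.of_forall fun s hs u hu => ?_
      rw [uIoc_of_le ht] at hs
      have := (hg (u - s) (by linarith [(hball u hu).1, hs.2])).comp u
        ((hasDerivAt_id u).sub_const s)
      simpa using this.mul_const (f s)
  have hB : HasDerivAt (fun u => ∫ s in t..u, g (u - s) * f s) (g 0 * f t) t := by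
    rw [hasDerivAt_iff_isLittleO, Asymptotics.isLittleO_iff]
    intro ε hε
    have hc2 : ContinuousAt (fun p : ℝ × ℝ => g (p.1 - p.2) * f p.2) (t, t) := by
      refine ContinuousAt.mul ?_ (by fun_prop)
      have : ContinuousAt g ((fun p : ℝ × ℝ => p.1 - p.2) (t, t)) := by
        simpa using (hg 0 (by norm_num)).continuousAt
      exact ContinuousAt.comp (f := fun p : ℝ × ℝ => p.1 - p.2) this (by fun_prop)
    obtain ⟨δ, hδ, hδ'⟩ := Metric.continuousAt_iff.1 hc2 ε hε
    filter_upwards [Metric.ball_mem_nhds t hδ,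
      Metric.ball_mem_nhds t (by norm_num : (0 : ℝ) < 1 / 2)] with u hu hu2
    have h1 : (∫ s in t..u, g (u - s) * f s) - (u - t) • (g 0 * f t) =
        ∫ s in t..u, (g (u - s) * f s - g 0 * f t) := by
      rw [intervalIntegral.integral_sub (hInt' u hu2) intervalIntegrable_const,
        intervalIntegral.integral_const]
    simp only [intervalIntegral.integral_same, sub_zero]
    rw [h1, Real.norm_eq_abs (u - t)]
    refine intervalIntegral.norm_integral_le_of_norm_le_const fun s hs => ?_
    have hst : |s - t| ≤ |u - t| := by
      have := abs_sub_left_of_mem_uIcc (uIoc_subset_uIcc hs)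
      simpa using this
    have hd : dist (u, s) (t, t) < δ := by
      rw [Prod.dist_eq, max_lt_iff]
      refine ⟨hu, ?_⟩
      rw [Metric.mem_ball, Real.dist_eq] at hu
      simpa [Real.dist_eq] using lt_of_le_of_lt hst hu
    have := hδ' hd
    simp only [sub_self] at this
    rw [Real.dist_eq] at this
    exact this.le
  have hAB : conv g f =ᶠ[𝓝 t] fun u =>
      (∫ s in (0 : ℝ)..t, g (u - s) * f s) + ∫ s in t..u, g (u - s) * f s := by
    filter_upwards [Metric.ball_mem_nhds t (by norm_num : (0 : ℝ) < 1 / 2)] with u hu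
    rw [intervalIntegral.integral_add_adjacent_intervals (hInt u hu 0 t ht le_rfl g hgc)
      (hInt' u hu), conv]
  rw [add_comm]
  exact (hA.add hB).congr_of_eventuallyEq hAB

theorem conv_congr {g f₁ f₂ : ℝ → ℝ} (h : ∀ s, 0 ≤ s → f₁ s = f₂ s) {t : ℝ} (ht : 0 ≤ t) :
    conv g f₁ t = conv g f₂ t := by
  refine intervalIntegral.integral_congr fun s hs => ?_
  rw [uIcc_of_le ht] at hs
  simp only [h s hs.1]

theorem hasDerivWithinAt_conv {g g' f : ℝ → ℝ}
    (hg : ∀ t, -1 < t → HasDerivAt g (g' t) t) (hg' : ContinuousOn g' (Ioi (-1)))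
    (hf : ContinuousOn f (Ici 0)) {t : ℝ} (ht : 0 ≤ t) :
    HasDerivWithinAt (conv g f) (g 0 * f t + conv g' f t) (Ici 0) t := by
  -- Extending `f` by the constant `f 0` to negative times leaves the convolution on `[0, ∞)`
  -- unchanged.
  have hc : Continuous fun s => f (max s 0) :=
    hf.comp_continuous (by fun_prop) fun s => le_max_right s 0
  have he : ∀ s, 0 ≤ s → f s = f (max s 0) := fun s hs => by rw [max_eq_left hs]
  have := (hasDerivAt_conv_of_continuous hg hg' hc ht).hasDerivWithinAt (s := Ici 0)
  rw [← conv_congr he ht, ← he t ht] at this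
  exact this.congr (fun s hs => conv_congr he hs) (conv_congr he ht)

/-! ### The polynomial kernel -/

theorem hasDerivAt_polyKernel (a r : ℝ) {t : ℝ} (ht : -1 < t) :
    HasDerivAt (polyKernel a r) (-(r * polyKernel a (r + 1) t)) t := by
  have h1 : (0 : ℝ) < 1 + t := by linarith
  have h2 : HasDerivAt (fun s : ℝ => 1 + s) 1 t := (hasDerivAt_id t).const_add 1
  have h3 := (h2.rpow_const (p := r) (Or.inl h1.ne')).inv (Real.rpow_pos_of_pos h1 r).ne'
  have h4 := h3.const_mul a
  refine (h4.congr_deriv ?_).congr_of_eventuallyEq (Eventually.of_forall fun s => ?_)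
  · rw [polyKernel, Real.rpow_sub_one h1.ne', Real.rpow_add_one h1.ne']
    have := (Real.rpow_pos_of_pos h1 r).ne'
    field_simp
  · simp [polyKernel, div_eq_mul_inv]

theorem continuousOn_polyKernel (a r : ℝ) : ContinuousOn (polyKernel a r) (Ioi (-1)) :=
  fun _ ht => (hasDerivAt_polyKernel a r ht).continuousAt.continuousWithinAt

theorem polyKernel_pos {a r t : ℝ} (ha : 0 < a) (ht : -1 < t) : 0 < polyKernel a r t :=
  div_pos ha (Real.rpow_pos_of_pos (by linarith) r)

theorem polyKernel_zero (a r : ℝ) : polyKernel a r 0 = a := by simp [polyKernel]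

theorem polyKernel_eq_mul (a r : ℝ) {t : ℝ} (ht : -1 < t) :
    polyKernel a r t = (1 + t) * polyKernel a (r + 1) t := by
  have h1 : (0 : ℝ) < 1 + t := by linarith
  have := (Real.rpow_pos_of_pos h1 r).ne'
  rw [polyKernel, polyKernel, Real.rpow_add_one h1.ne']
  field_simp

theorem polyKernel_anti {a r s t : ℝ} (ha : 0 ≤ a) (hr : 0 ≤ r) (hs : -1 < s) (hst : s ≤ t) :
    polyKernel a r t ≤ polyKernel a r s :=
  div_le_div_of_nonneg_left ha (Real.rpow_pos_of_pos (by linarith) r)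
    (Real.rpow_le_rpow (by linarith) (by linarith) hr)

theorem hasDerivWithinAt_conv_polyKernel (a r : ℝ) {f : ℝ → ℝ} (hf : ContinuousOn f (Ici 0))
    {t : ℝ} (ht : 0 ≤ t) :
    HasDerivWithinAt (conv (polyKernel a r) f) (a * f t - r * conv (polyKernel a (r + 1)) f t)
      (Ici 0) t := by
  have := hasDerivWithinAt_conv (fun s hs => hasDerivAt_polyKernel a r hs)
    (((continuousOn_polyKernel a (r + 1)).const_smul r).neg) hf ht
  refine this.congr_deriv ?_
  rw [polyKernel_zero, sub_eq_add_neg, conv, conv, ← intervalIntegral.integral_const_mul,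
    ← intervalIntegral.integral_neg]
  congr 1
  refine intervalIntegral.integral_congr fun s _ => ?_
  change -(r * polyKernel a (r + 1) (t - s)) * f s = -(r * (polyKernel a (r + 1) (t - s) * f s))
  ring

/-! ### Mass of the kernel and the quadratic memory term -/

/-- The total mass `∫₀ᵗ g` of the kernel up to time `t`. -/
def mass (g : ℝ → ℝ) (t : ℝ) : ℝ := ∫ s in (0 : ℝ)..t, g s

theorem mass_eq_conv (g : ℝ → ℝ) (t : ℝ) : mass g t = conv g (fun _ => 1) t := by
  simp [mass, conv]

/-- The quadratic memory term `∫₀ᵗ g(t-s) (y(t) - y(s))² ds`. -/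
def quadMem (g y : ℝ → ℝ) (t : ℝ) : ℝ := ∫ s in (0 : ℝ)..t, g (t - s) * (y t - y s) ^ 2

theorem integral_conv_sq {g y : ℝ → ℝ} (hg : ContinuousOn g (Ioi (-1)))
    (hy : ContinuousOn y (Ici 0)) {t : ℝ} (ht : 0 ≤ t) (c : ℝ) :
    ∫ s in (0 : ℝ)..t, g (t - s) * (c - y s) ^ 2 =
      mass g t * c ^ 2 - 2 * c * conv g y t + conv g (fun s => y s ^ 2) t := by
  have h0 := intervalIntegrable_conv hg (continuousOn_const (c := (1 : ℝ))) ht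
  have h1 := intervalIntegrable_conv hg hy ht
  have h2 : IntervalIntegrable (fun s => g (t - s) * y s ^ 2) volume 0 t :=
    intervalIntegrable_conv hg (hy.pow 2) ht
  rw [mass_eq_conv, conv, conv, conv, mul_comm _ (c ^ 2), ← intervalIntegral.integral_const_mul,
    ← intervalIntegral.integral_const_mul, ← intervalIntegral.integral_sub (h0.const_mul _)
    (h1.const_mul _), ← intervalIntegral.integral_add ((h0.const_mul _).sub (h1.const_mul _)) h2]
  refine intervalIntegral.integral_congr fun s _ => ?_
  ring

theorem quadMem_eq {g y : ℝ → ℝ} (hg : ContinuousOn g (Ioi (-1)))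
    (hy : ContinuousOn y (Ici 0)) {t : ℝ} (ht : 0 ≤ t) :
    quadMem g y t = mass g t * y t ^ 2 - 2 * y t * conv g y t + conv g (fun s => y s ^ 2) t :=
  integral_conv_sq hg hy ht _

theorem quadMem_nonneg {g : ℝ → ℝ} (hg : ∀ s, 0 ≤ s → 0 ≤ g s) (y : ℝ → ℝ) {t : ℝ} (ht : 0 ≤ t) :
    0 ≤ quadMem g y t :=
  intervalIntegral.integral_nonneg ht fun s hs =>
    mul_nonneg (hg _ (by linarith [hs.2])) (sq_nonneg _)

/-- Cauchy–Schwarz for the measure `g(t-s) ds`, proved as nonnegativity of a variance: the weighted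
integral of `(c - y(s))²` is nonnegative at the weighted mean `c`. This is how the memory term
controls the linear memory deviation. -/
theorem conv_sq_le {g y : ℝ → ℝ} (hg : ContinuousOn g (Ioi (-1))) (hg0 : ∀ s, 0 ≤ s → 0 ≤ g s)
    (hy : ContinuousOn y (Ici 0)) {t : ℝ} (ht : 0 ≤ t) (hm : 0 < mass g t) :
    (mass g t * y t - conv g y t) ^ 2 ≤ mass g t * quadMem g y t := by
  have h : 0 ≤ ∫ s in (0 : ℝ)..t, g (t - s) * (conv g y t / mass g t - y s) ^ 2 :=
    intervalIntegral.integral_nonneg ht fun s hs =>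
      mul_nonneg (hg0 _ (by linarith [hs.2])) (sq_nonneg _)
  rw [integral_conv_sq hg hy ht] at h
  rw [quadMem_eq hg hy ht]
  have h' := mul_nonneg hm.le h
  have e : mass g t * (mass g t * (conv g y t / mass g t) ^ 2
      - 2 * (conv g y t / mass g t) * conv g y t + conv g (fun s => y s ^ 2) t)
      = mass g t * conv g (fun s => y s ^ 2) t - conv g y t ^ 2 := by
    field_simp
    ring
  rw [e] at h'
  nlinarith

theorem mass_polyKernel_pos {a r t : ℝ} (ha : 0 < a) (ht : 0 < t) :
    0 < mass (polyKernel a r) t := by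
  refine intervalIntegral.intervalIntegral_pos_of_pos_on ?_ (fun s hs =>
    polyKernel_pos ha (by linarith [hs.1])) ht
  refine ((continuousOn_polyKernel a r).mono fun s hs => ?_).intervalIntegrable_of_Icc ht.le
  simp only [mem_Ioi]
  linarith [hs.1]

theorem mass_polyKernel_mono {a r s t : ℝ} (ha : 0 < a) (hs : 0 ≤ s) (hst : s ≤ t) :
    mass (polyKernel a r) s ≤ mass (polyKernel a r) t := by
  refine intervalIntegral.integral_mono_interval le_rfl hs hst ?_ ?_
  · refine (ae_restrict_iff' measurableSet_Ioc).2 (Eventually.of_forall fun u hu => ?_)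
    exact (polyKernel_pos ha (by linarith [hu.1])).le
  · refine ((continuousOn_polyKernel a r).mono fun s hs => ?_).intervalIntegrable_of_Icc
      (hs.trans hst)
    simp only [mem_Ioi]
    linarith [hs.1]

/-- The memory term is controlled by its dissipation, up to the tail of the kernel. -/
theorem quadMem_le_tail {a q : ℝ} (ha : 0 < a) (hq : 0 < q) {y : ℝ → ℝ}
    (hy : ContinuousOn y (Ici 0)) {t τ : ℝ} (ht : 0 ≤ t) (hτ : 0 ≤ τ) :
    quadMem (polyKernel a q) y t ≤ (1 + τ) * quadMem (polyKernel a (q + 1)) y t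
      + polyKernel a q τ * ∫ s in (0 : ℝ)..t, (y t - y s) ^ 2 := by
  have hys : ContinuousOn (fun s => (y t - y s) ^ 2) (Ici 0) := (continuousOn_const.sub hy).pow 2
  have h0 : IntervalIntegrable (fun s => (y t - y s) ^ 2) volume 0 t :=
    (hys.mono Icc_subset_Ici_self).intervalIntegrable_of_Icc ht
  have h1 := intervalIntegrable_conv (continuousOn_polyKernel a q) hys ht
  have h2 := intervalIntegrable_conv (continuousOn_polyKernel a (q + 1)) hys ht
  rw [quadMem, quadMem, ← intervalIntegral.integral_const_mul,
    ← intervalIntegral.integral_const_mul,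
    ← intervalIntegral.integral_add (h2.const_mul _) (h0.const_mul _)]
  refine intervalIntegral.integral_mono_on ht h1 ((h2.const_mul _).add (h0.const_mul _))
    fun s hs => ?_
  have hts : 0 ≤ t - s := by linarith [hs.2]
  have hp := (polyKernel_pos (r := q + 1) ha (by linarith : -1 < t - s)).le
  have hp' := (polyKernel_pos (r := q) ha (by linarith : -1 < τ)).le
  -- For ages up to `τ` the kernel is at most `1 + τ` times the dissipating one; for older history
  -- it is at most its value at `τ`.
  rcases le_total (t - s) τ with h | h
  · rw [polyKernel_eq_mul a q (by linarith : -1 < t - s)]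
    have : (1 + (t - s)) * polyKernel a (q + 1) (t - s) * (y t - y s) ^ 2 ≤
        (1 + τ) * polyKernel a (q + 1) (t - s) * (y t - y s) ^ 2 := by gcongr
    have h3 := mul_nonneg hp' (sq_nonneg (y t - y s))
    linarith
  · have h4 := polyKernel_anti ha.le hq.le (by linarith : -1 < τ) h
    have : polyKernel a q (t - s) * (y t - y s) ^ 2 ≤ polyKernel a q τ * (y t - y s) ^ 2 := by
      gcongr
    have h3 : 0 ≤ (1 + τ) * (polyKernel a (q + 1) (t - s) * (y t - y s) ^ 2) := by positivity
    linarith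

theorem quadMem_succ_le {a q : ℝ} (ha : 0 < a) {y : ℝ → ℝ}
    (hy : ContinuousOn y (Ici 0)) {t : ℝ} (ht : 0 ≤ t) :
    quadMem (polyKernel a (q + 1)) y t ≤ quadMem (polyKernel a q) y t := by
  have hys : ContinuousOn (fun s => (y t - y s) ^ 2) (Ici 0) := (continuousOn_const.sub hy).pow 2
  refine intervalIntegral.integral_mono_on ht
    (intervalIntegrable_conv (continuousOn_polyKernel a (q + 1)) hys ht)
    (intervalIntegrable_conv (continuousOn_polyKernel a q) hys ht) fun s hs => ?_
  have hts : 0 ≤ t - s := by linarith [hs.2]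
  have hp := (polyKernel_pos (r := q + 1) ha (by linarith : -1 < t - s)).le
  rw [polyKernel_eq_mul a q (by linarith : -1 < t - s)]
  nlinarith [mul_nonneg (mul_nonneg hts hp) (sq_nonneg (y t - y s))]

/-- The kernel decreases, so every past instant still has weight at least `g(t)`. This is the source
of the lower bound on the energy. -/
theorem le_quadMem {a q : ℝ} (ha : 0 < a) (hq : 0 < q) {y : ℝ → ℝ}
    (hy : ContinuousOn y (Ici 0)) {t : ℝ} (ht : 0 ≤ t) :
    polyKernel a q t * ∫ s in (0 : ℝ)..t, (y t - y s) ^ 2 ≤ quadMem (polyKernel a q) y t := by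
  have hys : ContinuousOn (fun s => (y t - y s) ^ 2) (Ici 0) := (continuousOn_const.sub hy).pow 2
  rw [← intervalIntegral.integral_const_mul]
  refine intervalIntegral.integral_mono_on ht
    (((hys.mono Icc_subset_Ici_self).intervalIntegrable_of_Icc ht).const_mul _)
    (intervalIntegrable_conv (continuousOn_polyKernel a q) hys ht) fun s hs => ?_
  have := polyKernel_anti (t := t) ha.le hq.le (by linarith [hs.2] : -1 < t - s)
    (by linarith [hs.1])
  gcongr

/-- The fundamental theorem of calculus for `g`. It allows the boundary term `a y(t)` of a
differentiated convolution to be split into `g(t) y(t)` and a part that completes a memory deviation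
for the kernel of exponent `q + 1`. -/
theorem mul_mass_polyKernel_succ {a q t : ℝ} (ht : 0 ≤ t) :
    q * mass (polyKernel a (q + 1)) t = a - polyKernel a q t := by
  have h : ∫ s in (0 : ℝ)..t, -(q * polyKernel a (q + 1) s) =
      polyKernel a q t - polyKernel a q 0 := by
    refine intervalIntegral.integral_eq_sub_of_hasDerivAt (fun s hs => ?_) ?_
    · rw [uIcc_of_le ht] at hs
      exact hasDerivAt_polyKernel a q (by linarith [hs.1])
    · refine ContinuousOn.intervalIntegrable_of_Icc ht ?_
      refine ((continuousOn_const.mul (continuousOn_polyKernel a (q + 1))).neg).mono fun s hs => ?_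
      simp only [mem_Ioi]
      linarith [hs.1]
  rw [intervalIntegral.integral_neg, intervalIntegral.integral_const_mul, polyKernel_zero] at h
  rw [mass]
  linarith

theorem hasDerivWithinAt_mass_polyKernel (a q : ℝ) {t : ℝ} (ht : 0 ≤ t) :
    HasDerivWithinAt (mass (polyKernel a q)) (polyKernel a q t) (Ici 0) t := by
  have h := hasDerivWithinAt_conv_polyKernel a q (continuousOn_const (c := (1 : ℝ))) ht
  rw [← mass_eq_conv, mul_mass_polyKernel_succ ht] at h
  exact (h.congr_deriv (by ring)).congr (fun s _ => mass_eq_conv _ s) (mass_eq_conv _ t)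

/-! ### The system satisfied by one Fourier mode -/

/-- `x, y, z` with velocities `X, Y, Z` solve on `[0,∞)` the system satisfied by the coefficients of
`sin (lam x)`, `cos (lam x)`, `cos (lam x)` of a solution of the Bresse system with memory kernel
`polyKernel a q` and `k₁ = k₃ = k`. -/
structure IsMode (l lam ρ₁ ρ₂ k k₂ a q : ℝ) (x y z X Y Z : ℝ → ℝ) : Prop where
  x_deriv : ∀ t, 0 ≤ t → HasDerivWithinAt x (X t) (Ici 0) t
  y_deriv : ∀ t, 0 ≤ t → HasDerivWithinAt y (Y t) (Ici 0) t
  z_deriv : ∀ t, 0 ≤ t → HasDerivWithinAt z (Z t) (Ici 0) t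
  X_deriv : ∀ t, 0 ≤ t → HasDerivWithinAt X
    (-(k * (lam * (lam * x t + y t + l * z t) + l * (lam * z t + l * x t))) / ρ₁) (Ici 0) t
  Y_deriv : ∀ t, 0 ≤ t → HasDerivWithinAt Y
    ((-(k₂ * lam ^ 2 * y t) - k * (lam * x t + y t + l * z t)
      + lam ^ 2 * conv (polyKernel a q) y t) / ρ₂) (Ici 0) t
  Z_deriv : ∀ t, 0 ≤ t → HasDerivWithinAt Z
    (-(k * (lam * (lam * z t + l * x t) + l * (lam * x t + y t + l * z t))) / ρ₁) (Ici 0) t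

/-- The energy of one Fourier mode. -/
def modeEnergy (l lam ρ₁ ρ₂ k k₂ a q : ℝ) (x y z X Y Z : ℝ → ℝ) (t : ℝ) : ℝ :=
  1 / 2 * (ρ₁ * X t ^ 2 + ρ₂ * Y t ^ 2 + ρ₁ * Z t ^ 2
    + (k₂ - mass (polyKernel a q) t) * (lam * y t) ^ 2
    + k * (lam * z t + l * x t) ^ 2 + k * (lam * x t + y t + l * z t) ^ 2)
    + 1 / 2 * (lam ^ 2 * quadMem (polyKernel a q) y t)

/-- The conditions on the coefficients of the system. -/
structure Admissible (l ρ₁ ρ₂ k k₂ a q : ℝ) : Prop where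
  l_pos : 0 < l
  ρ₁_pos : 0 < ρ₁
  ρ₂_pos : 0 < ρ₂
  k_pos : 0 < k
  k₂_pos : 0 < k₂
  speed : k / ρ₁ = k₂ / ρ₂
  a_pos : 0 < a
  q_gt : 2 < q
  mass_lt : ∃ κ, 0 < κ ∧ ∀ t, 0 ≤ t → κ ≤ k₂ - mass (polyKernel a q) t

section Mode

variable {l lam ρ₁ ρ₂ k k₂ a q : ℝ} {x y z X Y Z : ℝ → ℝ}

theorem IsMode.continuousOn_y (h : IsMode l lam ρ₁ ρ₂ k k₂ a q x y z X Y Z) :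
    ContinuousOn y (Ici 0) := fun t ht => (h.y_deriv t ht).continuousWithinAt

theorem IsMode.sub {x₂ y₂ z₂ X₂ Y₂ Z₂ : ℝ → ℝ} (h : IsMode l lam ρ₁ ρ₂ k k₂ a q x y z X Y Z)
    (h₂ : IsMode l lam ρ₁ ρ₂ k k₂ a q x₂ y₂ z₂ X₂ Y₂ Z₂) :
    IsMode l lam ρ₁ ρ₂ k k₂ a q (x - x₂) (y - y₂) (z - z₂) (X - X₂) (Y - Y₂) (Z - Z₂) where
  x_deriv t ht := (h.x_deriv t ht).sub (h₂.x_deriv t ht)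
  y_deriv t ht := (h.y_deriv t ht).sub (h₂.y_deriv t ht)
  z_deriv t ht := (h.z_deriv t ht).sub (h₂.z_deriv t ht)
  X_deriv t ht := ((h.X_deriv t ht).sub (h₂.X_deriv t ht)).congr_deriv (by
    simp only [Pi.sub_apply]; ring)
  Y_deriv t ht := ((h.Y_deriv t ht).sub (h₂.Y_deriv t ht)).congr_deriv (by
    have : conv (polyKernel a q) (y - y₂) t =
        conv (polyKernel a q) y t - conv (polyKernel a q) y₂ t := by
      rw [conv, conv, conv, ← intervalIntegral.integral_sub
        (intervalIntegrable_conv (continuousOn_polyKernel a q) h.continuousOn_y ht)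
        (intervalIntegrable_conv (continuousOn_polyKernel a q) h₂.continuousOn_y ht)]
      refine intervalIntegral.integral_congr fun s _ => ?_
      simp only [Pi.sub_apply]
      ring
    simp only [Pi.sub_apply, this]; ring)
  Z_deriv t ht := ((h.Z_deriv t ht).sub (h₂.Z_deriv t ht)).congr_deriv (by
    simp only [Pi.sub_apply]; ring)

theorem IsMode.hasDerivWithinAt_shear (h : IsMode l lam ρ₁ ρ₂ k k₂ a q x y z X Y Z) {t : ℝ}
    (ht : 0 ≤ t) : HasDerivWithinAt (fun t => lam * x t + y t + l * z t)
      (lam * X t + Y t + l * Z t) (Ici 0) t :=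
  (((h.x_deriv t ht).const_mul lam).add (h.y_deriv t ht)).add ((h.z_deriv t ht).const_mul l)

theorem IsMode.hasDerivWithinAt_axial (h : IsMode l lam ρ₁ ρ₂ k k₂ a q x y z X Y Z) {t : ℝ}
    (ht : 0 ≤ t) : HasDerivWithinAt (fun t => lam * z t + l * x t)
      (lam * Z t + l * X t) (Ici 0) t :=
  ((h.z_deriv t ht).const_mul lam).add ((h.x_deriv t ht).const_mul l)

/-- The energy identity. -/
theorem IsMode.hasDerivWithinAt_modeEnergy (hρ₁ : ρ₁ ≠ 0) (hρ₂ : ρ₂ ≠ 0)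
    (h : IsMode l lam ρ₁ ρ₂ k k₂ a q x y z X Y Z) {t : ℝ} (ht : 0 ≤ t) :
    HasDerivWithinAt (modeEnergy l lam ρ₁ ρ₂ k k₂ a q x y z X Y Z)
      (-(1 / 2 * lam ^ 2 * (q * quadMem (polyKernel a (q + 1)) y t
        + polyKernel a q t * y t ^ 2))) (Ici 0) t := by
  have hy := h.continuousOn_y
  -- Expanding the square in the memory term cancels the mass in the coefficient `k₂ - mass`, so
  -- only convolutions remain to be differentiated.
  have he : ∀ s, 0 ≤ s → modeEnergy l lam ρ₁ ρ₂ k k₂ a q x y z X Y Z s =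
      1 / 2 * (ρ₁ * X s ^ 2 + ρ₂ * Y s ^ 2 + ρ₁ * Z s ^ 2 + k₂ * lam ^ 2 * y s ^ 2
        + k * (lam * z s + l * x s) ^ 2 + k * (lam * x s + y s + l * z s) ^ 2)
      - lam ^ 2 * (y s * conv (polyKernel a q) y s)
      + 1 / 2 * lam ^ 2 * conv (polyKernel a q) (fun u => y u ^ 2) s := by
    intro s hs
    rw [modeEnergy, quadMem_eq (continuousOn_polyKernel a q) hy hs]
    ring
  refine HasDerivWithinAt.congr ?_ (fun s hs => he s hs) (he t ht)
  have hX := ((h.X_deriv t ht).pow 2).const_mul ρ₁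
  have hY := ((h.Y_deriv t ht).pow 2).const_mul ρ₂
  have hZ := ((h.Z_deriv t ht).pow 2).const_mul ρ₁
  have hy2 := ((h.y_deriv t ht).pow 2).const_mul (k₂ * lam ^ 2)
  have hA := ((h.hasDerivWithinAt_axial ht).pow 2).const_mul k
  have hS := ((h.hasDerivWithinAt_shear ht).pow 2).const_mul k
  have hc := ((h.y_deriv t ht).mul (hasDerivWithinAt_conv_polyKernel a q hy ht)).const_mul (lam ^ 2)
  have hc2 := (hasDerivWithinAt_conv_polyKernel a q (hy.pow 2) ht).const_mul (1 / 2 * lam ^ 2)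
  refine ((((((((hX.add hY).add hZ).add hy2).add hA).add hS).const_mul (1 / 2)).sub hc).add
    hc2).congr_deriv ?_
  rw [quadMem_eq (continuousOn_polyKernel a (q + 1)) hy ht]
  have e1 : ∀ u, (y ^ 2) u = y u ^ 2 := fun u => rfl
  have e2 : conv (polyKernel a (q + 1)) (y ^ 2) t = conv (polyKernel a (q + 1)) (fun s => y s ^ 2) t
    := rfl
  have hm := mul_mass_polyKernel_succ (a := a) (q := q) ht
  have hm' : polyKernel a q t = a - q * mass (polyKernel a (q + 1)) t := by linarith
  rw [e1, e2, hm']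
  simp only [Nat.cast_ofNat, Nat.add_one_sub_one, pow_one]
  field_simp
  ring

theorem Admissible.q_pos (H : Admissible l ρ₁ ρ₂ k k₂ a q) : 0 < q := by linarith [H.q_gt]

theorem modeEnergy_antitoneOn (H : Admissible l ρ₁ ρ₂ k k₂ a q)
    (h : IsMode l lam ρ₁ ρ₂ k k₂ a q x y z X Y Z) :
    AntitoneOn (modeEnergy l lam ρ₁ ρ₂ k k₂ a q x y z X Y Z) (Ici 0) := by
  refine antitoneOn_of_hasDerivWithinAt_nonpos (convex_Ici 0)
    (fun t ht => (h.hasDerivWithinAt_modeEnergy H.ρ₁_pos.ne' H.ρ₂_pos.ne' ht).continuousWithinAt)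
    (fun t ht => (h.hasDerivWithinAt_modeEnergy H.ρ₁_pos.ne' H.ρ₂_pos.ne'
      (interior_subset ht)).mono interior_subset) fun t ht => ?_
  have ht0 : 0 ≤ t := interior_subset ht
  have h1 := quadMem_nonneg (g := polyKernel a (q + 1))
    (fun s hs => (polyKernel_pos H.a_pos (by linarith)).le) y ht0
  have h2 := (polyKernel_pos (r := q) H.a_pos (by linarith : -1 < t)).le
  have := H.q_pos
  have : 0 ≤ 1 / 2 * lam ^ 2 * (q * quadMem (polyKernel a (q + 1)) y t
        + polyKernel a q t * y t ^ 2) := by positivity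
  linarith

/-- The energy controls all of its constituents. -/
theorem exists_le_modeEnergy (H : Admissible l ρ₁ ρ₂ k k₂ a q) :
    ∃ C, 0 < C ∧ ∀ (lam : ℝ) (x y z X Y Z : ℝ → ℝ) (t : ℝ), 0 ≤ t →
      X t ^ 2 + Y t ^ 2 + Z t ^ 2 + (lam * y t) ^ 2 + (lam * x t + y t + l * z t) ^ 2
        + (lam * z t + l * x t) ^ 2 + lam ^ 2 * quadMem (polyKernel a q) y t
      ≤ C * modeEnergy l lam ρ₁ ρ₂ k k₂ a q x y z X Y Z t := by
  obtain ⟨κ, hκ, hm⟩ := H.mass_lt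
  have h1 := H.ρ₁_pos
  have h2 := H.ρ₂_pos
  have h3 := H.k_pos
  have key : ∀ c C' : ℝ, 0 < c → 1 / c ≤ C' → ∀ u d : ℝ, 0 ≤ u → c ≤ d → u ≤ C' * (d * u) := by
    intro c C' hc hC u d hu hd
    have : 1 ≤ C' * d := by
      calc 1 = 1 / c * c := by field_simp
        _ ≤ C' * d := mul_le_mul hC hd hc.le ((one_div_pos.2 hc).le.trans hC)
    nlinarith
  refine ⟨2 * (1 / ρ₁ + 1 / ρ₂ + 1 / k + 1 / κ + 1), by positivity, ?_⟩
  intro lam x y z X Y Z t ht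
  set C' := 1 / ρ₁ + 1 / ρ₂ + 1 / k + 1 / κ + 1 with hC'
  have p1 : 0 < 1 / ρ₁ := by positivity
  have p2 : 0 < 1 / ρ₂ := by positivity
  have p3 : 0 < 1 / k := by positivity
  have p4 : 0 < 1 / κ := by positivity
  have hΓ := mul_nonneg (sq_nonneg lam) (quadMem_nonneg (g := polyKernel a q)
    (fun s hs => (polyKernel_pos H.a_pos (by linarith)).le) y ht)
  have a1 := key ρ₁ C' h1 (by linarith) _ ρ₁ (sq_nonneg (X t)) le_rfl
  have a2 := key ρ₂ C' h2 (by linarith) _ ρ₂ (sq_nonneg (Y t)) le_rfl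
  have a3 := key ρ₁ C' h1 (by linarith) _ ρ₁ (sq_nonneg (Z t)) le_rfl
  have a4 := key κ C' hκ (by linarith) _ _ (sq_nonneg (lam * y t)) (hm t ht)
  have a5 := key k C' h3 (by linarith) _ k (sq_nonneg (lam * x t + y t + l * z t)) le_rfl
  have a6 := key k C' h3 (by linarith) _ k (sq_nonneg (lam * z t + l * x t)) le_rfl
  have a7 := key 1 C' one_pos (by simp only [div_one]; linarith) _ 1 hΓ le_rfl
  rw [modeEnergy]
  linarith

theorem modeEnergy_nonneg (H : Admissible l ρ₁ ρ₂ k k₂ a q) (lam : ℝ) (x y z X Y Z : ℝ → ℝ)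
    {t : ℝ} (ht : 0 ≤ t) : 0 ≤ modeEnergy l lam ρ₁ ρ₂ k k₂ a q x y z X Y Z t := by
  obtain ⟨C, hC, h⟩ := exists_le_modeEnergy H
  have h1 := h lam x y z X Y Z t ht
  have hΓ := mul_nonneg (sq_nonneg lam) (quadMem_nonneg (g := polyKernel a q)
    (fun s hs => (polyKernel_pos H.a_pos (by linarith)).le) y ht)
  have : 0 ≤ C * modeEnergy l lam ρ₁ ρ₂ k k₂ a q x y z X Y Z t := le_trans (by positivity) h1
  exact nonneg_of_mul_nonneg_right this hC

theorem mass_le (H : Admissible l ρ₁ ρ₂ k k₂ a q) {t : ℝ} (ht : 0 ≤ t) :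
    mass (polyKernel a q) t ≤ k₂ := by
  obtain ⟨κ, hκ, h⟩ := H.mass_lt
  linarith [h t ht]

theorem exists_modeEnergy_le (H : Admissible l ρ₁ ρ₂ k k₂ a q) :
    ∃ C, 0 < C ∧ ∀ (lam : ℝ) (x y z X Y Z : ℝ → ℝ) (t : ℝ), 0 ≤ t →
      modeEnergy l lam ρ₁ ρ₂ k k₂ a q x y z X Y Z t ≤
      C * (X t ^ 2 + Y t ^ 2 + Z t ^ 2 + (lam * y t) ^ 2 + (lam * x t + y t + l * z t) ^ 2
        + (lam * z t + l * x t) ^ 2 + lam ^ 2 * quadMem (polyKernel a q) y t) := by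
  have h1 := H.ρ₁_pos
  have h2 := H.ρ₂_pos
  have h3 := H.k_pos
  have h4 := H.k₂_pos
  refine ⟨ρ₁ + ρ₂ + k + k₂ + 1, by positivity, ?_⟩
  intro lam x y z X Y Z t ht
  have hΓ := mul_nonneg (sq_nonneg lam) (quadMem_nonneg (g := polyKernel a q)
    (fun s hs => (polyKernel_pos H.a_pos (by linarith)).le) y ht)
  have hm : 0 ≤ mass (polyKernel a q) t := intervalIntegral.integral_nonneg ht fun s hs =>
    (polyKernel_pos H.a_pos (by linarith [hs.1])).le
  have hm' := mass_le H ht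
  have key : ∀ d u : ℝ, 0 ≤ u → d ≤ ρ₁ + ρ₂ + k + k₂ + 1 → 0 ≤ d →
      1 / 2 * (d * u) ≤ (ρ₁ + ρ₂ + k + k₂ + 1) * u := by
    intro d u hu hd hd0
    nlinarith [mul_le_mul_of_nonneg_right hd hu, mul_nonneg hd0 hu]
  have a1 := key ρ₁ _ (sq_nonneg (X t)) (by linarith) h1.le
  have a2 := key ρ₂ _ (sq_nonneg (Y t)) (by linarith) h2.le
  have a3 := key ρ₁ _ (sq_nonneg (Z t)) (by linarith) h1.le
  have a4 := key _ _ (sq_nonneg (lam * y t)) (by linarith) (by linarith :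
    0 ≤ k₂ - mass (polyKernel a q) t)
  have a5 := key k _ (sq_nonneg (lam * x t + y t + l * z t)) (by linarith) h3.le
  have a6 := key k _ (sq_nonneg (lam * z t + l * x t)) (by linarith) h3.le
  have a7 := key 1 _ hΓ (by linarith) zero_le_one
  rw [modeEnergy]
  linarith

end Mode

/-! ### Multipliers -/

theorem mul_le_young {ε : ℝ} (hε : 0 < ε) (u v : ℝ) : u * v ≤ ε * u ^ 2 + v ^ 2 / (4 * ε) := by
  have h : ε * u ^ 2 + v ^ 2 / (4 * ε) - u * v = (2 * ε * u - v) ^ 2 / (4 * ε) := by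
    field_simp
    ring
  have : 0 ≤ (2 * ε * u - v) ^ 2 / (4 * ε) := by positivity
  linarith

/-- In this and the next bounds `r = 1/lam`, `G` is the mass, `b = lam y`, `S` the shear, `Γ` the
memory term, and `μ`, `ν` are `lam` times the memory deviations for exponents `q` and `q + 1`. Every
product other than `G Y²` has a factor `μ` or `ν`, so Young's inequality moves it into `Γ`.
Frequencies enter only through `r ≤ R`, so `C` is uniform in the mode. -/
theorem exists_memory_multiplier_bound {ρ₂ k k₂ q R G₁ c₁ c₂ ε : ℝ} (hρ₂ : 0 < ρ₂)
    (hG₁ : 0 < G₁) (hc₁ : 0 ≤ c₁) (hc₂ : 0 ≤ c₂) (hε : 0 < ε) :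
    ∃ C, 0 < C ∧ ∀ r G b S Y μ ν Γ : ℝ, 0 < r → r ≤ R → G₁ ≤ G → G ≤ k₂ → 0 ≤ Γ →
      μ ^ 2 ≤ c₁ * Γ → ν ^ 2 ≤ c₂ * Γ →
      ((k₂ - G) * b + k * S * r + μ) * μ - ρ₂ * G * Y ^ 2 + ρ₂ * q * Y * (r * ν)
        ≤ -(ρ₂ * G₁ / 2) * Y ^ 2 + ε * (b ^ 2 + S ^ 2) + C * Γ := by
  refine ⟨k₂ ^ 2 * c₁ / (4 * ε) + k ^ 2 * R ^ 2 * c₁ / (4 * ε) + c₁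
    + (ρ₂ * q * R) ^ 2 * c₂ / (4 * (ρ₂ * G₁ / 2)) + 1, by positivity, ?_⟩
  intro r G b S Y μ ν Γ hr hrR hG hGk hΓ hμ hν
  have hr2 : r ^ 2 ≤ R ^ 2 := by gcongr
  have hGG : (k₂ - G) ^ 2 ≤ k₂ ^ 2 := by
    have : 0 ≤ k₂ - G := by linarith
    have : k₂ - G ≤ k₂ := by linarith
    gcongr
  have y1 := mul_le_young hε b ((k₂ - G) * μ)
  have y2 := mul_le_young hε S (k * r * μ)
  have y3 := mul_le_young (by positivity : 0 < ρ₂ * G₁ / 2) Y (ρ₂ * q * r * ν)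
  have z1 : ((k₂ - G) * μ) ^ 2 / (4 * ε) ≤ k₂ ^ 2 * c₁ / (4 * ε) * Γ := by
    calc ((k₂ - G) * μ) ^ 2 / (4 * ε) = (k₂ - G) ^ 2 * μ ^ 2 / (4 * ε) := by ring
      _ ≤ k₂ ^ 2 * (c₁ * Γ) / (4 * ε) := by gcongr
      _ = _ := by ring
  have z2 : (k * r * μ) ^ 2 / (4 * ε) ≤ k ^ 2 * R ^ 2 * c₁ / (4 * ε) * Γ := by
    calc (k * r * μ) ^ 2 / (4 * ε) = k ^ 2 * r ^ 2 * μ ^ 2 / (4 * ε) := by ring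
      _ ≤ k ^ 2 * R ^ 2 * (c₁ * Γ) / (4 * ε) := by gcongr
      _ = _ := by ring
  have z3 : (ρ₂ * q * r * ν) ^ 2 / (4 * (ρ₂ * G₁ / 2)) ≤
      (ρ₂ * q * R) ^ 2 * c₂ / (4 * (ρ₂ * G₁ / 2)) * Γ := by
    calc (ρ₂ * q * r * ν) ^ 2 / (4 * (ρ₂ * G₁ / 2))
        = (ρ₂ * q) ^ 2 * r ^ 2 * ν ^ 2 / (4 * (ρ₂ * G₁ / 2)) := by ring
      _ ≤ (ρ₂ * q) ^ 2 * R ^ 2 * (c₂ * Γ) / (4 * (ρ₂ * G₁ / 2)) := by gcongr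
      _ = _ := by ring
  have z4 : ρ₂ * G₁ * Y ^ 2 ≤ ρ₂ * G * Y ^ 2 := by gcongr
  nlinarith

/-- Here `s = lam σ` with `σ = (lam X - l Z)/(lam² - l²)`; the weight `ε/3` compensates the factor 3
in the bound on `s²`. -/
theorem exists_rotation_multiplier_bound {ρ₁ ρ₂ k₂ R κ c₁ ε : ℝ} (hρ₂ : 0 < ρ₂)
    (hκ : 0 < κ) (hc₁ : 0 ≤ c₁) (hε : 0 < ε) :
    ∃ C, 0 < C ∧ ∀ r G b s X Y Z μ Γ : ℝ, 0 < r → r ≤ R → κ ≤ k₂ - G → 0 ≤ Γ →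
      μ ^ 2 ≤ c₁ * Γ → s ^ 2 ≤ 3 * (X ^ 2 + Z ^ 2) →
      ρ₂ * Y ^ 2 - (k₂ - G) * b ^ 2 - μ * b - ρ₁ * Y * (r * s)
        ≤ -(κ / 2) * b ^ 2 + ε * (X ^ 2 + Z ^ 2) + C * (Y ^ 2 + Γ) := by
  refine ⟨ρ₂ + c₁ / (4 * (κ / 2)) + (ρ₁ * R) ^ 2 / (4 * (ε / 3)), by positivity, ?_⟩
  intro r G b s X Y Z μ Γ hr hrR hG hΓ hμ hs
  have hr2 : r ^ 2 ≤ R ^ 2 := by gcongr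
  have y1 := mul_le_young (by positivity : 0 < κ / 2) b (-μ)
  have y2 := mul_le_young (by positivity : 0 < ε / 3) s (-(ρ₁ * r * Y))
  have z1 : (-μ) ^ 2 / (4 * (κ / 2)) ≤ c₁ / (4 * (κ / 2)) * Γ := by
    calc (-μ) ^ 2 / (4 * (κ / 2)) = μ ^ 2 / (4 * (κ / 2)) := by ring
      _ ≤ (c₁ * Γ) / (4 * (κ / 2)) := by gcongr
      _ = _ := by ring
  have z2 : (-(ρ₁ * r * Y)) ^ 2 / (4 * (ε / 3)) ≤ (ρ₁ * R) ^ 2 / (4 * (ε / 3)) * Y ^ 2 := by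
    calc (-(ρ₁ * r * Y)) ^ 2 / (4 * (ε / 3)) = ρ₁ ^ 2 * r ^ 2 * Y ^ 2 / (4 * (ε / 3)) := by ring
      _ ≤ ρ₁ ^ 2 * R ^ 2 * Y ^ 2 / (4 * (ε / 3)) := by gcongr
      _ = _ := by ring
  have z3 : κ * b ^ 2 ≤ (k₂ - G) * b ^ 2 := by gcongr
  have w1 : 0 ≤ (c₁ / (4 * (κ / 2)) + (ρ₁ * R) ^ 2 / (4 * (ε / 3)) + ρ₂) * (Y ^ 2 + Γ)
      - (c₁ / (4 * (κ / 2)) * Γ + (ρ₁ * R) ^ 2 / (4 * (ε / 3)) * Y ^ 2 + ρ₂ * Y ^ 2) := by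
    have e : (c₁ / (4 * (κ / 2)) + (ρ₁ * R) ^ 2 / (4 * (ε / 3)) + ρ₂) * (Y ^ 2 + Γ)
      - (c₁ / (4 * (κ / 2)) * Γ + (ρ₁ * R) ^ 2 / (4 * (ε / 3)) * Y ^ 2 + ρ₂ * Y ^ 2) =
      c₁ / (4 * (κ / 2)) * Y ^ 2 + (ρ₁ * R) ^ 2 / (4 * (ε / 3)) * Γ + ρ₂ * Γ := by ring
    rw [e]
    positivity
  have w2 : ε / 3 * s ^ 2 ≤ ε / 3 * (3 * (X ^ 2 + Z ^ 2)) := by gcongr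
  linarith

/-- Here `γ = g(t)` and `τ = lam X + l Z - lam² σ`, which is of size `l` and not `lam`. The share of
`ε` is one half for `τ` and one quarter for each of the two products with `s`. -/
theorem exists_shear_multiplier_bound {l k₂ κ q a c₂ ε : ℝ} (hc₂ : 0 ≤ c₂) (hε : 0 < ε) :
    ∃ C, 0 < C ∧ ∀ γ b s S τ X Y Z ν Γ : ℝ, 0 ≤ γ → γ ≤ a → 0 ≤ Γ →
      ν ^ 2 ≤ c₂ * Γ → s ^ 2 ≤ 3 * (X ^ 2 + Z ^ 2) → τ ^ 2 ≤ 8 * l ^ 2 * (X ^ 2 + Z ^ 2) →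
      -κ * S ^ 2 + Y * (Y + τ) + 1 / k₂ * (γ * b + q * ν) * s
        ≤ -κ * S ^ 2 + ε * (X ^ 2 + Z ^ 2) + C * (Y ^ 2 + b ^ 2 + Γ) := by
  set d := ε / (16 * (l ^ 2 + 1)) with hd
  have hd0 : 0 < d := by positivity
  refine ⟨1 + 1 / (4 * d) + a ^ 2 / k₂ ^ 2 / (4 * (ε / 12)) + q ^ 2 / k₂ ^ 2 * c₂ / (4 * (ε / 12)),
    by positivity, ?_⟩
  intro γ b s S τ X Y Z ν Γ hγ hγa hΓ hν hs hτ
  have y1 := mul_le_young hd0 τ Y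
  have y2 := mul_le_young (by positivity : 0 < ε / 12) s (1 / k₂ * γ * b)
  have y3 := mul_le_young (by positivity : 0 < ε / 12) s (1 / k₂ * q * ν)
  have hXZ : 0 ≤ X ^ 2 + Z ^ 2 := by positivity
  have z1 : d * τ ^ 2 ≤ ε / 2 * (X ^ 2 + Z ^ 2) := by
    calc d * τ ^ 2 ≤ d * (8 * l ^ 2 * (X ^ 2 + Z ^ 2)) := by gcongr
      _ ≤ d * (8 * (l ^ 2 + 1) * (X ^ 2 + Z ^ 2)) := by gcongr; linarith
      _ = _ := by rw [hd]; field_simp; ring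
  have z2 : (1 / k₂ * γ * b) ^ 2 / (4 * (ε / 12)) ≤ a ^ 2 / k₂ ^ 2 / (4 * (ε / 12)) * b ^ 2 := by
    calc (1 / k₂ * γ * b) ^ 2 / (4 * (ε / 12)) = γ ^ 2 / k₂ ^ 2 / (4 * (ε / 12)) * b ^ 2 := by ring
      _ ≤ _ := by gcongr
  have z3 : (1 / k₂ * q * ν) ^ 2 / (4 * (ε / 12)) ≤ q ^ 2 / k₂ ^ 2 * c₂ / (4 * (ε / 12)) * Γ := by
    calc (1 / k₂ * q * ν) ^ 2 / (4 * (ε / 12)) = q ^ 2 / k₂ ^ 2 * ν ^ 2 / (4 * (ε / 12)) := by ring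
      _ ≤ q ^ 2 / k₂ ^ 2 * (c₂ * Γ) / (4 * (ε / 12)) := by gcongr
      _ = _ := by ring
  have w2 : ε / 12 * s ^ 2 ≤ ε / 12 * (3 * (X ^ 2 + Z ^ 2)) := by gcongr
  set A₁ := 1 / (4 * d)
  set A₂ := a ^ 2 / k₂ ^ 2 / (4 * (ε / 12))
  set A₃ := q ^ 2 / k₂ ^ 2 * c₂ / (4 * (ε / 12))
  have hA₁ : 0 ≤ A₁ := by positivity
  have hA₂ : 0 ≤ A₂ := by positivity
  have hA₃ : 0 ≤ A₃ := by positivity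
  have e1 : Y ^ 2 / (4 * d) = A₁ * Y ^ 2 := by simp only [A₁]; ring
  have w1 : 0 ≤ A₁ * (b ^ 2 + Γ) + A₂ * (Y ^ 2 + Γ) + A₃ * (Y ^ 2 + b ^ 2) + (b ^ 2 + Γ) := by
    positivity
  linarith

/-- The first product alone produces `l X²` with the wrong sign; the correction with factor 4 turns
it into `-3 l X²`, of which `2 l` is spent on the product `X Z`, `l/2` on `X Y`, and `l/2` is left.
Here `A` is the axial term, `u = l/lam` and `r = 1/lam`. -/
theorem axial_multiplier_bound {l u c A S X Y Z r : ℝ} (hl : 0 < l) (hc : 0 < c) (hu : 0 ≤ u)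
    (hu2 : u ≤ 1 / 2) (hr : l * r = u) :
    -(l * c * A ^ 2) - l * Z ^ 2 + l * X ^ 2 - Y * Z + l * c * S ^ 2
      + 4 * l * (-X ^ 2 + c * S ^ 2 + u * c * A * S - r * X * Y - u * X * Z)
      ≤ -(l * c / 2 * A ^ 2 + l / 4 * Z ^ 2 + l / 2 * X ^ 2) + 7 * l * c * S ^ 2
        + 3 / l * Y ^ 2 := by
  have y1 := mul_le_young (by positivity : 0 < l / 4) (-Z) Y
  have y2 := mul_le_young (by positivity : 0 < l / 2) (-X) (4 * u * Y)
  have y3 : 4 * l * (u * c * A * S) ≤ l * c / 2 * A ^ 2 + 2 * l * c * S ^ 2 := by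
    have : 0 ≤ l * c / 2 * (A - 4 * u * S) ^ 2 := by positivity
    have h1 : u ^ 2 ≤ 1 / 4 := by nlinarith
    have h2 : l * c * S ^ 2 * u ^ 2 ≤ l * c * S ^ 2 * (1 / 4) := by gcongr
    nlinarith
  have y4 : 4 * l * (-(u * X * Z)) ≤ 2 * l * X ^ 2 + l / 2 * Z ^ 2 := by
    have : 0 ≤ l / 2 * (Z + 4 * u * X) ^ 2 := by positivity
    have h1 : u ^ 2 ≤ 1 / 4 := by nlinarith
    have h2 : l * X ^ 2 * u ^ 2 ≤ l * X ^ 2 * (1 / 4) := by gcongr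
    nlinarith
  have e1 : Y ^ 2 / (4 * (l / 4)) = 1 / l * Y ^ 2 := by field_simp
  have e2 : (4 * u * Y) ^ 2 / (4 * (l / 2)) ≤ 2 / l * Y ^ 2 := by
    have h1 : u ^ 2 ≤ 1 / 4 := by nlinarith
    calc (4 * u * Y) ^ 2 / (4 * (l / 2)) = 8 * u ^ 2 / l * Y ^ 2 := by field_simp; ring
      _ ≤ 8 * (1 / 4) / l * Y ^ 2 := by gcongr
      _ = _ := by ring
  have e3 : 3 / l * Y ^ 2 = 1 / l * Y ^ 2 + 2 / l * Y ^ 2 := by ring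
  have e4 : 4 * l * (r * X * Y) = 4 * u * X * Y := by rw [← hr]; ring
  nlinarith

/-- Choice of the weights of the four multipliers. -/
theorem exists_weights {m₀ C₀ κ m₁ m₂ : ℝ} (hm₀ : 0 < m₀) (hC₀ : 0 < C₀) (hκ : 0 < κ)
    (hm₁ : 0 < m₁) (hm₂ : 0 < m₂) {P₁ P₂ P₃ : ℝ → ℝ → Prop}
    (h₁ : ∀ ε, 0 < ε → ∃ C, 0 < C ∧ P₁ ε C) (h₂ : ∀ ε, 0 < ε → ∃ C, 0 < C ∧ P₂ ε C)
    (h₃ : ∀ ε, 0 < ε → ∃ C, 0 < C ∧ P₃ ε C) :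
    ∃ N₁ N₂ N₃ ε₁ ε₂ ε₃ C₁ C₂ C₃ m C : ℝ, 0 < N₁ ∧ 0 < N₂ ∧ 0 < N₃ ∧ 0 < m ∧ 0 < C ∧
      P₁ ε₁ C₁ ∧ P₂ ε₂ C₂ ∧ P₃ ε₃ C₃ ∧
      ∀ D₀ D₁ D₂ D₃ α x s v b Γ : ℝ, 0 ≤ α → 0 ≤ x → 0 ≤ s → 0 ≤ v → 0 ≤ b →
        D₀ ≤ -m₀ * (α + x) + C₀ * (s + v) →
        D₃ ≤ -κ * s + ε₃ * x + C₃ * (v + b + Γ) →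
        D₂ ≤ -m₁ * b + ε₂ * x + C₂ * (v + Γ) →
        D₁ ≤ -m₂ * v + ε₁ * (b + s) + C₁ * Γ →
        D₀ + N₃ * D₃ + N₂ * D₂ + N₁ * D₁ ≤ -m * (α + x + s + v + b + Γ) + C * Γ := by
  -- The order avoids circularity. Each `N` must dominate the constants `C` found before it, and
  -- each `ε` is fixed after its own `N` so that their product is small; only then is the next `C`
  -- known. The two quarters of `m₀` leave half of the `x` term.
  obtain ⟨N₃, hN₃, e₃⟩ : ∃ N, 0 < N ∧ N * κ = C₀ + 1 :=
    ⟨(C₀ + 1) / κ, by positivity, by field_simp⟩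
  obtain ⟨ε₃, hε₃, f₃⟩ : ∃ ε, 0 < ε ∧ N₃ * ε = m₀ / 4 :=
    ⟨m₀ / (4 * N₃), by positivity, by field_simp⟩
  obtain ⟨C₃, hC₃, hP₃⟩ := h₃ ε₃ hε₃
  obtain ⟨N₂, hN₂, e₂⟩ : ∃ N, 0 < N ∧ N * m₁ = N₃ * C₃ + 1 :=
    ⟨(N₃ * C₃ + 1) / m₁, by positivity, by field_simp⟩
  obtain ⟨ε₂, hε₂, f₂⟩ : ∃ ε, 0 < ε ∧ N₂ * ε = m₀ / 4 :=
    ⟨m₀ / (4 * N₂), by positivity, by field_simp⟩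
  obtain ⟨C₂, hC₂, hP₂⟩ := h₂ ε₂ hε₂
  obtain ⟨N₁, hN₁, e₁⟩ : ∃ N, 0 < N ∧ N * m₂ = C₀ + N₃ * C₃ + N₂ * C₂ + 1 :=
    ⟨(C₀ + N₃ * C₃ + N₂ * C₂ + 1) / m₂, by positivity, by field_simp⟩
  obtain ⟨ε₁, hε₁, f₁⟩ : ∃ ε, 0 < ε ∧ N₁ * ε = 1 / 2 :=
    ⟨1 / (2 * N₁), by positivity, by field_simp⟩
  obtain ⟨C₁, hC₁, hP₁⟩ := h₁ ε₁ hε₁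
  obtain ⟨m, hm, hm₀', hm1⟩ : ∃ m, 0 < m ∧ m ≤ m₀ / 2 ∧ m ≤ 1 / 2 :=
    ⟨min (m₀ / 2) (1 / 2), by positivity, min_le_left _ _, min_le_right _ _⟩
  refine ⟨N₁, N₂, N₃, ε₁, ε₂, ε₃, C₁, C₂, C₃, m, N₃ * C₃ + N₂ * C₂ + N₁ * C₁ + m, hN₁, hN₂, hN₃,
    hm, by positivity, hP₁, hP₂, hP₃, ?_⟩
  intro D₀ D₁ D₂ D₃ α x s v b Γ hα hx hs hv hb d₀ d₃ d₂ d₁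
  have g₃ := mul_le_mul_of_nonneg_left d₃ hN₃.le
  have g₂ := mul_le_mul_of_nonneg_left d₂ hN₂.le
  have g₁ := mul_le_mul_of_nonneg_left d₁ hN₁.le
  have k₃ : N₃ * (-κ * s + ε₃ * x + C₃ * (v + b + Γ)) =
      -(C₀ + 1) * s + m₀ / 4 * x + N₃ * C₃ * (v + b + Γ) := by rw [← e₃, ← f₃]; ring
  have k₂ : N₂ * (-m₁ * b + ε₂ * x + C₂ * (v + Γ)) =
      -(N₃ * C₃ + 1) * b + m₀ / 4 * x + N₂ * C₂ * (v + Γ) := by rw [← e₂, ← f₂]; ring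
  have k₁ : N₁ * (-m₂ * v + ε₁ * (b + s) + C₁ * Γ) =
      -(C₀ + N₃ * C₃ + N₂ * C₂ + 1) * v + 1 / 2 * (b + s) + N₁ * C₁ * Γ := by
    rw [← e₁, ← f₁]; ring
  have q1 := mul_le_mul_of_nonneg_right hm₀' hα
  have q2 := mul_le_mul_of_nonneg_right hm₀' hx
  have q3 := mul_le_mul_of_nonneg_right hm1 hs
  have q4 := mul_le_mul_of_nonneg_right hm1 hv
  have q5 := mul_le_mul_of_nonneg_right hm1 hb
  have q6 : 0 ≤ m₀ / 2 * α := by positivity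
  nlinarith

/-! ### Multiplier identities along a mode and the Lyapunov functional -/

section Multipliers

variable {l lam ρ₁ ρ₂ k k₂ a q : ℝ} {x y z X Y Z : ℝ → ℝ}

/-- In `lam X' - l Z'` the axial terms cancel and the shear terms combine with the factor `lam² -
l²`. The quotient `σ` thus acts as a momentum driven by the shear alone. -/
theorem IsMode.hasDerivWithinAt_rotation (hlam : lam ^ 2 - l ^ 2 ≠ 0) (hρ₁ : ρ₁ ≠ 0)
    (h : IsMode l lam ρ₁ ρ₂ k k₂ a q x y z X Y Z) {t : ℝ} (ht : 0 ≤ t) :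
    HasDerivWithinAt (fun t => (lam * X t - l * Z t) / (lam ^ 2 - l ^ 2))
      (-(k / ρ₁ * (lam * x t + y t + l * z t))) (Ici 0) t := by
  refine ((((h.X_deriv t ht).const_mul lam).sub ((h.Z_deriv t ht).const_mul l)).div_const
    _).congr_deriv ?_
  field_simp
  ring

/-- The products of order `lam` cancel in the derivative of `X A - S Z`, because the shear and the
axial force carry the same stiffness `k`; what remains has size `l` apart from `Y Z`. -/
theorem IsMode.hasDerivWithinAt_axialMultiplier (hlam : lam ≠ 0) (hρ₁ : ρ₁ ≠ 0)
    (h : IsMode l lam ρ₁ ρ₂ k k₂ a q x y z X Y Z) {t : ℝ} (ht : 0 ≤ t) :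
    HasDerivWithinAt (fun t => X t * (lam * z t + l * x t) - (lam * x t + y t + l * z t) * Z t
        - 4 * l / lam * (X t * (lam * x t + y t + l * z t)))
      (-(l * (k / ρ₁) * (lam * z t + l * x t) ^ 2) - l * Z t ^ 2 + l * X t ^ 2 - Y t * Z t
        + l * (k / ρ₁) * (lam * x t + y t + l * z t) ^ 2
        + 4 * l * (-X t ^ 2 + k / ρ₁ * (lam * x t + y t + l * z t) ^ 2
          + l / lam * (k / ρ₁) * (lam * z t + l * x t) * (lam * x t + y t + l * z t)
          - 1 / lam * X t * Y t - l / lam * X t * Z t)) (Ici 0) t := by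
  refine ((((h.X_deriv t ht).mul (h.hasDerivWithinAt_axial ht)).sub
    ((h.hasDerivWithinAt_shear ht).mul (h.Z_deriv t ht))).sub
    (((h.X_deriv t ht).mul (h.hasDerivWithinAt_shear ht)).const_mul (4 * l / lam))).congr_deriv ?_
  field_simp
  ring

/-- Differentiating the memory deviation produces `mass · Y`, hence the damping `-ρ₂ mass Y²` of the
angular velocity. -/
theorem IsMode.hasDerivWithinAt_memoryMultiplier (hlam : lam ≠ 0) (hρ₂ : ρ₂ ≠ 0)
    (h : IsMode l lam ρ₁ ρ₂ k k₂ a q x y z X Y Z) {t : ℝ} (ht : 0 ≤ t) :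
    HasDerivWithinAt
      (fun t => -ρ₂ * (Y t * (mass (polyKernel a q) t * y t - conv (polyKernel a q) y t)))
      (((k₂ - mass (polyKernel a q) t) * (lam * y t)
        + k * (lam * x t + y t + l * z t) * (1 / lam)
        + lam * (mass (polyKernel a q) t * y t - conv (polyKernel a q) y t))
        * (lam * (mass (polyKernel a q) t * y t - conv (polyKernel a q) y t))
        - ρ₂ * mass (polyKernel a q) t * Y t ^ 2
        + ρ₂ * q * Y t * (1 / lam * (lam * (mass (polyKernel a (q + 1)) t * y t
          - conv (polyKernel a (q + 1)) y t)))) (Ici 0) t := by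
  have hm := mul_mass_polyKernel_succ (a := a) (q := q) ht
  have hm' : polyKernel a q t = a - q * mass (polyKernel a (q + 1)) t := by linarith
  refine (((h.Y_deriv t ht).mul (((hasDerivWithinAt_mass_polyKernel a q ht).mul
    (h.y_deriv t ht)).sub (hasDerivWithinAt_conv_polyKernel a q h.continuousOn_y ht))).const_mul
    (-ρ₂)).congr_deriv ?_
  rw [hm']
  simp only [Pi.sub_apply, Pi.mul_apply]
  field_simp
  ring

/-- The term with `σ` is there to cancel the product of `y` with the shear, which leaves the
coercive term in `lam y`. -/
theorem IsMode.hasDerivWithinAt_rotationMultiplier (hlam : lam ≠ 0) (hlam' : lam ^ 2 - l ^ 2 ≠ 0)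
    (hρ₁ : ρ₁ ≠ 0) (hρ₂ : ρ₂ ≠ 0)
    (h : IsMode l lam ρ₁ ρ₂ k k₂ a q x y z X Y Z) {t : ℝ} (ht : 0 ≤ t) :
    HasDerivWithinAt
      (fun t => ρ₂ * (Y t * y t) - ρ₁ * (y t * ((lam * X t - l * Z t) / (lam ^ 2 - l ^ 2))))
      (ρ₂ * Y t ^ 2 - (k₂ - mass (polyKernel a q) t) * (lam * y t) ^ 2
        - lam * (mass (polyKernel a q) t * y t - conv (polyKernel a q) y t) * (lam * y t)
        - ρ₁ * Y t * (1 / lam * (lam * ((lam * X t - l * Z t) / (lam ^ 2 - l ^ 2)))))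
      (Ici 0) t := by
  refine ((((h.Y_deriv t ht).mul (h.y_deriv t ht)).const_mul ρ₂).sub (((h.y_deriv t ht).mul
    (h.hasDerivWithinAt_rotation hlam' hρ₁ ht)).const_mul ρ₁)).congr_deriv ?_
  set σ := (lam * X t - l * Z t) / (lam ^ 2 - l ^ 2)
  field_simp
  ring

/-- Equal speeds are needed here: only then does `lam² y σ` cancel the product `lam² y S` coming
from `Y' S`. The convolution is removed from `Y' S` in the same way, and `lam² σ Y` compensates the
leading part of `Y S'`. -/
theorem IsMode.hasDerivWithinAt_shearMultiplier (hlam' : lam ^ 2 - l ^ 2 ≠ 0)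
    (hρ₁ : ρ₁ ≠ 0) (hρ₂ : ρ₂ ≠ 0) (hk₂ : k₂ ≠ 0) (hs : k / ρ₁ = k₂ / ρ₂)
    (h : IsMode l lam ρ₁ ρ₂ k k₂ a q x y z X Y Z) {t : ℝ} (ht : 0 ≤ t) :
    HasDerivWithinAt
      (fun t => Y t * (lam * x t + y t + l * z t)
        - lam ^ 2 * (y t * ((lam * X t - l * Z t) / (lam ^ 2 - l ^ 2)))
        + lam ^ 2 / k₂ * (conv (polyKernel a q) y t * ((lam * X t - l * Z t) / (lam ^ 2 - l ^ 2))))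
      (-(k / ρ₂) * (lam * x t + y t + l * z t) ^ 2
        + Y t * (Y t + (lam * X t + l * Z t
          - lam * (lam * ((lam * X t - l * Z t) / (lam ^ 2 - l ^ 2)))))
        + 1 / k₂ * (polyKernel a q t * (lam * y t) + q * (lam * (mass (polyKernel a (q + 1)) t * y t
          - conv (polyKernel a (q + 1)) y t)))
          * (lam * ((lam * X t - l * Z t) / (lam ^ 2 - l ^ 2)))) (Ici 0) t := by
  have hm := mul_mass_polyKernel_succ (a := a) (q := q) ht
  have hm' : polyKernel a q t = a - q * mass (polyKernel a (q + 1)) t := by linarith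
  have hσ := h.hasDerivWithinAt_rotation hlam' hρ₁ ht
  rw [hs] at hσ
  refine ((((h.Y_deriv t ht).mul (h.hasDerivWithinAt_shear ht)).sub
    (((h.y_deriv t ht).mul hσ).const_mul (lam ^ 2))).add
    (((hasDerivWithinAt_conv_polyKernel a q h.continuousOn_y ht).mul hσ).const_mul
      (lam ^ 2 / k₂))).congr_deriv ?_
  rw [hm']
  set σ := (lam * X t - l * Z t) / (lam ^ 2 - l ^ 2)
  field_simp
  ring

theorem abs_mul_le_half_sq (u v : ℝ) : |u * v| ≤ 1 / 2 * (u ^ 2 + v ^ 2) := by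
  rw [abs_le]
  constructor <;> nlinarith [sq_nonneg (u + v), sq_nonneg (u - v)]

/-- Scaling by `θ = l/lam ≤ 1/2` makes both bounds uniform in the mode; the second shows that `lam²
σ` agrees with `lam X` up to an error of order `l`. -/
theorem rotation_sq_le (hl : 0 ≤ l) (hlam : 0 < lam) (h : 2 * l ≤ lam) (u v : ℝ) :
    (lam * ((lam * u - l * v) / (lam ^ 2 - l ^ 2))) ^ 2 ≤ 3 * (u ^ 2 + v ^ 2) ∧
    (lam * u + l * v - lam * (lam * ((lam * u - l * v) / (lam ^ 2 - l ^ 2)))) ^ 2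
      ≤ 8 * l ^ 2 * (u ^ 2 + v ^ 2) := by
  obtain ⟨θ, rfl⟩ : ∃ θ, l = θ * lam := ⟨l / lam, by field_simp⟩
  have hθ : 0 ≤ θ := nonneg_of_mul_nonneg_left hl hlam
  have hθ2 : θ ≤ 1 / 2 := by
    by_contra! hc
    nlinarith
  have hθ3 : θ ^ 2 ≤ 1 / 4 := by nlinarith
  have hd : 0 < 1 - θ ^ 2 := by linarith
  have e : (lam * ((lam * u - θ * lam * v) / (lam ^ 2 - (θ * lam) ^ 2))) =
      (u - θ * v) / (1 - θ ^ 2) := by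
    have : lam ^ 2 - (θ * lam) ^ 2 = lam ^ 2 * (1 - θ ^ 2) := by ring
    rw [this]
    field_simp
  rw [e]
  have hd2 : 9 / 16 ≤ (1 - θ ^ 2) ^ 2 := by nlinarith
  constructor
  · rw [div_pow, div_le_iff₀ (by positivity)]
    have h1 : (u - θ * v) ^ 2 ≤ (1 + θ ^ 2) * (u ^ 2 + v ^ 2) := by
      nlinarith [sq_nonneg (θ * u + v)]
    have h2 : (1 + θ ^ 2) * (u ^ 2 + v ^ 2) ≤ 3 * (u ^ 2 + v ^ 2) * (9 / 16) := by
      nlinarith [mul_le_mul_of_nonneg_right hθ3 (add_nonneg (sq_nonneg u) (sq_nonneg v))]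
    have h3 : 3 * (u ^ 2 + v ^ 2) * (9 / 16) ≤ 3 * (u ^ 2 + v ^ 2) * (1 - θ ^ 2) ^ 2 := by gcongr
    linarith
  · have e2 : lam * u + θ * lam * v - lam * ((u - θ * v) / (1 - θ ^ 2)) =
        θ * lam * ((-(θ * u) + (2 - θ ^ 2) * v) / (1 - θ ^ 2)) := by
      field_simp
      ring
    have h1 : (-(θ * u) + (2 - θ ^ 2) * v) ^ 2 ≤ (θ ^ 2 + (2 - θ ^ 2) ^ 2) * (u ^ 2 + v ^ 2) := by
      nlinarith [sq_nonneg ((2 - θ ^ 2) * u + θ * v)]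
    have h2 : (θ ^ 2 + (2 - θ ^ 2) ^ 2) ≤ 8 * (1 - θ ^ 2) ^ 2 := by
      nlinarith
    rw [e2, mul_pow, div_pow]
    have h3 : (-(θ * u) + (2 - θ ^ 2) * v) ^ 2 / (1 - θ ^ 2) ^ 2 ≤ 8 * (u ^ 2 + v ^ 2) := by
      rw [div_le_iff₀ (by positivity)]
      nlinarith [mul_le_mul_of_nonneg_right h2 (add_nonneg (sq_nonneg u) (sq_nonneg v))]
    calc _ ≤ (θ * lam) ^ 2 * (8 * (u ^ 2 + v ^ 2)) := by gcongr
      _ = _ := by ring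

/-- Each multiplier is a product of two quantities controlled by the energy, with `r = 1/lam ≤ R`
absorbing the missing powers of `lam`. Hence a multiple of the energy dominates their sum. -/
theorem abs_multipliers_le {N₁ N₂ N₃ R r u G X Y Z A S b s μ Γ : ℝ} (hk₂ : 0 < k₂)
    (hρ₁ : 0 < ρ₁) (hρ₂ : 0 < ρ₂) (hN₁ : 0 < N₁) (hN₂ : 0 < N₂) (hN₃ : 0 < N₃) (hr0 : 0 ≤ r)
    (hr : r ≤ R) (hu0 : 0 ≤ u) (hu : u ≤ 1 / 2) (hG0 : 0 ≤ G) (hG : G ≤ k₂) (hΓ : 0 ≤ Γ)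
    (hμ : μ ^ 2 ≤ k₂ * Γ) (hs : s ^ 2 ≤ 3 * (X ^ 2 + Z ^ 2)) :
    |X * A - S * Z - 4 * u * (X * S) + N₃ * (Y * S - b * s + 1 / k₂ * (G * (b * s) - μ * s))
      + N₂ * (ρ₂ * r * (Y * b) - ρ₁ * (r * r) * (b * s)) + N₁ * (-(ρ₂ * r) * (Y * μ))|
      ≤ (1 + 2 + N₃ * (1 + 2 + 1 / k₂ * (k₂ + 1 + 3 * (k₂ + 1)))
        + N₂ * (ρ₂ * R + ρ₁ * (R * R) * 2) + N₁ * (ρ₂ * R * (1 + k₂)))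
        * (X ^ 2 + Y ^ 2 + Z ^ 2 + b ^ 2 + S ^ 2 + A ^ 2 + Γ) := by
  have hR0 : 0 ≤ R := hr0.trans hr
  set T := X ^ 2 + Y ^ 2 + Z ^ 2 + b ^ 2 + S ^ 2 + A ^ 2 + Γ with hTdef
  have hT0 : 0 ≤ T := by positivity
  have sq := fun v : ℝ => sq_nonneg v
  have i1 : |X * A| ≤ 1 / 2 * T := (abs_mul_le_half_sq X A).trans (by
    rw [hTdef]; linarith [sq Y, sq Z, sq b, sq S])
  have i2 : |S * Z| ≤ 1 / 2 * T := (abs_mul_le_half_sq S Z).trans (by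
    rw [hTdef]; linarith [sq Y, sq X, sq b, sq A])
  have i3 : |X * S| ≤ 1 / 2 * T := (abs_mul_le_half_sq X S).trans (by
    rw [hTdef]; linarith [sq Y, sq Z, sq b, sq A])
  have i4 : |Y * S| ≤ 1 / 2 * T := (abs_mul_le_half_sq Y S).trans (by
    rw [hTdef]; linarith [sq X, sq Z, sq b, sq A])
  have i5 : |Y * b| ≤ 1 / 2 * T := (abs_mul_le_half_sq Y b).trans (by
    rw [hTdef]; linarith [sq X, sq Z, sq S, sq A])
  have i6 : |b * s| ≤ 2 * T := (abs_mul_le_half_sq b s).trans (by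
    rw [hTdef]; linarith [sq X, sq Z, sq S, sq A, sq b, sq Y])
  have hkΓ : k₂ * Γ ≤ k₂ * T := by
    gcongr; rw [hTdef]; linarith [sq X, sq Z, sq S, sq A, sq b, sq Y]
  have hkT : 0 ≤ k₂ * T := by positivity
  have i7 : |μ * s| ≤ (k₂ + 2) * T := (abs_mul_le_half_sq μ s).trans (by
    have : 3 * (X ^ 2 + Z ^ 2) ≤ 3 * T := by rw [hTdef]; linarith [sq S, sq A, sq b, sq Y]
    linarith)
  have i8 : |Y * μ| ≤ (1 + k₂) * T := (abs_mul_le_half_sq Y μ).trans (by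
    have : Y ^ 2 ≤ T := by rw [hTdef]; linarith [sq X, sq Z, sq S, sq A, sq b]
    linarith)
  have j1 : |X * A - S * Z - 4 * u * (X * S)| ≤ (1 + 2) * T := by
    have h4 : |4 * u * (X * S)| ≤ 4 * (1 / 2) * (1 / 2 * T) := by
      rw [abs_mul, abs_of_nonneg (by positivity)]
      gcongr
    have := abs_sub (X * A - S * Z) (4 * u * (X * S))
    have := abs_sub (X * A) (S * Z)
    linarith
  have j2 : |N₁ * (-(ρ₂ * r) * (Y * μ))| ≤ N₁ * (ρ₂ * R * ((1 + k₂) * T)) := by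
    rw [abs_mul, abs_of_pos hN₁, abs_mul, abs_neg, abs_of_nonneg (by positivity)]
    gcongr
  have j3 : |N₂ * (ρ₂ * r * (Y * b) - ρ₁ * (r * r) * (b * s))|
      ≤ N₂ * (ρ₂ * R * (1 / 2 * T) + ρ₁ * (R * R) * (2 * T)) := by
    rw [abs_mul, abs_of_pos hN₂]
    refine mul_le_mul_of_nonneg_left ((abs_sub _ _).trans ?_) hN₂.le
    rw [abs_mul, abs_mul (ρ₁ * (r * r)), abs_of_nonneg (by positivity : 0 ≤ ρ₂ * r),
      abs_of_nonneg (by positivity : 0 ≤ ρ₁ * (r * r))]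
    gcongr
  have j4 : |N₃ * (Y * S - b * s + 1 / k₂ * (G * (b * s) - μ * s))|
      ≤ N₃ * (1 / 2 * T + 2 * T + 1 / k₂ * (k₂ * (2 * T) + (k₂ + 2) * T)) := by
    rw [abs_mul, abs_of_pos hN₃]
    refine mul_le_mul_of_nonneg_left ?_ hN₃.le
    have k1 := abs_add_le (Y * S - b * s) (1 / k₂ * (G * (b * s) - μ * s))
    have k2 := abs_sub (Y * S) (b * s)
    have k3 : |1 / k₂ * (G * (b * s) - μ * s)| ≤ 1 / k₂ * (k₂ * (2 * T) + (k₂ + 2) * T) := by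
      rw [abs_mul, abs_of_pos (by positivity : 0 < 1 / k₂)]
      refine mul_le_mul_of_nonneg_left ((abs_sub _ _).trans ?_) (by positivity)
      rw [abs_mul G, abs_of_nonneg hG0]
      gcongr
    linarith
  have j5 := abs_add_le (X * A - S * Z - 4 * u * (X * S)
    + N₃ * (Y * S - b * s + 1 / k₂ * (G * (b * s) - μ * s))
    + N₂ * (ρ₂ * r * (Y * b) - ρ₁ * (r * r) * (b * s))) (N₁ * (-(ρ₂ * r) * (Y * μ)))
  have j6 := abs_add_le (X * A - S * Z - 4 * u * (X * S)
    + N₃ * (Y * S - b * s + 1 / k₂ * (G * (b * s) - μ * s)))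
    (N₂ * (ρ₂ * r * (Y * b) - ρ₁ * (r * r) * (b * s)))
  have j7 := abs_add_le (X * A - S * Z - 4 * u * (X * S))
    (N₃ * (Y * S - b * s + 1 / k₂ * (G * (b * s) - μ * s)))
  have hQT : (1 + 2) * T + N₃ * (1 / 2 * T + 2 * T + 1 / k₂ * (k₂ * (2 * T) + (k₂ + 2) * T))
      + N₂ * (ρ₂ * R * (1 / 2 * T) + ρ₁ * (R * R) * (2 * T))
      + N₁ * (ρ₂ * R * ((1 + k₂) * T)) ≤ (1 + 2 + N₃ * (1 + 2 + 1 / k₂ * (k₂ + 1 + 3 * (k₂ + 1)))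
        + N₂ * (ρ₂ * R + ρ₁ * (R * R) * 2) + N₁ * (ρ₂ * R * (1 + k₂))) * T := by
    have : 0 ≤ N₃ * (1 / 2 * T + 1 / k₂ * ((k₂ + 2) * T)) + N₂ * (ρ₂ * R * (1 / 2 * T)) := by
      positivity
    linarith
  linarith

/-- A functional equivalent to the energy that dissipates the energy up to the memory term, with
constants that do not depend on the mode. -/
theorem exists_lyapunov (H : Admissible l ρ₁ ρ₂ k k₂ a q) :
    ∃ m B C : ℝ, 0 < m ∧ 0 < B ∧ 0 < C ∧
      ∀ (lam : ℝ) (x y z X Y Z : ℝ → ℝ), 2 * l ≤ lam →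
      IsMode l lam ρ₁ ρ₂ k k₂ a q x y z X Y Z →
      ∃ F F' : ℝ → ℝ, (∀ t, 0 ≤ t → HasDerivWithinAt F (F' t) (Ici 0) t) ∧
        (∀ t, 1 ≤ t → F' t ≤ -m * modeEnergy l lam ρ₁ ρ₂ k k₂ a q x y z X Y Z t
          + C * (lam ^ 2 * quadMem (polyKernel a q) y t)) ∧
        (∀ t, 0 ≤ t → modeEnergy l lam ρ₁ ρ₂ k k₂ a q x y z X Y Z t ≤ F t) ∧
        (∀ t, 0 ≤ t → F t ≤ B * modeEnergy l lam ρ₁ ρ₂ k k₂ a q x y z X Y Z t) := by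
  obtain ⟨κ, hκ, hmass⟩ := H.mass_lt
  have hl := H.l_pos
  have hρ₁ := H.ρ₁_pos
  have hρ₂ := H.ρ₂_pos
  have hk := H.k_pos
  have hk₂ := H.k₂_pos
  have ha := H.a_pos
  have hq := H.q_pos
  -- The damping of `Y` is proportional to the mass, which vanishes at time zero. From time 1 on it
  -- is at least `G₁`, which is why the dissipation estimate starts there.
  set G₁ := mass (polyKernel a q) 1 with hG₁
  have hG₁0 : 0 < G₁ := mass_polyKernel_pos ha one_pos
  set R := 1 / (2 * l) with hR
  have hR0 : 0 < R := by positivity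
  set c := k / ρ₁ with hc
  have hc0 : 0 < c := by positivity
  obtain ⟨Ce, hCe, hle⟩ := exists_le_modeEnergy H
  obtain ⟨Cf, hCf, hge⟩ := exists_modeEnergy_le H
  obtain ⟨N₁, N₂, N₃, ε₁, ε₂, ε₃, C₁, C₂, C₃, m, C, hN₁, hN₂, hN₃, hm, hC, b₁, b₂, b₃, hsum⟩ :=
    exists_weights (m₀ := min (l * c / 2) (l / 4)) (C₀ := 7 * l * c + 3 / l) (κ := k / ρ₂)
      (m₁ := κ / 2) (m₂ := ρ₂ * G₁ / 2) (by positivity) (by positivity) (by positivity)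
      (by positivity) (by positivity)
      (fun ε hε => exists_memory_multiplier_bound (k := k) (k₂ := k₂) (q := q) (R := R)
        (c₁ := k₂) (c₂ := a / q) hρ₂ hG₁0 hk₂.le (by positivity) hε)
      (fun ε hε => exists_rotation_multiplier_bound (ρ₁ := ρ₁) (k₂ := k₂) (R := R)
        (c₁ := k₂) hρ₂ hκ hk₂.le hε)
      (fun ε hε => exists_shear_multiplier_bound (l := l) (k₂ := k₂) (κ := k / ρ₂) (q := q)
        (a := a) (c₂ := a / q) (by positivity) hε)
  set Q := 1 + 2 + N₃ * (1 + 2 + 1 / k₂ * (k₂ + 1 + 3 * (k₂ + 1))) + N₂ * (ρ₂ * R + ρ₁ * (R * R) * 2)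
    + N₁ * (ρ₂ * R * (1 + k₂)) with hQ
  have hQ0 : 0 < Q := by positivity
  refine ⟨m / Cf, 2 * (Q * Ce) + 1, C, by positivity, by positivity, hC, ?_⟩
  intro lam x y z X Y Z hlam h
  have hlam0 : 0 < lam := by linarith
  have hlam' : lam ^ 2 - l ^ 2 ≠ 0 := by
    have : 0 < lam ^ 2 - l ^ 2 := by nlinarith
    exact this.ne'
  have hr : 1 / lam ≤ R := one_div_le_one_div_of_le (by positivity) hlam
  have hy := h.continuousOn_y
  have hK : ∀ r s, 0 ≤ s → 0 ≤ polyKernel a r s := fun r s hs =>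
    (polyKernel_pos ha (by linarith)).le
  set e := modeEnergy l lam ρ₁ ρ₂ k k₂ a q x y z X Y Z with he
  set W : ℝ → ℝ := fun t => X t * (lam * z t + l * x t) - (lam * x t + y t + l * z t) * Z t
        - 4 * l / lam * (X t * (lam * x t + y t + l * z t)) with hW
  set I₁ : ℝ → ℝ :=
    fun t => -ρ₂ * (Y t * (mass (polyKernel a q) t * y t - conv (polyKernel a q) y t)) with hI₁
  set I₂ : ℝ → ℝ := fun t =>
    ρ₂ * (Y t * y t) - ρ₁ * (y t * ((lam * X t - l * Z t) / (lam ^ 2 - l ^ 2))) with hI₂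
  set I₃ : ℝ → ℝ := fun t => Y t * (lam * x t + y t + l * z t)
        - lam ^ 2 * (y t * ((lam * X t - l * Z t) / (lam ^ 2 - l ^ 2)))
        + lam ^ 2 / k₂ * (conv (polyKernel a q) y t * ((lam * X t - l * Z t) / (lam ^ 2 - l ^ 2)))
    with hI₃
  have hμ : ∀ t, 0 < t → (lam * (mass (polyKernel a q) t * y t - conv (polyKernel a q) y t)) ^ 2
      ≤ k₂ * (lam ^ 2 * quadMem (polyKernel a q) y t) := by
    intro t ht
    have h1 := conv_sq_le (continuousOn_polyKernel a q) (hK q) hy ht.le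
      (mass_polyKernel_pos ha ht)
    have h2 := quadMem_nonneg (hK q) y ht.le
    have h3 := mass_le H ht.le
    calc (lam * (mass (polyKernel a q) t * y t - conv (polyKernel a q) y t)) ^ 2
        = lam ^ 2 * (mass (polyKernel a q) t * y t - conv (polyKernel a q) y t) ^ 2 := by ring
      _ ≤ lam ^ 2 * (k₂ * quadMem (polyKernel a q) y t) := by
          gcongr
          exact h1.trans (by gcongr)
      _ = _ := by ring
  have hν : ∀ t, 0 < t → (lam * (mass (polyKernel a (q + 1)) t * y t
      - conv (polyKernel a (q + 1)) y t)) ^ 2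
      ≤ a / q * (lam ^ 2 * quadMem (polyKernel a q) y t) := by
    intro t ht
    have h1 := conv_sq_le (continuousOn_polyKernel a (q + 1)) (hK (q + 1)) hy ht.le
      (mass_polyKernel_pos ha ht)
    have h2 := quadMem_nonneg (hK (q + 1)) y ht.le
    have h3 : mass (polyKernel a (q + 1)) t ≤ a / q := by
      rw [le_div_iff₀ hq]
      have := mul_mass_polyKernel_succ (a := a) (q := q) ht.le
      linarith [hK q t ht.le]
    have h4 := quadMem_succ_le (q := q) ha hy ht.le
    calc (lam * (mass (polyKernel a (q + 1)) t * y t - conv (polyKernel a (q + 1)) y t)) ^ 2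
        = lam ^ 2 * (mass (polyKernel a (q + 1)) t * y t - conv (polyKernel a (q + 1)) y t) ^ 2 := by
          ring
      _ ≤ lam ^ 2 * (a / q * quadMem (polyKernel a q) y t) := by
          gcongr
          exact h1.trans (by gcongr)
      _ = _ := by ring
  have hμ0 : ∀ t, 0 ≤ t → (lam * (mass (polyKernel a q) t * y t - conv (polyKernel a q) y t)) ^ 2
      ≤ k₂ * (lam ^ 2 * quadMem (polyKernel a q) y t) := by
    intro t ht
    rcases ht.eq_or_lt with rfl | ht
    · simp [mass, conv, quadMem]
    · exact hμ t ht
  have habs : ∀ t, 0 ≤ t → |W t + N₃ * I₃ t + N₂ * I₂ t + N₁ * I₁ t| ≤ Q * (Ce * e t) := by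
    intro t ht
    have hT := hle lam x y z X Y Z t ht
    obtain ⟨hs, -⟩ := rotation_sq_le hl.le hlam0 hlam (X t) (Z t)
    have hΓ : 0 ≤ lam ^ 2 * quadMem (polyKernel a q) y t :=
      mul_nonneg (sq_nonneg _) (quadMem_nonneg (hK q) y ht)
    have hμt := hμ0 t ht
    have hG0 : 0 ≤ mass (polyKernel a q) t := intervalIntegral.integral_nonneg ht fun s hs =>
      hK q s hs.1
    have hG := mass_le H ht
    have eW : W t = X t * (lam * z t + l * x t) - (lam * x t + y t + l * z t) * Z t
        - 4 * (l / lam) * (X t * (lam * x t + y t + l * z t)) := by simp only [hW]; ring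
    set s := lam * ((lam * X t - l * Z t) / (lam ^ 2 - l ^ 2)) with hsdef
    set μ := lam * (mass (polyKernel a q) t * y t - conv (polyKernel a q) y t) with hμdef
    have e1 : I₁ t = -(ρ₂ * (1 / lam)) * (Y t * μ) := by
      simp only [hI₁, hμdef]; field_simp
    have e2 : I₂ t = ρ₂ * (1 / lam) * (Y t * (lam * y t))
        - ρ₁ * (1 / lam * (1 / lam)) * ((lam * y t) * s) := by
      simp only [hI₂, hsdef]
      generalize (lam * X t - l * Z t) / (lam ^ 2 - l ^ 2) = σ
      field_simp
    have e3 : I₃ t = Y t * (lam * x t + y t + l * z t) - (lam * y t) * s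
        + 1 / k₂ * (mass (polyKernel a q) t * ((lam * y t) * s) - μ * s) := by
      simp only [hI₃, hsdef, hμdef]
      ring
    have hlr : l / lam ≤ 1 / 2 := by rw [div_le_iff₀ hlam0]; linarith
    have hlr0 : 0 ≤ l / lam := by positivity
    rw [eW, e1, e2, e3]
    exact (abs_multipliers_le hk₂ hρ₁ hρ₂ hN₁ hN₂ hN₃ (by positivity) hr (by positivity) hlr hG0 hG
      hΓ hμt hs).trans (mul_le_mul_of_nonneg_left hT hQ0.le)
  have hdiff : ∀ t, 0 ≤ t → ∃ D, HasDerivWithinAt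
      (fun t => W t + N₃ * I₃ t + N₂ * I₂ t + N₁ * I₁ t) D (Ici 0) t ∧ (1 ≤ t →
      D ≤ -(m / Cf) * e t + C * (lam ^ 2 * quadMem (polyKernel a q) y t)) := by
    intro t ht
    have dW := h.hasDerivWithinAt_axialMultiplier hlam0.ne' hρ₁.ne' ht
    have d₁ := h.hasDerivWithinAt_memoryMultiplier hlam0.ne' hρ₂.ne' ht
    have d₂ := h.hasDerivWithinAt_rotationMultiplier hlam0.ne' hlam' hρ₁.ne' hρ₂.ne' ht
    have d₃ := h.hasDerivWithinAt_shearMultiplier hlam' hρ₁.ne' hρ₂.ne' hk₂.ne' H.speed ht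
    refine ⟨_, ((dW.add (d₃.const_mul N₃)).add (d₂.const_mul N₂)).add (d₁.const_mul N₁), fun ht1 => ?_⟩
    have ht0 : 0 < t := by linarith
    obtain ⟨hs, hτ⟩ := rotation_sq_le hl.le hlam0 hlam (X t) (Z t)
    have hΓ : 0 ≤ lam ^ 2 * quadMem (polyKernel a q) y t :=
      mul_nonneg (sq_nonneg _) (quadMem_nonneg (hK q) y ht0.le)
    have hlr : l / lam ≤ 1 / 2 := by rw [div_le_iff₀ hlam0]; linarith
    have hga : polyKernel a q t ≤ a := by
      have := polyKernel_anti (r := q) ha.le hq.le (by norm_num : (-1 : ℝ) < 0) ht0.le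
      rwa [polyKernel_zero] at this
    have i₁ := b₁ (1 / lam) (mass (polyKernel a q) t) (lam * y t) (lam * x t + y t + l * z t)
      (Y t) _ _ _ (by positivity) hr (mass_polyKernel_mono ha zero_le_one ht1) (mass_le H ht0.le)
      hΓ (hμ t ht0) (hν t ht0)
    have i₂ := b₂ (1 / lam) (mass (polyKernel a q) t) (lam * y t) _ (X t)
      (Y t) (Z t) _ _ (by positivity) hr (hmass t ht0.le) hΓ (hμ t ht0) hs
    have i₃ := b₃ (polyKernel a q t) (lam * y t) _ (lam * x t + y t + l * z t) _ (X t) (Y t) (Z t)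
      _ _ (hK q t ht0.le) hga hΓ (hν t ht0) hs hτ
    have i₀ := axial_multiplier_bound (A := lam * z t + l * x t) (S := lam * x t + y t + l * z t)
      (X := X t) (Y := Y t) (Z := Z t) hl hc0 (by positivity : 0 ≤ l / lam) hlr
      (by field_simp : l * (1 / lam) = l / lam)
    have i₀' := i₀.trans (show _ ≤ -(min (l * c / 2) (l / 4)) *
        ((lam * z t + l * x t) ^ 2 + (X t ^ 2 + Z t ^ 2)) + (7 * l * c + 3 / l) *
        ((lam * x t + y t + l * z t) ^ 2 + Y t ^ 2) by
      have k1 := mul_le_mul_of_nonneg_right (min_le_left (l * c / 2) (l / 4))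
        (sq_nonneg (lam * z t + l * x t))
      have k2 := mul_le_mul_of_nonneg_right (min_le_right (l * c / 2) (l / 4)) (sq_nonneg (X t))
      have k3 := mul_le_mul_of_nonneg_right (min_le_right (l * c / 2) (l / 4)) (sq_nonneg (Z t))
      have k4 : 0 ≤ 7 * l * c * Y t ^ 2 + 3 / l * (lam * x t + y t + l * z t) ^ 2
        + l / 4 * X t ^ 2 := by positivity
      linarith)
    have key := hsum _ _ _ _ _ _ _ _ _ _ (sq_nonneg (lam * z t + l * x t))
      (add_nonneg (sq_nonneg (X t)) (sq_nonneg (Z t))) (sq_nonneg (lam * x t + y t + l * z t))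
      (sq_nonneg (Y t)) (sq_nonneg (lam * y t)) i₀' i₃ i₂ i₁
    have hge' := hge lam x y z X Y Z t ht0.le
    have hfin : m / Cf * e t ≤ m * (X t ^ 2 + Y t ^ 2 + Z t ^ 2 + (lam * y t) ^ 2
        + (lam * x t + y t + l * z t) ^ 2 + (lam * z t + l * x t) ^ 2
        + lam ^ 2 * quadMem (polyKernel a q) y t) := by
      rw [div_mul_eq_mul_div, div_le_iff₀ hCf, mul_assoc]
      refine mul_le_mul_of_nonneg_left (hge'.trans_eq (mul_comm _ _)) hm.le
    linarith
  have hde := fun t (ht : 0 ≤ t) => h.hasDerivWithinAt_modeEnergy H.ρ₁_pos.ne' H.ρ₂_pos.ne' ht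
  choose! D hD hD' using hdiff
  -- The multipliers are at most `Q Ce e` in absolute value, so this weight makes `F` at least `e`;
  -- the added term has a nonpositive derivative.
  refine ⟨fun t => (W t + N₃ * I₃ t + N₂ * I₂ t + N₁ * I₁ t) + (Q * Ce + 1) * e t, _,
    fun t ht => (hD t ht).add ((hde t ht).const_mul (Q * Ce + 1)), ?_, ?_, ?_⟩
  · intro t ht
    have ht0 : 0 ≤ t := by linarith
    have h1 := quadMem_nonneg (hK (q + 1)) y ht0
    have h2 := hK q t ht0
    have : 0 ≤ (Q * Ce + 1) * (1 / 2 * lam ^ 2 * (q * quadMem (polyKernel a (q + 1)) y t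
        + polyKernel a q t * y t ^ 2)) := by positivity
    have := hD' t ht0 ht
    linarith
  · intro t ht
    have := (abs_le.1 (habs t ht)).1
    linarith
  · intro t ht
    have := (abs_le.1 (habs t ht)).2
    linarith

end Multipliers

/-! ### Decay of the modes -/

/-- Polynomial decay from a Lyapunov functional whose derivative is controlled up to a memory term
with a tail of size `K (1+t)^j`. -/
theorem exists_decay_of_tail {m B C q a : ℝ} (hm : 0 < m) (hB : 0 < B) (hC : 0 < C) (hq : 0 < q)
    (ha : 0 < a) {K : ℝ} (hK : 0 < K) (j : ℕ) :
    ∃ K', 0 < K' ∧ ∀ e e' F F' Γ W : ℝ → ℝ,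
      (∀ t, 0 ≤ t → HasDerivWithinAt e (e' t) (Ici 0) t) → AntitoneOn e (Ici 0) →
      (∀ t, 0 ≤ t → 0 ≤ e t) →
      (∀ t, 0 ≤ t → HasDerivWithinAt F (F' t) (Ici 0) t) →
      (∀ t, 1 ≤ t → F' t ≤ -m * e t + C * Γ t) →
      (∀ t, 0 ≤ t → e t ≤ F t) → (∀ t, 0 ≤ t → F t ≤ B * e t) →
      (∀ t τ, 0 ≤ t → 0 ≤ τ →
        Γ t ≤ (1 + τ) * (2 / q * -e' t) + a / (1 + τ) ^ q * W t) →
      (∀ t, 0 ≤ t → W t ≤ K * e 0 * (1 + t) ^ j) →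
      ∀ t, 0 ≤ t → e t * (1 + t) ^ q ≤ K' * e 0 * (1 + t) ^ j := by
  set c := C * (2 / q) with hc
  have hc0 : 0 < c := by positivity
  -- `c δ ≤ m/2` pays for differentiating the weight `1 + δ t`; `q c δ ≤ m/2`, together with the
  -- choice of `T`, pays for differentiating `(T + t)^q`.
  obtain ⟨δ, hδ, hδ1, hδ2, hδ3⟩ : ∃ δ, 0 < δ ∧ δ ≤ 1 ∧ c * δ ≤ m / 2 ∧ q * (c * δ) ≤ m / 2 := by
    refine ⟨min 1 (min (m / 2 / c) (m / 2 / (q * c))), by positivity, min_le_left _ _, ?_, ?_⟩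
    · rw [mul_comm, ← le_div_iff₀ hc0]
      exact (min_le_right _ _).trans (min_le_left _ _)
    · rw [← mul_assoc, mul_comm, ← le_div_iff₀ (by positivity)]
      exact (min_le_right _ _).trans (min_le_right _ _)
  obtain ⟨T, hT1, hT2⟩ : ∃ T, 1 ≤ T ∧ q * (B + c) ≤ m / 2 * T := by
    refine ⟨max 1 (q * (B + c) / (m / 2)), le_max_left _ _, ?_⟩
    rw [mul_comm (m / 2), ← div_le_iff₀ (by positivity)]
    exact le_max_right _ _
  have hT0 : 0 < T := by linarith
  set P := C * a * (T / δ) ^ q * K with hP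
  have hP0 : 0 < P := by positivity
  set V₁ := (T + 1) ^ q * (B + c * (1 + δ)) with hV₁
  have hV₁0 : 0 < V₁ := by positivity
  refine ⟨(V₁ + P) / (c * δ) + 2 ^ q, by positivity, ?_⟩
  intro e e' F F' Γ W he hanti hpos hF hF' heF hFe hΓ hW t ht
  have he0 : 0 ≤ e 0 := hpos 0 le_rfl
  have h1t : (0 : ℝ) < 1 + t := by linarith
  -- Up to time 1 monotonicity of `e` is enough; this accounts for the summand `2 ^ q` of the
  -- constant.
  rcases le_total t 1 with h1 | h1
  · have a1 : e t ≤ e 0 := hanti self_mem_Ici ht ht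
    have a2 : (1 + t) ^ q ≤ 2 ^ q := Real.rpow_le_rpow h1t.le (by linarith) hq.le
    have a3 : (1 : ℝ) ≤ (1 + t) ^ j := one_le_pow₀ (by linarith)
    calc e t * (1 + t) ^ q ≤ e 0 * 2 ^ q := by gcongr
      _ ≤ ((V₁ + P) / (c * δ) + 2 ^ q) * e 0 := by
        have : 0 ≤ (V₁ + P) / (c * δ) * e 0 := by positivity
        linarith
      _ ≤ ((V₁ + P) / (c * δ) + 2 ^ q) * e 0 * (1 + t) ^ j := by
        exact le_mul_of_one_le_right (by positivity) a3
  -- The derivative of the weighted energy cancels the contribution `(1 + τ)(-e')` of the tail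
  -- estimate taken at `τ = δ t`.
  set H : ℝ → ℝ := fun t => F t + c * ((1 + δ * t) * e t) with hH
  set H' : ℝ → ℝ := fun t => F' t + c * (δ * e t + (1 + δ * t) * e' t) with hH'
  have hHd : ∀ t, 0 ≤ t → HasDerivWithinAt H (H' t) (Ici 0) t := by
    intro t ht
    have h2 : HasDerivWithinAt (fun t : ℝ => 1 + δ * t) δ (Ici 0) t := by
      simpa using (((hasDerivAt_id t).const_mul δ).const_add 1).hasDerivWithinAt (s := Ici 0)
    exact (hF t ht).add ((h2.mul (he t ht)).const_mul c)
  have hHup : ∀ t, 0 ≤ t → q * H t ≤ m / 2 * ((T + t) * e t) := by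
    intro t ht
    have h2 := mul_le_mul_of_nonneg_left (hFe t ht) hq.le
    have h3 := mul_le_mul_of_nonneg_right hT2 (hpos t ht)
    have h4 := mul_le_mul_of_nonneg_right hδ3 (mul_nonneg ht (hpos t ht))
    simp only [hH]
    linarith
  have hH'le : ∀ t, 1 ≤ t →
      H' t ≤ -(m / 2) * e t + C * a / (1 + δ * t) ^ q * (K * e 0 * (1 + t) ^ j) := by
    intro t ht
    have ht0 : 0 ≤ t := by linarith
    have hδt : 0 ≤ δ * t := by positivity
    have h2 := mul_le_mul_of_nonneg_left (hΓ t (δ * t) ht0 hδt) hC.le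
    have h3 := mul_le_mul_of_nonneg_left (hW t ht0)
      (by positivity : 0 ≤ C * a / (1 + δ * t) ^ q)
    have h4 := mul_le_mul_of_nonneg_right hδ2 (hpos t ht0)
    have h5 := hF' t ht
    have e1 : C * ((1 + δ * t) * (2 / q * -e' t) + a / (1 + δ * t) ^ q * W t) =
      -(c * ((1 + δ * t) * e' t)) + C * a / (1 + δ * t) ^ q * W t := by rw [hc]; ring
    simp only [hH']
    linarith
  have hTt : ∀ t : ℝ, 0 ≤ t → 0 < T + t := fun t ht => by linarith
  have hTd : ∀ t : ℝ, 0 ≤ t → HasDerivWithinAt (fun t : ℝ => (T + t) ^ q)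
      (q * (T + t) ^ (q - 1)) (Ici 0) t := by
    intro t ht
    have := (((hasDerivAt_id t).const_add T).rpow_const (p := q)
      (Or.inl (hTt t ht).ne')).hasDerivWithinAt (s := Ici 0)
    simpa using this
  have hVd : ∀ t, 0 ≤ t → HasDerivWithinAt
      (fun t => (T + t) ^ q * H t - P * e 0 * (1 + t) ^ (j + 1))
      (q * (T + t) ^ (q - 1) * H t + (T + t) ^ q * H' t - P * e 0 * ((j + 1 : ℕ) * (1 + t) ^ j))
      (Ici 0) t := by
    intro t ht
    have h2 : HasDerivWithinAt (fun t : ℝ => (1 + t) ^ (j + 1)) ((j + 1 : ℕ) * (1 + t) ^ j)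
        (Ici 0) t := by
      simpa using (((hasDerivAt_id t).const_add 1).fun_pow (j + 1)).hasDerivWithinAt (s := Ici 0)
    exact ((hTd t ht).mul (hHd t ht)).sub (h2.const_mul (P * e 0))
  have hIci : Ici (1 : ℝ) ⊆ Ici 0 := Ici_subset_Ici.2 zero_le_one
  -- The weight `(T + t)^q` balances the tail `(1 + δ t)^(-q)`, so the growth of `(T + t)^q H` is at
  -- most that of the subtracted power.
  have hVanti : AntitoneOn (fun t => (T + t) ^ q * H t - P * e 0 * (1 + t) ^ (j + 1))
      (Ici 1) := by
    refine antitoneOn_of_hasDerivWithinAt_nonpos (convex_Ici 1)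
      (fun t ht => (hVd t (hIci ht)).continuousWithinAt.mono hIci)
      (fun t ht => (hVd t (hIci (interior_subset ht))).mono (interior_subset.trans hIci))
      fun t ht => ?_
    have ht1 : 1 ≤ t := interior_subset ht
    have ht0 : 0 ≤ t := by linarith
    have h2 : q * (T + t) ^ (q - 1) * H t ≤ m / 2 * ((T + t) ^ q * e t) := by
      have e1 : (T + t) ^ q = (T + t) ^ (q - 1) * (T + t) := by
        rw [← Real.rpow_add_one (hTt t ht0).ne', sub_add_cancel]
      have := mul_le_mul_of_nonneg_left (hHup t ht0)
        (Real.rpow_pos_of_pos (hTt t ht0) (q - 1)).le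
      rw [e1]
      linarith
    have h3 := mul_le_mul_of_nonneg_left (hH'le t ht1) (Real.rpow_pos_of_pos (hTt t ht0) q).le
    have hδt : 0 < 1 + δ * t := by positivity
    have h4 : (T + t) ^ q / (1 + δ * t) ^ q ≤ (T / δ) ^ q := by
      rw [← Real.div_rpow (hTt t ht0).le hδt.le]
      refine Real.rpow_le_rpow (div_nonneg (hTt t ht0).le hδt.le) ?_ hq.le
      rw [div_le_div_iff₀ hδt hδ]
      nlinarith [mul_nonneg hδ.le ht0, mul_nonneg (sub_nonneg.2 hδ1) hT0.le]
    have h5 : C * a * K * ((T + t) ^ q / (1 + δ * t) ^ q) * (e 0 * (1 + t) ^ j)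
        ≤ P * e 0 * (1 + t) ^ j := by
      calc _ ≤ C * a * K * (T / δ) ^ q * (e 0 * (1 + t) ^ j) := by gcongr
        _ = _ := by rw [hP]; ring
    have h6 : P * e 0 * (1 + t) ^ j ≤ P * e 0 * ((j + 1 : ℕ) * (1 + t) ^ j) := by
      have : (1 : ℝ) ≤ ((j + 1 : ℕ) : ℝ) := by
        push_cast
        linarith [(Nat.cast_nonneg j : (0 : ℝ) ≤ j)]
      refine mul_le_mul_of_nonneg_left (le_mul_of_one_le_left (by positivity) this)
        (by positivity)
    have e2 : (T + t) ^ q * (-(m / 2) * e t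
        + C * a / (1 + δ * t) ^ q * (K * e 0 * (1 + t) ^ j)) = -(m / 2 * ((T + t) ^ q * e t))
        + C * a * K * ((T + t) ^ q / (1 + δ * t) ^ q) * (e 0 * (1 + t) ^ j) := by ring
    linarith
  have hV := hVanti self_mem_Ici h1 h1
  simp only at hV
  have hV1 : (T + 1) ^ q * H 1 ≤ V₁ * e 0 := by
    have h2 := hFe 1 zero_le_one
    have h3 : e 1 ≤ e 0 := hanti self_mem_Ici (mem_Ici.2 zero_le_one) zero_le_one
    have h4 : H 1 ≤ (B + c * (1 + δ)) * e 1 := by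
      simp only [hH]
      linarith
    calc (T + 1) ^ q * H 1 ≤ (T + 1) ^ q * ((B + c * (1 + δ)) * e 0) := by
          gcongr
          exact h4.trans (by gcongr)
      _ = _ := by rw [hV₁]; ring
  have h1j : (1 : ℝ) ≤ (1 + t) ^ (j + 1) := one_le_pow₀ (by linarith)
  -- `H` exceeds `e` by a factor of order `1 + t`; this gain brings the exponent `j + 1` back to
  -- `j`.
  have hlow : c * δ * (1 + t) * e t ≤ H t := by
    have h2 := (hpos t ht).trans (heF t ht)
    have h3 : δ * (1 + t) ≤ 1 + δ * t := by linarith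
    have h4 := mul_le_mul_of_nonneg_left h3 (mul_nonneg hc0.le (hpos t ht))
    simp only [hH]
    linarith
  have hup : (T + t) ^ q * H t ≤ (V₁ + P) * e 0 * (1 + t) ^ (j + 1) := by
    have h2 : V₁ * e 0 ≤ V₁ * e 0 * (1 + t) ^ (j + 1) :=
      le_mul_of_one_le_right (by positivity) h1j
    have h3 : 0 ≤ P * e 0 * (1 + 1) ^ (j + 1) := by positivity
    linarith
  have h7 : (1 + t) ^ q * (c * δ * (1 + t) * e t) ≤ (V₁ + P) * e 0 * (1 + t) ^ (j + 1) := by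
    refine le_trans ?_ hup
    have h8 : (1 + t) ^ q ≤ (T + t) ^ q := Real.rpow_le_rpow h1t.le (by linarith) hq.le
    have h9 := hpos t ht
    have h10 : 0 ≤ c * δ * (1 + t) * e t := by positivity
    exact mul_le_mul h8 hlow h10 (by positivity)
  have h8 : e t * (1 + t) ^ q ≤ (V₁ + P) / (c * δ) * e 0 * (1 + t) ^ j := by
    rw [div_mul_eq_mul_div, div_mul_eq_mul_div, le_div_iff₀ (by positivity)]
    refine le_of_mul_le_mul_right ?_ h1t
    rw [pow_succ] at h7
    linarith
  have h9 : 0 ≤ (2 : ℝ) ^ q * e 0 * (1 + t) ^ j := by positivity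
  linarith

section Mode

variable {l ρ₁ ρ₂ k k₂ a q : ℝ}

/-- The energy of the modes decays like the relaxation function, uniformly in the mode. -/
theorem exists_modeEnergy_decay (H : Admissible l ρ₁ ρ₂ k k₂ a q) :
    ∃ K : ℝ, 0 < K ∧ ∀ (lam : ℝ) (x y z X Y Z : ℝ → ℝ), 2 * l ≤ lam →
      IsMode l lam ρ₁ ρ₂ k k₂ a q x y z X Y Z → ∀ t, 0 ≤ t →
      modeEnergy l lam ρ₁ ρ₂ k k₂ a q x y z X Y Z t * (1 + t) ^ q
        ≤ K * modeEnergy l lam ρ₁ ρ₂ k k₂ a q x y z X Y Z 0 := by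
  have ha := H.a_pos
  have hq := H.q_pos
  have hq2 := H.q_gt
  obtain ⟨m, B, C, hm, hB, hC, hlyap⟩ := exists_lyapunov H
  obtain ⟨Ce, hCe, hle⟩ := exists_le_modeEnergy H
  -- First pass: as `e` is nonincreasing, the history integral grows at most linearly, and `e`
  -- decays like `(1+t)^(1-q)`. The second pass, with exponent 0, uses the integrability of that
  -- rate.
  obtain ⟨K₁, hK₁, hdec₁⟩ := exists_decay_of_tail hm hB hC hq ha
    (by positivity : 0 < 4 * Ce) 1
  obtain ⟨K₂, hK₂, hdec₂⟩ := exists_decay_of_tail hm hB hC hq ha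
    (by have := sub_pos.2 hq2; positivity : 0 < 4 * Ce * K₁ * (1 / (q - 2))) 0
  refine ⟨K₂, hK₂, ?_⟩
  intro lam x y z X Y Z hlam h
  obtain ⟨F, F', hF, hF', heF, hFe⟩ := hlyap lam x y z X Y Z hlam h
  set e := modeEnergy l lam ρ₁ ρ₂ k k₂ a q x y z X Y Z with he
  have hy := h.continuousOn_y
  have hde := fun t (ht : 0 ≤ t) => h.hasDerivWithinAt_modeEnergy H.ρ₁_pos.ne' H.ρ₂_pos.ne' ht
  have hanti := modeEnergy_antitoneOn H h
  have hpos := fun t (ht : 0 ≤ t) => modeEnergy_nonneg H lam x y z X Y Z ht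
  rw [← he] at hanti
  have hec : ContinuousOn e (Ici 0) := fun t ht => (hde t ht).continuousWithinAt
  have hye : ∀ t, 0 ≤ t → (lam * y t) ^ 2 ≤ Ce * e t := by
    intro t ht
    have hΓ := mul_nonneg (sq_nonneg lam) (quadMem_nonneg (g := polyKernel a q)
      (fun s hs => (polyKernel_pos ha (by linarith)).le) y ht)
    refine le_trans ?_ (hle lam x y z X Y Z t ht)
    linarith [sq_nonneg (X t), sq_nonneg (Y t), sq_nonneg (Z t),
      sq_nonneg (lam * x t + y t + l * z t), sq_nonneg (lam * z t + l * x t)]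
  have htail : ∀ t τ, 0 ≤ t → 0 ≤ τ → lam ^ 2 * quadMem (polyKernel a q) y t ≤
      (1 + τ) * (2 / q * -(-(1 / 2 * lam ^ 2 * (q * quadMem (polyKernel a (q + 1)) y t
        + polyKernel a q t * y t ^ 2))))
      + a / (1 + τ) ^ q * (lam ^ 2 * ∫ s in (0 : ℝ)..t, (y t - y s) ^ 2) := by
    intro t τ ht hτ
    have h1 := mul_le_mul_of_nonneg_left (quadMem_le_tail ha hq hy ht hτ) (sq_nonneg lam)
    have h2 := (polyKernel_pos (r := q) ha (by linarith : -1 < t)).le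
    have h3 : 0 ≤ (1 + τ) * (2 / q * (1 / 2 * lam ^ 2 * (polyKernel a q t * y t ^ 2))) := by
      positivity
    have e1 : (1 + τ) * (2 / q * -(-(1 / 2 * lam ^ 2 * (q * quadMem (polyKernel a (q + 1)) y t
        + polyKernel a q t * y t ^ 2)))) = lam ^ 2 * ((1 + τ) * quadMem (polyKernel a (q + 1)) y t)
        + (1 + τ) * (2 / q * (1 / 2 * lam ^ 2 * (polyKernel a q t * y t ^ 2))) := by
      field_simp
    rw [e1]
    rw [polyKernel] at h1
    linarith
  have hW : ∀ t, 0 ≤ t → lam ^ 2 * (∫ s in (0 : ℝ)..t, (y t - y s) ^ 2) ≤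
      ∫ s in (0 : ℝ)..t, 4 * Ce * e s := by
    intro t ht
    rw [← intervalIntegral.integral_const_mul]
    refine intervalIntegral.integral_mono_on ht ?_ ?_ fun s hs => ?_
    · exact ((continuousOn_const.mul ((continuousOn_const.sub hy).pow 2)).mono
        Icc_subset_Ici_self).intervalIntegrable_of_Icc ht
    · exact ((continuousOn_const.mul hec).mono Icc_subset_Ici_self).intervalIntegrable_of_Icc ht
    · have h1 := hye t ht
      have h2 := hye s hs.1
      have h3 : Ce * e t ≤ Ce * e s :=
        mul_le_mul_of_nonneg_left (hanti hs.1 ht hs.2) hCe.le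
      nlinarith [sq_nonneg (lam * y t + lam * y s)]
  have hdec := hdec₁ e _ F F' _ (fun t => lam ^ 2 * ∫ s in (0 : ℝ)..t, (y t - y s) ^ 2)
    hde hanti hpos hF hF' heF hFe htail fun t ht => by
      refine (hW t ht).trans ?_
      have h0 := hpos 0 le_rfl
      calc ∫ s in (0 : ℝ)..t, 4 * Ce * e s ≤ ∫ s in (0 : ℝ)..t, 4 * Ce * e 0 := by
            refine intervalIntegral.integral_mono_on ht
              ((continuousOn_const.mul hec).mono Icc_subset_Ici_self |>.intervalIntegrable_of_Icc
                ht) intervalIntegrable_const fun s hs => ?_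
            exact mul_le_mul_of_nonneg_left (hanti self_mem_Ici hs.1 hs.1) (by positivity)
        _ = 4 * Ce * e 0 * t := by
            rw [intervalIntegral.integral_const]
            simp [mul_comm]
        _ ≤ 4 * Ce * e 0 * (1 + t) ^ 1 := by
            have : 0 ≤ 4 * Ce * e 0 := by positivity
            nlinarith
  have hdec' := hdec₂ e _ F F' _ (fun t => lam ^ 2 * ∫ s in (0 : ℝ)..t, (y t - y s) ^ 2)
    hde hanti hpos hF hF' heF hFe htail fun t ht => by
      refine (hW t ht).trans ?_
      have h0 := hpos 0 le_rfl
      -- The rate `q - 1` is written `q - 2 + 1` so that `mul_mass_polyKernel_succ` evaluates its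
      -- integral, which is at most `1/(q-2)`.
      have hcK : ContinuousOn (polyKernel 1 (q - 2 + 1)) (Icc 0 t) :=
        (continuousOn_polyKernel 1 (q - 2 + 1)).mono fun s hs => by
          simp only [mem_Ioi]
          linarith [hs.1]
      calc ∫ s in (0 : ℝ)..t, 4 * Ce * e s
          ≤ ∫ s in (0 : ℝ)..t, 4 * Ce * K₁ * e 0 * polyKernel 1 (q - 2 + 1) s := by
            refine intervalIntegral.integral_mono_on ht
              ((continuousOn_const.mul hec).mono Icc_subset_Ici_self |>.intervalIntegrable_of_Icc
                ht) ((continuousOn_const.mul hcK).intervalIntegrable_of_Icc ht) fun s hs => ?_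
            have hs1 : (0 : ℝ) < 1 + s := by linarith [hs.1]
            have h1 := hdec s hs.1
            have e1 : (1 + s) ^ q = (1 + s) ^ (q - 2 + 1) * (1 + s) := by
              rw [← Real.rpow_add_one hs1.ne']
              congr 1
              ring
            have h2 : e s * (1 + s) ^ (q - 2 + 1) ≤ K₁ * e 0 := by
              refine le_of_mul_le_mul_right ?_ hs1
              rw [e1] at h1
              linarith
            have h3 : e s ≤ K₁ * e 0 * polyKernel 1 (q - 2 + 1) s := by
              rw [polyKernel, mul_one_div, le_div_iff₀ (Real.rpow_pos_of_pos hs1 _)]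
              exact h2
            calc 4 * Ce * e s ≤ 4 * Ce * (K₁ * e 0 * polyKernel 1 (q - 2 + 1) s) := by gcongr
              _ = _ := by ring
        _ = 4 * Ce * K₁ * e 0 * mass (polyKernel 1 (q - 2 + 1)) t := by
            rw [intervalIntegral.integral_const_mul, mass]
        _ ≤ 4 * Ce * K₁ * e 0 * (1 / (q - 2)) := by
            have h2 : 0 < q - 2 := by linarith
            have h3 := mul_mass_polyKernel_succ (a := 1) (q := q - 2) ht
            have h4 := (polyKernel_pos (a := 1) (r := q - 2) one_pos (by linarith : -1 < t)).le
            have h5 : mass (polyKernel 1 (q - 2 + 1)) t ≤ 1 / (q - 2) := by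
              rw [le_div_iff₀ h2]
              linarith
            gcongr
        _ = _ := by ring
  intro t ht
  simpa using hdec' t ht

/-- A mode that does not vanish decays no faster than the relaxation function. -/
theorem IsMode.exists_le_modeEnergy {lam : ℝ} {x y z X Y Z : ℝ → ℝ}
    (H : Admissible l ρ₁ ρ₂ k k₂ a q) (hlam : 2 * l ≤ lam)
    (h : IsMode l lam ρ₁ ρ₂ k k₂ a q x y z X Y Z)
    (h0 : modeEnergy l lam ρ₁ ρ₂ k k₂ a q x y z X Y Z 0 ≠ 0) :
    ∃ c, 0 < c ∧ ∀ t, 0 ≤ t →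
      c / (1 + t) ^ q ≤ modeEnergy l lam ρ₁ ρ₂ k k₂ a q x y z X Y Z t := by
  have ha := H.a_pos
  have hq := H.q_pos
  have hlam0 : 0 < lam := by linarith [H.l_pos]
  obtain ⟨K, hK, hdec⟩ := exists_modeEnergy_decay H
  replace hdec := hdec lam x y z X Y Z hlam h
  obtain ⟨Ce, hCe, hle⟩ := Bresse.exists_le_modeEnergy H
  set e := modeEnergy l lam ρ₁ ρ₂ k k₂ a q x y z X Y Z with he
  have hy := h.continuousOn_y
  have hde := fun t (ht : 0 ≤ t) => h.hasDerivWithinAt_modeEnergy H.ρ₁_pos.ne' H.ρ₂_pos.ne' ht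
  have hanti := modeEnergy_antitoneOn H h
  have hpos := fun t (ht : 0 ≤ t) => modeEnergy_nonneg H lam x y z X Y Z ht
  rw [← he] at hanti
  have hKq : ∀ s, 0 ≤ s → 0 ≤ polyKernel a q s := fun s hs => (polyKernel_pos ha (by linarith)).le
  have htend : Tendsto e atTop (𝓝 0) := by
    have h1 : Tendsto (fun t : ℝ => K * e 0 / (1 + t) ^ q) atTop (𝓝 0) :=
      ((tendsto_rpow_atTop hq).comp (tendsto_atTop_add_const_left _ 1 tendsto_id)).const_div_atTop _
    refine squeeze_zero' ?_ ?_ h1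
    · filter_upwards [eventually_ge_atTop 0] with t ht using hpos t ht
    · filter_upwards [eventually_ge_atTop 0] with t ht
      rw [le_div_iff₀ (Real.rpow_pos_of_pos (by linarith) q)]
      exact hdec t ht
  have hye : ∀ t, 0 ≤ t → (lam * y t) ^ 2 ≤ Ce * e t := by
    intro t ht
    have hΓ := mul_nonneg (sq_nonneg lam) (quadMem_nonneg hKq y ht)
    refine le_trans ?_ (hle lam x y z X Y Z t ht)
    linarith [sq_nonneg (X t), sq_nonneg (Y t), sq_nonneg (Z t),
      sq_nonneg (lam * x t + y t + l * z t), sq_nonneg (lam * z t + l * x t)]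
  -- If `y` vanished identically, nothing would dissipate and the energy would be constant, although
  -- it tends to zero from a nonzero value.
  by_cases hyz : ∀ t, 0 ≤ t → y t = 0
  · exfalso
    have hmono : MonotoneOn e (Ici 0) := by
      refine monotoneOn_of_hasDerivWithinAt_nonneg (convex_Ici 0)
        (fun t ht => (hde t ht).continuousWithinAt)
        (fun t ht => (hde t (interior_subset ht)).mono interior_subset) fun t ht => ?_
      have ht0 : 0 ≤ t := interior_subset ht
      have : quadMem (polyKernel a (q + 1)) y t = 0 := by
        rw [quadMem, intervalIntegral.integral_congr (g := fun _ => 0), intervalIntegral.integral_zero]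
        intro s hs
        rw [uIcc_of_le ht0] at hs
        simp only [hyz t ht0, hyz s hs.1]
        ring
      rw [this, hyz t ht0]
      norm_num
    have h1 : e 0 ≤ 0 := by
      refine ge_of_tendsto htend ?_
      filter_upwards [eventually_ge_atTop 0] with t ht using hmono self_mem_Ici ht ht
    exact h0 (le_antisymm h1 (hpos 0 le_rfl))
  push Not at hyz
  obtain ⟨s₁, hs₁, hys₁⟩ := hyz
  set T := s₁ + 1 with hT
  have hT0 : 0 < T := by linarith
  have hysq : IntervalIntegrable (fun s => y s ^ 2) volume 0 T :=
    ((hy.pow 2).mono Icc_subset_Ici_self).intervalIntegrable_of_Icc hT0.le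
  set J := ∫ s in (0 : ℝ)..T, y s ^ 2 with hJ
  have hJ0 : 0 < J := by
    refine intervalIntegral.integral_pos hT0 ((hy.pow 2).mono Icc_subset_Ici_self)
      (fun s _ => sq_nonneg _) ⟨s₁, ⟨hs₁, by linarith⟩, by positivity⟩
  -- After `t₁` the present value is so small that the deviation from the history on `[0,T]` keeps
  -- at least `J/4`, by `(u - v)² ≥ v²/2 - u²`.
  obtain ⟨t₁, ht₁T, ht₁⟩ : ∃ t₁, T ≤ t₁ ∧ ∀ t, t₁ ≤ t → T * y t ^ 2 ≤ J / 4 := by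
    have h1 : Tendsto (fun t => T * (Ce / lam ^ 2 * e t)) atTop (𝓝 0) := by
      simpa using (htend.const_mul (Ce / lam ^ 2)).const_mul T
    have h2 := (h1.eventually (gt_mem_nhds (by positivity : 0 < J / 4))).and
      (eventually_ge_atTop T)
    obtain ⟨t₁, ht₁⟩ := eventually_atTop.1 h2
    refine ⟨max t₁ T, le_max_right _ _, fun t ht => ?_⟩
    obtain ⟨h3, h4⟩ := ht₁ t ((le_max_left _ _).trans ht)
    refine le_trans ?_ h3.le
    have h5 := hye t (hT0.le.trans h4)
    gcongr
    rw [div_mul_eq_mul_div, le_div_iff₀ (by positivity)]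
    linarith
  have hlow : ∀ t, t₁ ≤ t → lam ^ 2 / 2 * (J / 4) * a / (1 + t) ^ q ≤ e t := by
    intro t ht
    have ht0 : 0 ≤ t := by linarith
    have hysq' : ContinuousOn (fun s => (y t - y s) ^ 2) (Ici 0) :=
      (continuousOn_const.sub hy).pow 2
    have h1 : J / 4 ≤ ∫ s in (0 : ℝ)..T, (y t - y s) ^ 2 := by
      calc J / 4 ≤ 1 / 2 * J - T * y t ^ 2 := by linarith [ht₁ t ht]
        _ = ∫ s in (0 : ℝ)..T, (1 / 2 * y s ^ 2 - y t ^ 2) := by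
          rw [intervalIntegral.integral_sub (hysq.const_mul _) intervalIntegrable_const,
            intervalIntegral.integral_const_mul, intervalIntegral.integral_const]
          simp [hJ]
        _ ≤ _ := by
          refine intervalIntegral.integral_mono_on hT0.le
            ((hysq.const_mul _).sub intervalIntegrable_const)
            ((hysq'.mono Icc_subset_Ici_self).intervalIntegrable_of_Icc hT0.le) fun s _ => ?_
          nlinarith [sq_nonneg (y s - 2 * y t)]
    have h2 : ∫ s in (0 : ℝ)..T, (y t - y s) ^ 2 ≤ ∫ s in (0 : ℝ)..t, (y t - y s) ^ 2 := by
      refine intervalIntegral.integral_mono_interval le_rfl hT0.le (ht₁T.trans ht)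
        (Eventually.of_forall fun s => sq_nonneg _)
        ((hysq'.mono Icc_subset_Ici_self).intervalIntegrable_of_Icc ht0)
    have h3 := le_quadMem ha hq hy ht0
    have h4 : polyKernel a q t * (J / 4) ≤ quadMem (polyKernel a q) y t :=
      le_trans (mul_le_mul_of_nonneg_left (h1.trans h2) (hKq t ht0)) h3
    have h5 : 1 / 2 * (lam ^ 2 * quadMem (polyKernel a q) y t) ≤ e t := by
      have hm := mass_le H ht0
      have i1 : 0 ≤ (k₂ - mass (polyKernel a q) t) * (lam * y t) ^ 2 :=
        mul_nonneg (by linarith) (sq_nonneg _)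
      have i2 := mul_nonneg H.ρ₁_pos.le (sq_nonneg (X t))
      have i3 := mul_nonneg H.ρ₂_pos.le (sq_nonneg (Y t))
      have i4 := mul_nonneg H.ρ₁_pos.le (sq_nonneg (Z t))
      have i5 := mul_nonneg H.k_pos.le (sq_nonneg (lam * z t + l * x t))
      have i6 := mul_nonneg H.k_pos.le (sq_nonneg (lam * x t + y t + l * z t))
      rw [he, modeEnergy]
      linarith
    refine le_trans ?_ h5
    calc lam ^ 2 / 2 * (J / 4) * a / (1 + t) ^ q = 1 / 2 * (lam ^ 2 * (polyKernel a q t * (J / 4)))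
        := by rw [polyKernel]; ring
      _ ≤ _ := by gcongr
  have hlam2 : 0 < lam ^ 2 / 2 * (J / 4) * a := by positivity
  have ht₁0 : 0 ≤ t₁ := hT0.le.trans ht₁T
  have het₁ : 0 < e t₁ := lt_of_lt_of_le
    (div_pos hlam2 (Real.rpow_pos_of_pos (by linarith) q)) (hlow t₁ le_rfl)
  refine ⟨min (lam ^ 2 / 2 * (J / 4) * a) (e t₁), lt_min hlam2 het₁, fun t ht => ?_⟩
  have h1q : (1 : ℝ) ≤ (1 + t) ^ q := Real.one_le_rpow (by linarith) hq.le
  rcases le_total t₁ t with h1 | h1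
  · exact le_trans (by gcongr; exact min_le_left _ _) (hlow t h1)
  · calc _ ≤ e t₁ / (1 + t) ^ q := by gcongr; exact min_le_right _ _
      _ ≤ e t₁ := div_le_self het₁.le h1q
      _ ≤ e t := hanti ht ht₁0 h1

/-- Once `y`, the shear and the axial term vanish, `x` and `z` solve a linear system with
determinant `lam² - l²` up to sign, which is nonzero since `2 l ≤ lam`. -/
theorem eq_zero_of_modeEnergy_eq_zero {lam : ℝ} {x y z X Y Z : ℝ → ℝ}
    (H : Admissible l ρ₁ ρ₂ k k₂ a q) (hlam : 2 * l ≤ lam) {t : ℝ} (ht : 0 ≤ t)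
    (h0 : modeEnergy l lam ρ₁ ρ₂ k k₂ a q x y z X Y Z t = 0) :
    x t = 0 ∧ y t = 0 ∧ z t = 0 ∧ X t = 0 ∧ Y t = 0 ∧ Z t = 0 := by
  have hl := H.l_pos
  obtain ⟨Ce, hCe, hle⟩ := Bresse.exists_le_modeEnergy H
  have h1 := hle lam x y z X Y Z t ht
  rw [h0, mul_zero] at h1
  have hΓ := mul_nonneg (sq_nonneg lam) (quadMem_nonneg (g := polyKernel a q)
    (fun s hs => (polyKernel_pos H.a_pos (by linarith)).le) y ht)
  have sq := fun v : ℝ => sq_nonneg v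
  have hX : X t = 0 := pow_eq_zero_iff two_ne_zero |>.1 (le_antisymm (by
    linarith [sq (X t), sq (Y t), sq (Z t), sq (lam * y t), sq (lam * x t + y t + l * z t),
      sq (lam * z t + l * x t)]) (sq _))
  have hY : Y t = 0 := pow_eq_zero_iff two_ne_zero |>.1 (le_antisymm (by
    linarith [sq (X t), sq (Y t), sq (Z t), sq (lam * y t), sq (lam * x t + y t + l * z t),
      sq (lam * z t + l * x t)]) (sq _))
  have hZ : Z t = 0 := pow_eq_zero_iff two_ne_zero |>.1 (le_antisymm (by
    linarith [sq (X t), sq (Y t), sq (Z t), sq (lam * y t), sq (lam * x t + y t + l * z t),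
      sq (lam * z t + l * x t)]) (sq _))
  have hy : lam * y t = 0 := pow_eq_zero_iff two_ne_zero |>.1 (le_antisymm (by
    linarith [sq (X t), sq (Y t), sq (Z t), sq (lam * y t), sq (lam * x t + y t + l * z t),
      sq (lam * z t + l * x t)]) (sq _))
  have hS : lam * x t + y t + l * z t = 0 := pow_eq_zero_iff two_ne_zero |>.1 (le_antisymm (by
    linarith [sq (X t), sq (Y t), sq (Z t), sq (lam * y t), sq (lam * x t + y t + l * z t),
      sq (lam * z t + l * x t)]) (sq _))
  have hA : lam * z t + l * x t = 0 := pow_eq_zero_iff two_ne_zero |>.1 (le_antisymm (by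
    linarith [sq (X t), sq (Y t), sq (Z t), sq (lam * y t), sq (lam * x t + y t + l * z t),
      sq (lam * z t + l * x t)]) (sq _))
  have hlam0 : lam ≠ 0 := by linarith
  have hy' : y t = 0 := (mul_eq_zero.1 hy).resolve_left hlam0
  have hd : lam ^ 2 - l ^ 2 ≠ 0 := by
    have : 0 < lam ^ 2 - l ^ 2 := by nlinarith
    exact this.ne'
  have hx' : (lam ^ 2 - l ^ 2) * x t = 0 := by
    rw [hy'] at hS
    linear_combination lam * hS - l * hA
  have hz' : (lam ^ 2 - l ^ 2) * z t = 0 := by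
    rw [hy'] at hS
    linear_combination lam * hA - l * hS
  exact ⟨(mul_eq_zero.1 hx').resolve_left hd, hy', (mul_eq_zero.1 hz').resolve_left hd, hX, hY, hZ⟩

/-- A mode is determined by its initial data. -/
theorem IsMode.eq_of_initial {lam : ℝ} {x y z X Y Z x₂ y₂ z₂ X₂ Y₂ Z₂ : ℝ → ℝ}
    (H : Admissible l ρ₁ ρ₂ k k₂ a q) (hlam : 2 * l ≤ lam)
    (h : IsMode l lam ρ₁ ρ₂ k k₂ a q x y z X Y Z)
    (h₂ : IsMode l lam ρ₁ ρ₂ k k₂ a q x₂ y₂ z₂ X₂ Y₂ Z₂)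
    (hx : x 0 = x₂ 0) (hy : y 0 = y₂ 0) (hz : z 0 = z₂ 0)
    (hX : X 0 = X₂ 0) (hY : Y 0 = Y₂ 0) (hZ : Z 0 = Z₂ 0) {t : ℝ} (ht : 0 ≤ t) :
    x t = x₂ t ∧ y t = y₂ t ∧ z t = z₂ t ∧ X t = X₂ t ∧ Y t = Y₂ t ∧ Z t = Z₂ t := by
  have hd := h.sub h₂
  have h1 := modeEnergy_antitoneOn H hd self_mem_Ici ht ht
  have h2 := modeEnergy_nonneg H lam (x - x₂) (y - y₂) (z - z₂) (X - X₂) (Y - Y₂) (Z - Z₂) ht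
  have h3 : modeEnergy l lam ρ₁ ρ₂ k k₂ a q (x - x₂) (y - y₂) (z - z₂) (X - X₂) (Y - Y₂)
      (Z - Z₂) 0 = 0 := by
    simp [modeEnergy, quadMem, hx, hy, hz, hX, hY, hZ]
  obtain ⟨a1, a2, a3, a4, a5, a6⟩ :=
    eq_zero_of_modeEnergy_eq_zero H hlam ht (le_antisymm (h1.trans h3.le) h2)
  simp only [Pi.sub_apply, sub_eq_zero] at a1 a2 a3 a4 a5 a6
  exact ⟨a1, a2, a3, a4, a5, a6⟩

end Mode

/-! ### Fourier series on `(0,L)` -/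

theorem memLp_of_continuous (L : ℝ) {f : ℝ → ℝ} (hf : Continuous f) :
    MemLp f 2 (volume.restrict (Ioo 0 L)) := by
  obtain ⟨C, hC⟩ := (isCompact_Icc (a := (0 : ℝ)) (b := L)).exists_bound_of_continuousOn
    hf.continuousOn
  refine MemLp.of_bound hf.aestronglyMeasurable C ?_
  filter_upwards [ae_restrict_mem measurableSet_Ioo] with x hx
  exact hC x (Ioo_subset_Icc_self hx)

/-- The restriction to `(0,L)` of a continuous function, as an element of `L²(0,L)`. -/
def restrictL2 (L : ℝ) (f : ℝ → ℝ) (hf : Continuous f) : L2 L := (memLp_of_continuous L hf).toLp f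

theorem coeFn_restrictL2 (L : ℝ) {f : ℝ → ℝ} (hf : Continuous f) :
    restrictL2 L f hf =ᵐ[volume.restrict (Ioo 0 L)] f := MemLp.coeFn_toLp _

theorem inner_restrictL2 {L : ℝ} (v : L2 L) {f : ℝ → ℝ} (hf : Continuous f) :
    inner ℝ v (restrictL2 L f hf) = ∫ x in Ioo 0 L, v x * f x := by
  rw [L2.inner_def]
  refine integral_congr_ae ?_
  filter_upwards [coeFn_restrictL2 L hf] with x hx
  rw [hx]
  simp [mul_comm]

theorem inner_restrictL2_restrictL2 {L : ℝ} {f g : ℝ → ℝ} (hf : Continuous f) (hg : Continuous g) :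
    inner ℝ (restrictL2 L f hf) (restrictL2 L g hg) = ∫ x in Ioo 0 L, f x * g x := by
  rw [inner_restrictL2]
  refine integral_congr_ae ?_
  filter_upwards [coeFn_restrictL2 L hf] with x hx
  rw [hx]

theorem tendsto_restrictL2 {L C : ℝ} {f : ℝ → ℝ} {F : ℕ → ℝ → ℝ} (hf : Continuous f)
    (hF : ∀ n, Continuous (F n)) (hb : ∀ n, ∀ x ∈ Ioo 0 L, |F n x| ≤ C)
    (hlim : ∀ x ∈ Ioo 0 L, Tendsto (fun n => F n x) atTop (𝓝 (f x))) :
    Tendsto (fun n => restrictL2 L (F n) (hF n)) atTop (𝓝 (restrictL2 L f hf)) := by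
  rw [tendsto_iff_norm_sub_tendsto_zero]
  have hsq : ∀ n, ‖restrictL2 L (F n) (hF n) - restrictL2 L f hf‖ ^ 2 =
      ∫ x in Ioo 0 L, (F n x - f x) ^ 2 := by
    intro n
    have e : restrictL2 L (F n) (hF n) - restrictL2 L f hf =
        restrictL2 L (fun x => F n x - f x) ((hF n).sub hf) := (MemLp.toLp_sub _ _).symm
    rw [e, ← real_inner_self_eq_norm_sq, inner_restrictL2_restrictL2]
    simp only [sq]
  have hC : ∀ x ∈ Ioo 0 L, |f x| ≤ C := fun x hx =>
    le_of_tendsto (hlim x hx).abs (Eventually.of_forall fun n => hb n x hx)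
  have h0 : Tendsto (fun n => ∫ x in Ioo 0 L, (F n x - f x) ^ 2) atTop
      (𝓝 (∫ _x in Ioo 0 L, (0 : ℝ))) := by
    refine tendsto_integral_filter_of_norm_le_const ?_ ?_ ?_
    · exact Eventually.of_forall fun n => (((hF n).sub hf).pow 2).aestronglyMeasurable
    · refine ⟨(C + C) ^ 2, Eventually.of_forall fun n => ?_⟩
      filter_upwards [ae_restrict_mem measurableSet_Ioo] with x hx
      rw [norm_pow, Real.norm_eq_abs]
      have := abs_sub (F n x) (f x)
      have h1 := hb n x hx
      have h2 := hC x hx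
      gcongr
      linarith
    · filter_upwards [ae_restrict_mem measurableSet_Ioo] with x hx
      simpa using ((hlim x hx).sub_const (f x)).pow 2
  rw [integral_zero] at h0
  have h1 := (Real.continuous_sqrt.tendsto 0).comp h0
  rw [Real.sqrt_zero] at h1
  refine h1.congr fun n => ?_
  simp only [Function.comp]
  rw [← hsq, Real.sqrt_sq (norm_nonneg _)]

theorem restrictL2_mem_H1 {L : ℝ} (hL : 0 < L) {f : ℝ → ℝ} (hf : ContDiff ℝ ∞ f) :
    (restrictL2 L f hf.continuous,
      restrictL2 L (deriv f) (hf.continuous_deriv (by simp))) ∈ H1 L := by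
  intro η hη
  have h1 : ∀ g k : ℝ → ℝ, ∀ hg : Continuous g,
      ∫ x in Ioo (0 : ℝ) L, (restrictL2 L g hg) x * k x = ∫ x in (0 : ℝ)..L, g x * k x := by
    intro g k hg
    rw [intervalIntegral.integral_of_le hL.le, integral_Ioc_eq_integral_Ioo]
    refine integral_congr_ae ?_
    filter_upwards [coeFn_restrictL2 L hg] with x hx
    rw [hx]
  rw [h1, h1]
  have hz : ∀ x, x ∉ Ioo 0 L → η x = 0 := fun x hx => image_eq_zero_of_notMem_tsupport
    fun h => hx (hη.2.2 h)
  have hfd := hf.differentiable (by simp)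
  have hηd := hη.1.differentiable (by simp)
  rw [intervalIntegral.integral_mul_deriv_eq_deriv_mul (u := f) (v := η)
    (fun x _ => (hfd x).hasDerivAt) (fun x _ => (hηd x).hasDerivAt)
    ((hf.continuous_deriv (by simp)).intervalIntegrable _ _)
    ((hη.1.continuous_deriv (by simp)).intervalIntegrable _ _), hz 0 (by simp), hz L (by simp)]
  simp

/-- The function is cut off by a smooth step of `m x (L - x) - 1`. The derivative of the cutoff has
size `m`, but it lives where `m x (L - x) ≤ 2`, and there the linear vanishing of `f` at the ends
compensates. Bounded convergence then gives the limit of both components. -/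
theorem restrictL2_mem_H10 {L C : ℝ} (hL : 0 < L) {f : ℝ → ℝ} (hf : ContDiff ℝ ∞ f)
    (hC : ∀ x ∈ Ioo 0 L, |f x| ≤ C * (x * (L - x))) :
    (restrictL2 L f hf.continuous,
      restrictL2 L (deriv f) (hf.continuous_deriv (by simp))) ∈ H10 L := by
  have hdf := hf.continuous_deriv (n := ∞) (by simp)
  have hTs : ContDiff ℝ ∞ Real.smoothTransition := Real.smoothTransition.contDiff
  have hdT := hTs.continuous_deriv (n := ∞) (by simp)
  set T := Real.smoothTransition with hT
  set u : ℕ → ℝ → ℝ := fun m x => m * (x * (L - x)) - 1 with hu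
  have hus : ∀ m, ContDiff ℝ ∞ (u m) := fun m => by fun_prop
  set η : ℕ → ℝ → ℝ := fun m x => f x * T (u m x) with hη
  have hηs : ∀ m, ContDiff ℝ ∞ (η m) := fun m => hf.mul (hTs.comp (hus m))
  have hud : ∀ m x, HasDerivAt (u m) (m * (L - 2 * x)) x := by
    intro m x
    have := (((hasDerivAt_id x).mul ((hasDerivAt_id x).const_sub L)).const_mul (m : ℝ)).sub_const 1
    refine this.congr_deriv ?_
    simp only [id]
    ring
  have hηd : ∀ m x, deriv (η m) x =
      deriv f x * T (u m x) + f x * (deriv T (u m x) * (m * (L - 2 * x))) := by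
    intro m x
    have h1 := (hf.differentiable (by simp) x).hasDerivAt
    have h2 := ((hTs.differentiable (by simp) (u m x)).hasDerivAt).comp x (hud m x)
    exact (h1.mul h2).deriv
  have hT1 : ∀ s, 1 < s → deriv T s = 0 := by
    intro s hs
    have : T =ᶠ[𝓝 s] fun _ => 1 := by
      filter_upwards [lt_mem_nhds hs] with r hr using Real.smoothTransition.one_of_one_le hr.le
    rw [this.deriv_eq]
    simp
  obtain ⟨D, hD⟩ := (isCompact_Icc (a := (-1 : ℝ)) (b := 1)).exists_bound_of_continuousOn
    hdT.continuousOn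
  have hD0 : 0 ≤ D := (norm_nonneg _).trans (hD 0 (by norm_num))
  obtain ⟨B, hB⟩ := (isCompact_Icc (a := (0 : ℝ)) (b := L)).exists_bound_of_continuousOn
    hf.continuous.continuousOn
  obtain ⟨B', hB'⟩ := (isCompact_Icc (a := (0 : ℝ)) (b := L)).exists_bound_of_continuousOn
    hdf.continuousOn
  have hTabs : ∀ s, |T s| ≤ 1 := fun s => by
    rw [abs_of_nonneg (Real.smoothTransition.nonneg s)]
    exact Real.smoothTransition.le_one s
  have hularge : ∀ x ∈ Ioo 0 L, ∀ᶠ m : ℕ in atTop, 1 < u m x := by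
    intro x hx
    have hx0 : 0 < x * (L - x) := mul_pos hx.1 (by linarith [hx.2])
    have := (tendsto_natCast_atTop_atTop (R := ℝ)).atTop_mul_const hx0
    filter_upwards [this.eventually_gt_atTop 2] with m hm
    simp only [hu]
    linarith
  have hpos : ∀ m x, η m x ≠ 0 → 1 < m * (x * (L - x)) := by
    intro m x h
    by_contra! hc
    exact h (by simp only [hη, hu, hT, Real.smoothTransition.zero_of_nonpos (sub_nonpos.2 hc),
      mul_zero])
  have hsupp : ∀ m, tsupport (η m) ⊆ {x | 1 ≤ (m : ℝ) * (x * (L - x))} := by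
    intro m
    refine closure_minimal (fun x hx => (hpos m x hx).le) (isClosed_le (by fun_prop) (by fun_prop))
  have hIoo : ∀ m : ℕ, {x : ℝ | 1 ≤ (m : ℝ) * (x * (L - x))} ⊆ Ioo 0 L := by
    intro m x hx
    simp only [mem_ofPred_eq] at hx
    have hx0 : 0 < x * (L - x) := by
      by_contra! hc
      linarith [mul_nonpos_of_nonneg_of_nonpos (Nat.cast_nonneg m : (0 : ℝ) ≤ m) hc]
    constructor
    · by_contra! hc
      nlinarith
    · by_contra! hc
      nlinarith
  have htest : ∀ m, IsTest L (η m) := fun m =>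
    ⟨hηs m, HasCompactSupport.of_support_subset_isCompact isCompact_Icc
      ((subset_tsupport _).trans (((hsupp m).trans (hIoo m)).trans Ioo_subset_Icc_self)),
      (hsupp m).trans (hIoo m)⟩
  have hdηc : ∀ m, Continuous (deriv (η m)) := fun m => (hηs m).continuous_deriv (n := ∞) (by simp)
  have l1 : Tendsto (fun m => restrictL2 L (η m) (hηs m).continuous) atTop
      (𝓝 (restrictL2 L f hf.continuous)) := by
    refine tendsto_restrictL2 (C := B) _ _ (fun m x hx => ?_) fun x hx => ?_
    · rw [abs_mul]
      have h1 := hB x (Ioo_subset_Icc_self hx)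
      rw [Real.norm_eq_abs] at h1
      exact (mul_le_of_le_one_right (abs_nonneg _) (hTabs _)).trans h1
    · refine tendsto_const_nhds.congr' ?_
      filter_upwards [hularge x hx] with m hm
      simp only [hη, hT, Real.smoothTransition.one_of_one_le hm.le, mul_one]
  have l2 : Tendsto (fun m => restrictL2 L (deriv (η m)) (hdηc m)) atTop
      (𝓝 (restrictL2 L (deriv f) hdf)) := by
    refine tendsto_restrictL2 (C := B' + |C| * (2 * D * L)) _ _ (fun m x hx => ?_) fun x hx => ?_
    · rw [hηd]
      have h1 := hB' x (Ioo_subset_Icc_self hx)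
      rw [Real.norm_eq_abs] at h1
      have h2 : |deriv f x * T (u m x)| ≤ B' := by
        rw [abs_mul]
        exact (mul_le_of_le_one_right (abs_nonneg _) (hTabs _)).trans h1
      have hx0 : 0 < x * (L - x) := mul_pos hx.1 (by linarith [hx.2])
      have h3 : |f x * (deriv T (u m x) * (m * (L - 2 * x)))| ≤ |C| * (2 * D * L) := by
        rcases lt_or_ge 1 (u m x) with h | h
        · rw [hT1 _ h]
          simp only [zero_mul, mul_zero, abs_zero]
          positivity
        · have hm0 : (0 : ℝ) ≤ m := Nat.cast_nonneg m
          have h4 : m * (x * (L - x)) ≤ 2 := by simp only [hu] at h; linarith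
          have h5 := hD (u m x) ⟨by simp only [hu]; linarith [mul_nonneg hm0 hx0.le], h⟩
          rw [Real.norm_eq_abs] at h5
          have h6 : |L - 2 * x| ≤ L := by
            rw [abs_le]
            constructor <;> linarith [hx.1, hx.2]
          have h7 : |f x| ≤ |C| * (x * (L - x)) :=
            (hC x hx).trans (mul_le_mul_of_nonneg_right (le_abs_self C) hx0.le)
          rw [abs_mul, abs_mul, abs_mul, abs_of_nonneg hm0]
          calc |f x| * (|deriv T (u m x)| * (m * |L - 2 * x|))
              ≤ |C| * (x * (L - x)) * (D * (m * L)) := by gcongr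
            _ = |C| * (m * (x * (L - x)) * D * L) := by ring
            _ ≤ |C| * (2 * D * L) := by gcongr
      exact (abs_add_le _ _).trans (add_le_add h2 h3)
    · refine tendsto_const_nhds.congr' ?_
      filter_upwards [hularge x hx] with m hm
      rw [hηd, hT1 _ hm, hT, Real.smoothTransition.one_of_one_le hm.le]
      ring
  refine mem_closure_of_tendsto (l1.prodMk_nhds l2) (Eventually.of_forall fun m => ?_)
  exact Submodule.subset_span ⟨η m, htest m, coeFn_restrictL2 L (hηs m).continuous,
    coeFn_restrictL2 L (hdηc m)⟩

/-- Integration by parts: there are no boundary terms between `H¹` and `H¹₀`. -/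
theorem inner_H1_H10 {L : ℝ} {p r : L2 L × L2 L} (hp : p ∈ H1 L) (hr : r ∈ H10 L) :
    inner ℝ p.2 r.1 + inner ℝ p.1 r.2 = 0 := by
  set Φ : L2 L × L2 L →L[ℝ] ℝ := (innerSL ℝ p.2).comp (ContinuousLinearMap.fst ℝ _ _)
    + (innerSL ℝ p.1).comp (ContinuousLinearMap.snd ℝ _ _) with hΦ
  -- The pairing is continuous in `r`, so by density test functions suffice, and for these it is the
  -- definition of the weak derivative.
  have hle : H10 L ≤ LinearMap.ker (Φ : L2 L × L2 L →ₗ[ℝ] ℝ) := by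
    refine Submodule.topologicalClosure_minimal _ (Submodule.span_le.2 ?_) Φ.isClosed_ker
    rintro ⟨a, b⟩ ⟨η, hη, ha, hb⟩
    have h := hp η hη
    have e1 : inner ℝ p.2 a = ∫ x in Ioo (0 : ℝ) L, p.2 x * η x := by
      rw [L2.inner_def]
      refine integral_congr_ae ?_
      filter_upwards [ha] with x hx
      rw [hx]
      simp [mul_comm]
    have e2 : inner ℝ p.1 b = ∫ x in Ioo (0 : ℝ) L, p.1 x * deriv η x := by
      rw [L2.inner_def]
      refine integral_congr_ae ?_
      filter_upwards [hb] with x hx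
      rw [hx]
      simp [mul_comm]
    change inner ℝ p.2 a + inner ℝ p.1 b = 0
    rw [e1, e2, h]
    ring
  exact hle hr

/-- The cosines are complete. -/
theorem ae_eq_zero_of_integral_cos {L : ℝ} (hL : 0 < L) {v : ℝ → ℝ} (hv : IntegrableOn v (Ioo 0 L))
    (h : ∀ n : ℕ, ∫ x in Ioo 0 L, v x * Real.cos (n * (Real.pi / L * x)) = 0) :
    ∀ᵐ x ∂(volume.restrict (Ioo 0 L)), v x = 0 := by
  have hint : ∀ f : ℝ → ℝ, Continuous f → IntegrableOn (fun x => v x * f x) (Ioo 0 L) := by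
    intro f hf
    obtain ⟨C, hC⟩ := (isCompact_Icc (a := (0 : ℝ)) (b := L)).exists_bound_of_continuousOn
      hf.continuousOn
    refine Integrable.mul_bdd (c := C) hv hf.aestronglyMeasurable ?_
    filter_upwards [ae_restrict_mem measurableSet_Ioo] with x hx
    exact hC x (Ioo_subset_Icc_self hx)
  -- Product-to-sum formulas lower the power of the cosine; the case `n = 0` puts `cos^(k+1)` into
  -- the form with `k` and frequency 1.
  have hpow : ∀ k n : ℕ, ∫ x in Ioo 0 L, v x * (Real.cos (Real.pi / L * x) ^ k *
      Real.cos (n * (Real.pi / L * x))) = 0 := by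
    intro k
    induction k with
    | zero => intro n; simpa using h n
    | succ k ih =>
      intro n
      rcases n with _ | n
      · simpa [pow_succ] using ih 1
      · have e : ∀ x, v x * (Real.cos (Real.pi / L * x) ^ (k + 1) *
            Real.cos (((n + 1 : ℕ) : ℝ) * (Real.pi / L * x))) =
            1 / 2 * (v x * (Real.cos (Real.pi / L * x) ^ k *
            Real.cos (((n + 2 : ℕ) : ℝ) * (Real.pi / L * x)))) +
            1 / 2 * (v x * (Real.cos (Real.pi / L * x) ^ k *
            Real.cos ((n : ℝ) * (Real.pi / L * x)))) := by
          intro x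
          set θ := Real.pi / L * x
          have e1 : ((n + 2 : ℕ) : ℝ) * θ = ((n + 1 : ℕ) : ℝ) * θ + θ := by push_cast; ring
          have e2 : (n : ℝ) * θ = ((n + 1 : ℕ) : ℝ) * θ - θ := by push_cast; ring
          rw [e1, e2, Real.cos_add, Real.cos_sub]
          ring
        simp_rw [e]
        rw [integral_add ((hint _ (by fun_prop)).const_mul _) ((hint _ (by fun_prop)).const_mul _),
          integral_const_mul, integral_const_mul, ih, ih]
        ring
  have hpoly : ∀ P : Polynomial ℝ,
      ∫ x in Ioo 0 L, v x * P.eval (Real.cos (Real.pi / L * x)) = 0 := by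
    intro P
    induction P using Polynomial.induction_on' with
    | add P Q hP hQ =>
      simp_rw [Polynomial.eval_add, mul_add]
      rw [integral_add (hint _ (by fun_prop)) (hint _ (by fun_prop)), hP, hQ, add_zero]
    | monomial k c =>
      have := hpow k 0
      simp only [Nat.cast_zero, zero_mul, Real.cos_zero, mul_one] at this
      simp_rw [Polynomial.eval_monomial, mul_left_comm _ c]
      rw [integral_const_mul, this, mul_zero]
  have hcont : ∀ F : ℝ → ℝ, Continuous F → ∫ x in Ioo 0 L, v x * F x = 0 := by
    intro F hF
    have hbound : ∀ ε, 0 < ε → |∫ x in Ioo 0 L, v x * F x| ≤ ε * ∫ x in Ioo 0 L, |v x| := by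
      intro ε hε
      -- The substitution `y = cos (π x / L)` is injective on `[0,L]`, so Weierstrass approximation
      -- of `F` in the variable `y` reduces continuous functions to polynomials in the cosine.
      obtain ⟨P, hP⟩ := exists_polynomial_near_of_continuousOn (-1) 1
        (fun y => F (L / Real.pi * Real.arccos y)) (by fun_prop) ε hε
      have e : ∫ x in Ioo 0 L, v x * F x =
          ∫ x in Ioo 0 L, v x * (F x - P.eval (Real.cos (Real.pi / L * x))) := by
        simp_rw [mul_sub]
        rw [integral_sub (hint F hF) (hint _ (by fun_prop)), hpoly, sub_zero]
      rw [e, ← integral_const_mul, ← Real.norm_eq_abs]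
      refine norm_integral_le_of_norm_le (hv.abs.const_mul ε) ?_
      filter_upwards [ae_restrict_mem measurableSet_Ioo] with x hx
      have hx1 : 0 ≤ Real.pi / L * x := mul_nonneg (by positivity) hx.1.le
      have hx2 : Real.pi / L * x ≤ Real.pi := by
        rw [div_mul_eq_mul_div, div_le_iff₀ hL]
        exact mul_le_mul_of_nonneg_left hx.2.le Real.pi_pos.le
      have h1 := hP (Real.cos (Real.pi / L * x)) ⟨Real.neg_one_le_cos _, Real.cos_le_one _⟩
      rw [Real.arccos_cos hx1 hx2] at h1
      have e2 : L / Real.pi * (Real.pi / L * x) = x := by field_simp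
      rw [e2, abs_sub_comm] at h1
      rw [norm_mul, mul_comm, Real.norm_eq_abs, Real.norm_eq_abs]
      gcongr
    have hI : 0 ≤ ∫ x in Ioo 0 L, |v x| := integral_nonneg fun _ => abs_nonneg _
    refine abs_eq_zero.1 (le_antisymm (le_of_forall_pos_le_add fun ε hε => ?_) (abs_nonneg _))
    refine (hbound (ε / ((∫ x in Ioo 0 L, |v x|) + 1)) (by positivity)).trans ?_
    rw [zero_add, div_mul_eq_mul_div, div_le_iff₀ (by positivity)]
    nlinarith
  rw [ae_restrict_iff' measurableSet_Ioo]
  refine isOpen_Ioo.ae_eq_zero_of_integral_contDiff_smul_eq_zero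
    (hv.locallyIntegrableOn) fun g hg _ hsupp => ?_
  rw [← setIntegral_eq_integral_of_forall_compl_eq_zero (s := Ioo 0 L)]
  · simpa [mul_comm] using hcont g hg.continuous
  · intro x hx
    rw [image_eq_zero_of_notMem_tsupport fun hx' => hx (hsupp hx'), zero_smul]

/-- The sines are complete. -/
theorem ae_eq_zero_of_integral_sin {L : ℝ} (hL : 0 < L) {v : ℝ → ℝ} (hv : IntegrableOn v (Ioo 0 L))
    (h : ∀ n : ℕ, ∫ x in Ioo 0 L, v x * Real.sin (((n : ℝ) + 1) * (Real.pi / L * x)) = 0) :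
    ∀ᵐ x ∂(volume.restrict (Ioo 0 L)), v x = 0 := by
  have hint : ∀ f : ℝ → ℝ, Continuous f → IntegrableOn (fun x => v x * f x) (Ioo 0 L) := by
    intro f hf
    obtain ⟨C, hC⟩ := (isCompact_Icc (a := (0 : ℝ)) (b := L)).exists_bound_of_continuousOn
      hf.continuousOn
    refine Integrable.mul_bdd (c := C) hv hf.aestronglyMeasurable ?_
    filter_upwards [ae_restrict_mem measurableSet_Ioo] with x hx
    exact hC x (Ioo_subset_Icc_self hx)
  -- Multiplied by the first sine, which is positive inside the interval, `v` has vanishing cosine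
  -- moments; the products telescope into sine moments of neighbouring frequencies, with the two
  -- lowest treated apart.
  have key := ae_eq_zero_of_integral_cos hL
    (hint (fun x => Real.sin (Real.pi / L * x)) (by fun_prop)) fun n => by
      rcases n with _ | _ | n
      · simpa using h 0
      · have h1 := h 1
        have e : ∀ x, v x * Real.sin (Real.pi / L * x) *
            Real.cos (((0 + 1 : ℕ) : ℝ) * (Real.pi / L * x)) =
            1 / 2 * (v x * Real.sin ((((1 : ℕ) : ℝ) + 1) * (Real.pi / L * x))) := by
          intro x
          have e1 : (((1 : ℕ) : ℝ) + 1) * (Real.pi / L * x) = 2 * (Real.pi / L * x) := by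
            push_cast; ring
          rw [e1, Real.sin_two_mul]
          simp only [zero_add, Nat.cast_one, one_mul]
          ring
        simp_rw [e]
        rw [integral_const_mul, h1, mul_zero]
      · have e : ∀ x, v x * Real.sin (Real.pi / L * x) *
            Real.cos (((n + 1 + 1 : ℕ) : ℝ) * (Real.pi / L * x)) =
            1 / 2 * (v x * Real.sin ((((n + 2 : ℕ) : ℝ) + 1) * (Real.pi / L * x)))
            - 1 / 2 * (v x * Real.sin (((n : ℝ) + 1) * (Real.pi / L * x))) := by
          intro x
          set θ := Real.pi / L * x
          have e1 : (((n + 2 : ℕ) : ℝ) + 1) * θ = ((n + 1 + 1 : ℕ) : ℝ) * θ + θ := by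
            push_cast; ring
          have e2 : ((n : ℝ) + 1) * θ = ((n + 1 + 1 : ℕ) : ℝ) * θ - θ := by push_cast; ring
          rw [e1, e2, Real.sin_add, Real.sin_sub]
          ring
        simp_rw [e]
        rw [integral_sub ((hint _ (by fun_prop)).const_mul _) ((hint _ (by fun_prop)).const_mul _),
          integral_const_mul, integral_const_mul, h, h]
        ring
  filter_upwards [key, ae_restrict_mem measurableSet_Ioo] with x hx hxL
  have hs : 0 < Real.sin (Real.pi / L * x) := by
    refine Real.sin_pos_of_pos_of_lt_pi (mul_pos (by positivity) hxL.1) ?_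
    rw [div_mul_eq_mul_div, div_lt_iff₀ hL]
    exact mul_lt_mul_of_pos_left hxL.2 Real.pi_pos
  exact (mul_eq_zero.1 hx).resolve_right hs.ne'

/-! ### Sine and cosine bases and Parseval's identities -/

/-- The frequency `(n+1)π/L`. -/
def freq (L : ℝ) (n : ℕ) : ℝ := (n + 1) * (Real.pi / L)

theorem freq_pos {L : ℝ} (hL : 0 < L) (n : ℕ) : 0 < freq L n := by
  unfold freq
  positivity

theorem freq_ge {L : ℝ} (hL : 0 < L) (n : ℕ) : Real.pi / L ≤ freq L n := by
  have : 0 < Real.pi / L := by positivity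
  unfold freq
  nlinarith [(Nat.cast_nonneg n : (0 : ℝ) ≤ n)]

/-- The normalised sine. -/
def sinFun (L : ℝ) (n : ℕ) (x : ℝ) : ℝ := √(2 / L) * Real.sin (freq L n * x)

/-- The normalised cosine. -/
def cosFun (L : ℝ) (n : ℕ) (x : ℝ) : ℝ := √(2 / L) * Real.cos (freq L n * x)

theorem contDiff_sinFun (L : ℝ) (n : ℕ) : ContDiff ℝ ∞ (sinFun L n) := by
  unfold sinFun
  fun_prop

theorem contDiff_cosFun (L : ℝ) (n : ℕ) : ContDiff ℝ ∞ (cosFun L n) := by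
  unfold cosFun
  fun_prop

theorem deriv_sinFun (L : ℝ) (n : ℕ) : deriv (sinFun L n) = fun x => freq L n * cosFun L n x := by
  funext x
  have := (((hasDerivAt_id x).const_mul (freq L n)).sin).const_mul √(2 / L)
  refine (this.congr_deriv ?_).deriv
  simp only [cosFun, id]
  ring

theorem deriv_cosFun (L : ℝ) (n : ℕ) :
    deriv (cosFun L n) = fun x => -freq L n * sinFun L n x := by
  funext x
  have := (((hasDerivAt_id x).const_mul (freq L n)).cos).const_mul √(2 / L)
  refine (this.congr_deriv ?_).deriv
  simp only [sinFun, id]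
  ring

/-- The normalised sine in `L²(0,L)`. -/
def sinL2 (L : ℝ) (n : ℕ) : L2 L := restrictL2 L (sinFun L n) (contDiff_sinFun L n).continuous

/-- The normalised cosine in `L²(0,L)`. -/
def cosL2 (L : ℝ) (n : ℕ) : L2 L := restrictL2 L (cosFun L n) (contDiff_cosFun L n).continuous

theorem restrictL2_const_mul (L c : ℝ) {f g : ℝ → ℝ} (hf : Continuous f) (hg : Continuous g)
    (h : g = fun x => c * f x) : restrictL2 L g hg = c • restrictL2 L f hf := by
  subst h
  exact MemLp.toLp_const_smul c (memLp_of_continuous L hf)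

theorem sin_mem_H10 {L : ℝ} (hL : 0 < L) (n : ℕ) :
    ((sinL2 L n, freq L n • cosL2 L n) : L2 L × L2 L) ∈ H10 L := by
  have hd := (contDiff_sinFun L n).continuous_deriv (by simp)
  have e : freq L n • cosL2 L n = restrictL2 L (deriv (sinFun L n)) hd :=
    (restrictL2_const_mul L (freq L n) _ hd (deriv_sinFun L n)).symm
  rw [e]
  refine restrictL2_mem_H10 (C := √(2 / L) * (2 * freq L n / L)) hL (contDiff_sinFun L n) ?_
  intro x hx
  have hω := freq_pos hL n
  have h1 : |Real.sin (freq L n * x)| ≤ freq L n * x := by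
    refine Real.abs_sin_le_abs.trans_eq (abs_of_nonneg (mul_nonneg hω.le hx.1.le))
  have h2 : |Real.sin (freq L n * x)| ≤ freq L n * (L - x) := by
    have e2 : freq L n * x = (n + 1 : ℕ) * Real.pi - freq L n * (L - x) := by
      have : freq L n * L = (n + 1 : ℕ) * Real.pi := by
        unfold freq
        push_cast
        field_simp
      linarith
    rw [e2, Real.sin_sub, Real.sin_nat_mul_pi, zero_mul, zero_sub, abs_neg, abs_mul,
      Real.cos_nat_mul_pi, abs_neg_one_pow]
    rw [one_mul]
    exact Real.abs_sin_le_abs.trans_eq (abs_of_nonneg (mul_nonneg hω.le (by linarith [hx.2])))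
  rw [sinFun, abs_mul, abs_of_nonneg (Real.sqrt_nonneg _), mul_assoc]
  refine mul_le_mul_of_nonneg_left ?_ (Real.sqrt_nonneg _)
  rw [div_mul_eq_mul_div, le_div_iff₀ hL]
  have hx0 := hx.1
  have hx1 : 0 < L - x := by linarith [hx.2]
  have h3 := mul_le_mul_of_nonneg_right h1 hx1.le
  have h4 := mul_le_mul_of_nonneg_right h2 hx0.le
  linarith

theorem cos_mem_H1 {L : ℝ} (hL : 0 < L) (n : ℕ) :
    ((cosL2 L n, -freq L n • sinL2 L n) : L2 L × L2 L) ∈ H1 L := by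
  have hd := (contDiff_cosFun L n).continuous_deriv (by simp)
  have e : -freq L n • sinL2 L n = restrictL2 L (deriv (cosFun L n)) hd :=
    (restrictL2_const_mul L (-freq L n) _ hd (deriv_cosFun L n)).symm
  rw [e]
  exact restrictL2_mem_H1 hL (contDiff_cosFun L n)

/-- The normalised constant in `L²(0,L)`. -/
def constL2 (L : ℝ) : L2 L := restrictL2 L (fun _ => √(1 / L)) continuous_const

theorem const_mem_H1 {L : ℝ} (hL : 0 < L) : ((constL2 L, 0) : L2 L × L2 L) ∈ H1 L := by
  have h := restrictL2_mem_H1 hL (f := fun _ => √(1 / L)) contDiff_const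
  have hd := (contDiff_const (n := ∞) (c := √(1 / L)) (𝕜 := ℝ) (E := ℝ)).continuous_deriv (by simp)
  have e : restrictL2 L (deriv fun _ => √(1 / L)) hd = 0 := by
    have := restrictL2_const_mul L 0 (continuous_const (y := √(1 / L))) hd (by funext x; simp)
    rw [this, zero_smul]
  rw [← e]
  exact h

theorem inner_constL2_cosL2 {L : ℝ} (hL : 0 < L) (n : ℕ) :
    inner ℝ (constL2 L) (cosL2 L n) = 0 := by
  have h := inner_H1_H10 (const_mem_H1 hL) (sin_mem_H10 hL n)
  rw [inner_zero_left, zero_add, inner_smul_right] at h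
  exact (mul_eq_zero.1 h).resolve_left (freq_pos hL n).ne'

theorem inner_dx_sin {L : ℝ} (hL : 0 < L) {p : L2 L × L2 L} (hp : p ∈ H1 L) (n : ℕ) :
    inner ℝ p.2 (sinL2 L n) = -(freq L n * inner ℝ p.1 (cosL2 L n)) := by
  have h := inner_H1_H10 hp (sin_mem_H10 hL n)
  rw [inner_smul_right] at h
  linarith

theorem inner_dx_cos {L : ℝ} (hL : 0 < L) {r : L2 L × L2 L} (hr : r ∈ H10 L) (n : ℕ) :
    inner ℝ r.2 (cosL2 L n) = freq L n * inner ℝ r.1 (sinL2 L n) := by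
  have h := inner_H1_H10 (cos_mem_H1 hL n) hr
  rw [inner_smul_left, real_inner_comm, real_inner_comm r.2] at h
  simp only [conj_trivial] at h
  linarith

theorem inner_dx_const {L : ℝ} (hL : 0 < L) {r : L2 L × L2 L} (hr : r ∈ H10 L) :
    inner ℝ r.2 (constL2 L) = 0 := by
  have h := inner_H1_H10 (const_mem_H1 hL) hr
  rw [inner_zero_left, zero_add, real_inner_comm] at h
  exact h

/-- Integrating by parts in both directions relates the sine and cosine products. For distinct
frequencies this forces both to vanish; for equal ones they coincide, and their sum is 2 by `sin² +
cos² = 1`. -/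
theorem inner_sin_cos_orthonormal {L : ℝ} (hL : 0 < L) (m n : ℕ) :
    inner ℝ (sinL2 L m) (sinL2 L n) = (if m = n then 1 else 0 : ℝ) ∧
    inner ℝ (cosL2 L m) (cosL2 L n) = (if m = n then 1 else 0 : ℝ) := by
  have h1 := inner_dx_sin hL (cos_mem_H1 hL m) n
  have h2 := inner_dx_cos hL (sin_mem_H10 hL m) n
  rw [inner_smul_left] at h1 h2
  simp only [conj_trivial] at h1 h2
  have hm := freq_pos hL m
  have hn := freq_pos hL n
  split_ifs with hmn
  · subst hmn
    have hs : inner ℝ (sinL2 L m) (sinL2 L m) + inner ℝ (cosL2 L m) (cosL2 L m) = (2 : ℝ) := by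
      have hcs := (contDiff_sinFun L m).continuous
      have hcc := (contDiff_cosFun L m).continuous
      have i1 : IntegrableOn (fun x => sinFun L m x * sinFun L m x) (Ioo 0 L) :=
        ((hcs.mul hcs).integrableOn_Icc (a := 0) (b := L)).mono_set Ioo_subset_Icc_self
      have i2 : IntegrableOn (fun x => cosFun L m x * cosFun L m x) (Ioo 0 L) :=
        ((hcc.mul hcc).integrableOn_Icc (a := 0) (b := L)).mono_set Ioo_subset_Icc_self
      rw [sinL2, cosL2, inner_restrictL2_restrictL2, inner_restrictL2_restrictL2,
        ← integral_add i1 i2]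
      have e : ∀ x, sinFun L m x * sinFun L m x + cosFun L m x * cosFun L m x = 2 / L := by
        intro x
        have h3 := Real.sin_sq_add_cos_sq (freq L m * x)
        have h4 := Real.mul_self_sqrt (by positivity : 0 ≤ 2 / L)
        simp only [sinFun, cosFun]
        linear_combination (√(2 / L) * √(2 / L)) * h3 + h4
      simp_rw [e]
      rw [setIntegral_const]
      simp only [Measure.real, Real.volume_Ioo, sub_zero, smul_eq_mul, ENNReal.toReal_ofReal hL.le]
      field_simp
    have h3 : inner ℝ (sinL2 L m) (sinL2 L m) = inner ℝ (cosL2 L m) (cosL2 L m) := by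
      have := mul_left_cancel₀ hm.ne' h2
      exact this.symm
    constructor <;> linarith
  · have hne : freq L m ^ 2 - freq L n ^ 2 ≠ 0 := by
      intro h
      have h' : freq L m = freq L n := by
        rw [sub_eq_zero] at h
        exact (pow_left_inj₀ hm.le hn.le two_ne_zero).1 h
      unfold freq at h'
      have hpi : Real.pi / L ≠ 0 := by positivity
      have := mul_right_cancel₀ hpi h'
      exact hmn (by exact_mod_cast add_right_cancel this)
    have hs : (freq L m ^ 2 - freq L n ^ 2) * inner ℝ (sinL2 L m) (sinL2 L n) = 0 := by
      linear_combination -freq L m * h1 + freq L n * h2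
    have hc : (freq L m ^ 2 - freq L n ^ 2) * inner ℝ (cosL2 L m) (cosL2 L n) = 0 := by
      linear_combination -freq L n * h1 + freq L m * h2
    exact ⟨(mul_eq_zero.1 hs).resolve_left hne, (mul_eq_zero.1 hc).resolve_left hne⟩

theorem orthogonal_span_range_eq_bot {L : ℝ} {ι : Type*} {b : ι → L2 L}
    (h : ∀ v : L2 L, (∀ i, inner ℝ v (b i) = 0) → v = 0) :
    (Submodule.span ℝ (range b))ᗮ = ⊥ := by
  rw [Submodule.eq_bot_iff]
  intro v hv
  refine h v fun i => ?_
  rw [real_inner_comm]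
  exact (Submodule.mem_orthogonal _ v).1 hv _ (Submodule.subset_span (mem_range_self i))

theorem hasSum_inner_sq {L : ℝ} {ι : Type*} (b : HilbertBasis ι ℝ (L2 L)) (v : L2 L) :
    HasSum (fun i => inner ℝ v (b i) ^ 2) (‖v‖ ^ 2) := by
  have := b.hasSum_inner_mul_inner v v
  rw [real_inner_self_eq_norm_sq] at this
  refine this.congr_fun fun i => ?_
  rw [real_inner_comm v (b i), sq]

/-- Parseval's identity for the sine series. -/
theorem hasSum_inner_sin {L : ℝ} (hL : 0 < L) (v : L2 L) :
    HasSum (fun n => inner ℝ v (sinL2 L n) ^ 2) (‖v‖ ^ 2) := by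
  have hon : Orthonormal ℝ (sinL2 L) :=
    orthonormal_iff_ite.2 fun m n => (inner_sin_cos_orthonormal hL m n).1
  have hbot : (Submodule.span ℝ (range (sinL2 L)))ᗮ = ⊥ := by
    refine orthogonal_span_range_eq_bot fun u hu => ?_
    have h0 := ae_eq_zero_of_integral_sin hL (integrable_L2 u) fun n => by
      have h1 := hu n
      rw [sinL2, inner_restrictL2] at h1
      simp only [sinFun] at h1
      have h2 : √(2 / L) ≠ 0 := (Real.sqrt_pos.2 (by positivity)).ne'
      simp_rw [mul_left_comm _ √(2 / L)] at h1
      rw [integral_const_mul] at h1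
      have h3 := (mul_eq_zero.1 h1).resolve_left h2
      simpa only [freq, mul_assoc] using h3
    exact (Lp.eq_zero_iff_ae_eq_zero).2 h0
  have h := hasSum_inner_sq (HilbertBasis.mkOfOrthogonalEqBot hon hbot) v
  rwa [HilbertBasis.coe_mkOfOrthogonalEqBot] at h

/-- Parseval's identity for the cosine series of a function of zero mean. -/
theorem hasSum_inner_cos {L : ℝ} (hL : 0 < L) {v : L2 L} (hv : inner ℝ v (constL2 L) = 0) :
    HasSum (fun n => inner ℝ v (cosL2 L n) ^ 2) (‖v‖ ^ 2) := by
  -- The constant takes index 0, which completes the cosines to a basis; its term disappears at the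
  -- end because `v` has zero mean.
  set b : ℕ → L2 L := fun n => Nat.casesOn n (constL2 L) (cosL2 L) with hb
  have hconst : inner ℝ (constL2 L) (constL2 L) = (1 : ℝ) := by
    rw [constL2, inner_restrictL2_restrictL2, setIntegral_const]
    simp only [Measure.real, Real.volume_Ioo, sub_zero, smul_eq_mul, ENNReal.toReal_ofReal hL.le]
    rw [Real.mul_self_sqrt (by positivity)]
    field_simp
  have hon : Orthonormal ℝ b := by
    refine orthonormal_iff_ite.2 fun m n => ?_
    rcases m with _ | m <;> rcases n with _ | n
    · simpa [hb] using hconst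
    · simpa [hb] using inner_constL2_cosL2 hL n
    · simpa [hb, real_inner_comm] using inner_constL2_cosL2 hL m
    · simpa [hb] using (inner_sin_cos_orthonormal hL m n).2
  have hbot : (Submodule.span ℝ (range b))ᗮ = ⊥ := by
    refine orthogonal_span_range_eq_bot fun u hu => ?_
    have h0 := ae_eq_zero_of_integral_cos hL (integrable_L2 u) fun n => by
      have h1 := hu n
      rcases n with _ | n
      · change inner ℝ u (constL2 L) = 0 at h1
        rw [constL2, inner_restrictL2, integral_mul_const] at h1
        have h2 : √(1 / L) ≠ 0 := (Real.sqrt_pos.2 (by positivity)).ne'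
        simpa using (mul_eq_zero.1 h1).resolve_right h2
      · change inner ℝ u (cosL2 L n) = 0 at h1
        rw [cosL2, inner_restrictL2] at h1
        simp only [cosFun] at h1
        have h2 : √(2 / L) ≠ 0 := (Real.sqrt_pos.2 (by positivity)).ne'
        simp_rw [mul_left_comm _ √(2 / L)] at h1
        rw [integral_const_mul] at h1
        have h3 := (mul_eq_zero.1 h1).resolve_left h2
        push_cast
        simpa only [freq, mul_assoc] using h3
    exact (Lp.eq_zero_iff_ae_eq_zero).2 h0
  have h := hasSum_inner_sq (HilbertBasis.mkOfOrthogonalEqBot hon hbot) v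
  rw [HilbertBasis.coe_mkOfOrthogonalEqBot] at h
  have h' := (hasSum_nat_add_iff' 1).2 h
  simpa [hb, hv] using h'

/-! ### Reduction of a weak solution to its Fourier modes -/

section Reduction

variable {L l ρ₁ ρ₂ k k₂ a q : ℝ}

theorem inner_shear_cos (hL : 0 < L) (l : ℝ) (φ : H10 L) (ψ w : H1s L) (n : ℕ) :
    inner ℝ (shear l φ ψ w) (cosL2 L n) = freq L n * inner ℝ (val φ) (sinL2 L n)
      + inner ℝ (val ψ) (cosL2 L n) + l * inner ℝ (val w) (cosL2 L n) := by
  rw [shear, inner_add_left, inner_add_left, inner_smul_left, dx, inner_dx_cos hL φ.2]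
  rfl

theorem inner_axial_sin (hL : 0 < L) (l : ℝ) (φ : H10 L) (w : H1s L) (n : ℕ) :
    inner ℝ (axial l φ w) (sinL2 L n) = -(freq L n * inner ℝ (val w) (cosL2 L n)
      + l * inner ℝ (val φ) (sinL2 L n)) := by
  rw [axial, inner_sub_left, inner_smul_left, dx, inner_dx_sin hL w.2.1]
  simp only [conj_trivial, val]
  ring

theorem inner_dx_H1s_sin (hL : 0 < L) (ψ : H1s L) (n : ℕ) :
    inner ℝ (dx ψ) (sinL2 L n) = -(freq L n * inner ℝ (val ψ) (cosL2 L n)) :=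
  inner_dx_sin hL ψ.2.1 n

theorem inner_constL2_of_mem_L2s {v : L2 L} (hv : v ∈ L2s L) : inner ℝ v (constL2 L) = 0 := by
  have h : ∫ x in Ioo (0 : ℝ) L, v x = 0 := hv
  rw [constL2, inner_restrictL2, integral_mul_const, h, zero_mul]

theorem inner_val_const (ψ : H1s L) : inner ℝ (val ψ) (constL2 L) = 0 :=
  inner_constL2_of_mem_L2s ψ.2.2

theorem inner_shear_const (hL : 0 < L) (l : ℝ) (φ : H10 L) (ψ w : H1s L) :
    inner ℝ (shear l φ ψ w) (constL2 L) = 0 := by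
  rw [shear, inner_add_left, inner_add_left, inner_smul_left, inner_val_const, inner_val_const, dx,
    inner_dx_const hL φ.2]
  simp

theorem IsFiniteEnergy.hasDerivWithinAt {V : Submodule ℝ (L2 L × L2 L)} {u : ℝ → V}
    (hu : IsFiniteEnergy u) {t : ℝ} (ht : 0 ≤ t) :
    HasDerivWithinAt (fun s => val (u s)) (dt u t) (Ici 0) t :=
  (hu.2.differentiableOn one_ne_zero t ht).hasDerivWithinAt

theorem IsFiniteEnergy.hasDerivWithinAt_inner {V : Submodule ℝ (L2 L × L2 L)} {u : ℝ → V}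
    (hu : IsFiniteEnergy u) (v : L2 L) {t : ℝ} (ht : 0 ≤ t) :
    HasDerivWithinAt (fun s => inner ℝ (val (u s)) v) (inner ℝ (dt u t) v) (Ici 0) t := by
  have := (hu.hasDerivWithinAt ht).inner ℝ (hasDerivWithinAt_const t (Ici 0) v)
  simpa using this

/-- The mean of `u` is zero at all times, hence so is that of its time derivative. This permits the
cosine series without constant term for velocities, which are only known to lie in `L²`. -/
theorem IsFiniteEnergy.inner_dt_const {u : ℝ → H1s L} (hu : IsFiniteEnergy u) {t : ℝ}
    (ht : 0 ≤ t) : inner ℝ (dt u t) (constL2 L) = 0 := by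
  have h1 := hu.hasDerivWithinAt_inner (constL2 L) ht
  have h2 : HasDerivWithinAt (fun s => inner ℝ (val (u s)) (constL2 L)) (0 : ℝ) (Ici 0) t := by
    simp only [inner_val_const]
    exact hasDerivWithinAt_const t (Ici 0) (0 : ℝ)
  exact (uniqueDiffOn_Ici 0 t ht).eq_deriv _ h1 h2

theorem IsFiniteEnergy.continuousOn_dx {V : Submodule ℝ (L2 L × L2 L)} {u : ℝ → V}
    (hu : IsFiniteEnergy u) : ContinuousOn (fun s => dx (u s)) (Ici 0) :=
  (continuous_snd.comp continuous_subtype_val).comp_continuousOn hu.1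

/-- The Fourier coefficients of a weak solution solve the system of ordinary differential
equations. -/
theorem IsWeakSolution.isMode {φ₀ : H10 L} {φ₁ : L2 L} {ψ₀ : H1s L} {ψ₁ : L2s L} {w₀ : H1s L}
    {w₁ : L2s L} {φ : ℝ → H10 L} {ψ w : ℝ → H1s L} (hL : 0 < L) (hρ₁ : ρ₁ ≠ 0) (hρ₂ : ρ₂ ≠ 0)
    (h : IsWeakSolution L l ρ₁ ρ₂ k k₂ k (polyKernel a q) φ₀ φ₁ ψ₀ ψ₁ w₀ w₁ φ ψ w) (n : ℕ) :
    IsMode l (freq L n) ρ₁ ρ₂ k k₂ a q (fun t => inner ℝ (val (φ t)) (sinL2 L n))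
      (fun t => inner ℝ (val (ψ t)) (cosL2 L n)) (fun t => inner ℝ (val (w t)) (cosL2 L n))
      (fun t => inner ℝ (dt φ t) (sinL2 L n)) (fun t => inner ℝ (dt ψ t) (cosL2 L n))
      (fun t => inner ℝ (dt w t) (cosL2 L n)) where
  x_deriv t ht := h.φ_reg.hasDerivWithinAt_inner _ ht
  y_deriv t ht := h.ψ_reg.hasDerivWithinAt_inner _ ht
  z_deriv t ht := h.w_reg.hasDerivWithinAt_inner _ ht
  X_deriv t ht := by
    have h1 := (h.φ_eq ⟨_, sin_mem_H10 hL n⟩ t ht).div_const ρ₁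
    simp only [val, dx] at h1
    rw [inner_smul_right, inner_shear_cos hL, inner_axial_sin hL] at h1
    refine (h1.congr_deriv ?_).congr (fun s _ => ?_) ?_
    · simp only [val]; ring
    · field_simp
    · field_simp
  Y_deriv t ht := by
    have h1 := (h.ψ_eq ⟨_, cos_mem_H1 hL n⟩ t ht).div_const ρ₂
    have e : ∀ s, inner ℝ (dx (ψ s)) (-freq L n • sinL2 L n) =
        freq L n ^ 2 * inner ℝ (val (ψ s)) (cosL2 L n) := by
      intro s
      rw [inner_smul_right, inner_dx_H1s_sin hL]
      ring
    have e2 : ∫ s in (0 : ℝ)..t, polyKernel a q (t - s) *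
        inner ℝ (dx (ψ s)) (-freq L n • sinL2 L n) =
        freq L n ^ 2 * conv (polyKernel a q) (fun s => inner ℝ (val (ψ s)) (cosL2 L n)) t := by
      rw [conv, ← intervalIntegral.integral_const_mul]
      refine intervalIntegral.integral_congr fun s _ => ?_
      simp only [e]
      ring
    change HasDerivWithinAt (fun s => ρ₂ * inner ℝ (dt ψ s) (cosL2 L n) / ρ₂)
      ((-(k₂ * inner ℝ (dx (ψ t)) (-freq L n • sinL2 L n))
        - k * inner ℝ (shear l (φ t) (ψ t) (w t)) (cosL2 L n)
        + ∫ s in (0 : ℝ)..t, polyKernel a q (t - s) *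
        inner ℝ (dx (ψ s)) (-freq L n • sinL2 L n)) / ρ₂) (Ici 0) t at h1
    rw [e2, e, inner_shear_cos hL] at h1
    refine (h1.congr_deriv ?_).congr (fun s _ => ?_) ?_
    · ring
    · field_simp
    · field_simp
  Z_deriv t ht := by
    have h1 := (h.w_eq ⟨_, cos_mem_H1 hL n⟩ t ht).div_const ρ₁
    change HasDerivWithinAt (fun s => ρ₁ * inner ℝ (dt w s) (cosL2 L n) / ρ₁)
      ((-(k * inner ℝ (axial l (φ t) (w t)) (-freq L n • sinL2 L n))
        - l * k * inner ℝ (shear l (φ t) (ψ t) (w t)) (cosL2 L n)) / ρ₁) (Ici 0) t at h1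
    rw [inner_smul_right, inner_shear_cos hL, inner_axial_sin hL] at h1
    refine (h1.congr_deriv ?_).congr (fun s _ => ?_) ?_
    · ring
    · field_simp
    · field_simp

/-- Parseval's identity for the memory term. -/
theorem hasSum_memory (hL : 0 < L) (ha : 0 < a) {ψ : ℝ → H1s L} (hψ : IsFiniteEnergy ψ) {t : ℝ}
    (ht : 0 ≤ t) :
    HasSum (fun n => freq L n ^ 2 *
      quadMem (polyKernel a q) (fun s => inner ℝ (val (ψ s)) (cosL2 L n)) t)
      (memory (polyKernel a q) (fun s => dx (ψ s)) t) := by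
  set y : ℕ → ℝ → ℝ := fun n s => inner ℝ (val (ψ s)) (cosL2 L n) with hy
  have hyc : ∀ n, ContinuousOn (y n) (Ici 0) := fun n s hs =>
    (hψ.hasDerivWithinAt_inner _ hs).continuousWithinAt
  set F : ℕ → ℝ → ℝ := fun n s => polyKernel a q (t - s) * (freq L n * (y n t - y n s)) ^ 2
    with hF
  have hFint : ∀ n, IntervalIntegrable (F n) volume 0 t := fun n =>
    intervalIntegrable_conv (continuousOn_polyKernel a q)
      ((continuousOn_const.mul (continuousOn_const.sub (hyc n))).pow 2) ht
  have htot : IntervalIntegrable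
      (fun s => polyKernel a q (t - s) * ‖dx (ψ t) - dx (ψ s)‖ ^ 2) volume 0 t :=
    intervalIntegrable_conv (continuousOn_polyKernel a q)
      ((continuousOn_const.sub hψ.continuousOn_dx).norm.pow 2) ht
  rw [intervalIntegrable_iff_integrableOn_Ioc_of_le ht] at htot
  have hFint' : ∀ n, IntegrableOn (F n) (Ioc 0 t) := fun n =>
    (intervalIntegrable_iff_integrableOn_Ioc_of_le ht).1 (hFint n)
  have hF0 : ∀ n, ∀ s ∈ Ioc 0 t, 0 ≤ F n s := fun n s hs =>
    mul_nonneg (polyKernel_pos ha (by linarith [hs.2])).le (sq_nonneg _)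
  have hsum : ∀ s, HasSum (fun n => F n s) (polyKernel a q (t - s) * ‖dx (ψ t) - dx (ψ s)‖ ^ 2) := by
    intro s
    refine ((hasSum_inner_sin hL (dx (ψ t) - dx (ψ s))).mul_left _).congr_fun fun n => ?_
    rw [inner_sub_left, inner_dx_H1s_sin hL, inner_dx_H1s_sin hL]
    simp only [hF, hy]
    ring
  have hnorm : ∀ n, ∫ s in Ioc 0 t, ‖F n s‖ = ∫ s in Ioc 0 t, F n s := by
    intro n
    refine setIntegral_congr_fun measurableSet_Ioc fun s hs => ?_
    exact Real.norm_of_nonneg (hF0 n s hs)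
  -- The terms are nonnegative and their partial sums are dominated pointwise by the full series,
  -- whose sum is integrable; this justifies exchanging sum and time integral.
  have hsummable : Summable fun n => ∫ s in Ioc 0 t, ‖F n s‖ := by
    refine summable_of_sum_le
      (c := ∫ s in Ioc 0 t, polyKernel a q (t - s) * ‖dx (ψ t) - dx (ψ s)‖ ^ 2)
      (fun n => integral_nonneg fun s => norm_nonneg _) fun u => ?_
    simp_rw [hnorm]
    rw [← integral_finsetSum _ fun n _ => hFint' n]
    refine setIntegral_mono_on (integrable_finsetSum _ fun n _ => hFint' n) htot
      measurableSet_Ioc fun s hs => ?_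
    exact sum_le_hasSum u (fun n _ => hF0 n s hs) (hsum s)
  have key := hasSum_integral_of_summable_integral_norm hFint' hsummable
  simp_rw [(hsum _).tsum_eq] at key
  rw [memory, intervalIntegral.integral_of_le ht]
  refine key.congr_fun fun n => ?_
  rw [quadMem, ← intervalIntegral.integral_const_mul, intervalIntegral.integral_of_le ht]
  refine integral_congr_ae (Eventually.of_forall fun s => ?_)
  simp only [hF]
  ring

/-- The energy of a weak solution is the sum of the energies of its modes. -/
theorem IsWeakSolution.hasSum_energy {φ₀ : H10 L} {φ₁ : L2 L} {ψ₀ : H1s L} {ψ₁ : L2s L}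
    {w₀ : H1s L} {w₁ : L2s L} {φ : ℝ → H10 L} {ψ w : ℝ → H1s L} (hL : 0 < L) (ha : 0 < a)
    (h : IsWeakSolution L l ρ₁ ρ₂ k k₂ k (polyKernel a q) φ₀ φ₁ ψ₀ ψ₁ w₀ w₁ φ ψ w) {t : ℝ}
    (ht : 0 ≤ t) :
    HasSum (fun n => modeEnergy l (freq L n) ρ₁ ρ₂ k k₂ a q
      (fun t => inner ℝ (val (φ t)) (sinL2 L n))
      (fun t => inner ℝ (val (ψ t)) (cosL2 L n)) (fun t => inner ℝ (val (w t)) (cosL2 L n))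
      (fun t => inner ℝ (dt φ t) (sinL2 L n)) (fun t => inner ℝ (dt ψ t) (cosL2 L n))
      (fun t => inner ℝ (dt w t) (cosL2 L n)) t)
      (energy l ρ₁ ρ₂ k k₂ k (polyKernel a q) φ ψ w t) := by
  have h1 := (hasSum_inner_sin hL (dt φ t)).mul_left ρ₁
  have h2 := (hasSum_inner_cos hL (h.ψ_reg.inner_dt_const ht)).mul_left ρ₂
  have h3 := (hasSum_inner_cos hL (h.w_reg.inner_dt_const ht)).mul_left ρ₁
  have h4 := (hasSum_inner_sin hL (dx (ψ t))).mul_left (k₂ - ∫ s in (0 : ℝ)..t, polyKernel a q s)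
  have h5 := (hasSum_inner_sin hL (axial l (φ t) (w t))).mul_left k
  have h6 := (hasSum_inner_cos hL (inner_shear_const hL l (φ t) (ψ t) (w t))).mul_left k
  have h7 := (hasSum_memory (q := q) hL ha h.ψ_reg ht).mul_left (1 / 2)
  refine (((((((h1.add h2).add h3).add h4).add h5).add h6).mul_left (1 / 2)).add h7).congr_fun
    fun n => ?_
  rw [inner_shear_cos hL, inner_axial_sin hL, inner_dx_H1s_sin hL, modeEnergy, mass]
  ring

end Reduction

/-- Agreement at the single time `t` would not suffice, because the memory term depends on the
history of `y`. -/
theorem modeEnergy_congr {l lam ρ₁ ρ₂ k k₂ a q : ℝ} {x y z X Y Z x₂ y₂ z₂ X₂ Y₂ Z₂ : ℝ → ℝ}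
    (h : ∀ t, 0 ≤ t → x t = x₂ t ∧ y t = y₂ t ∧ z t = z₂ t ∧ X t = X₂ t ∧ Y t = Y₂ t ∧ Z t = Z₂ t)
    {t : ℝ} (ht : 0 ≤ t) : modeEnergy l lam ρ₁ ρ₂ k k₂ a q x y z X Y Z t =
      modeEnergy l lam ρ₁ ρ₂ k k₂ a q x₂ y₂ z₂ X₂ Y₂ Z₂ t := by
  obtain ⟨h1, h2, h3, h4, h5, h6⟩ := h t ht
  have hq : quadMem (polyKernel a q) y t = quadMem (polyKernel a q) y₂ t := by
    refine intervalIntegral.integral_congr fun s hs => ?_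
    rw [uIcc_of_le ht] at hs
    simp only [h2, (h s hs.1).2.1]
  rw [modeEnergy, modeEnergy, h1, h2, h3, h4, h5, h6, hq]

theorem IsRelaxation.admissible {l ρ₁ ρ₂ k k₂ a q : ℝ} (hg : IsRelaxation k₂ (polyKernel a q))
    (hl : 0 < l) (hρ₁ : 0 < ρ₁) (hρ₂ : 0 < ρ₂) (hk : 0 < k) (hk₂ : 0 < k₂)
    (hs : k / ρ₁ = k₂ / ρ₂) (ha : 0 < a) (hq : 2 < q) : Admissible l ρ₁ ρ₂ k k₂ a q where
  l_pos := hl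
  ρ₁_pos := hρ₁
  ρ₂_pos := hρ₂
  k_pos := hk
  k₂_pos := hk₂
  speed := hs
  a_pos := ha
  q_gt := hq
  mass_lt := by
    refine ⟨_, hg.mass, fun t ht => ?_⟩
    have : Bresse.mass (polyKernel a q) t ≤ ∫ s in Ioi (0 : ℝ), polyKernel a q s := by
      rw [Bresse.mass, intervalIntegral.integral_of_le ht]
      refine setIntegral_mono_set hg.integrable ?_ Ioc_subset_Ioi_self.eventuallyLE
      filter_upwards [ae_restrict_mem measurableSet_Ioi] with s hs
      exact hg.nonneg s (le_of_lt hs)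
    linarith

/-! ### Upper and lower bounds for the energy of weak solutions -/

section Decay

variable {L l ρ₁ ρ₂ k k₂ a q : ℝ} {φ₀ : H10 L} {φ₁ : L2 L} {ψ₀ : H1s L} {ψ₁ : L2s L}
  {w₀ : H1s L} {w₁ : L2s L}

/-- The smallness of `l` enters the proof only through this comparison with the lowest frequency
`π/L`. -/
theorem two_mul_le_freq (hL : 0 < L) (hl : l < Real.pi / (2 * L)) (n : ℕ) :
    2 * l ≤ freq L n := by
  refine le_trans ?_ (freq_ge hL n)
  have : Real.pi / L = 2 * (Real.pi / (2 * L)) := by field_simp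
  linarith

/-- The energy decays like the relaxation function, with a constant depending on the data only. -/
theorem exists_energy_le (H : Admissible l ρ₁ ρ₂ k k₂ a q) (hL : 0 < L)
    (hl : l < Real.pi / (2 * L)) :
    ∃ c, 0 < c ∧ ∀ (φ : ℝ → H10 L) (ψ w : ℝ → H1s L),
      IsWeakSolution L l ρ₁ ρ₂ k k₂ k (polyKernel a q) φ₀ φ₁ ψ₀ ψ₁ w₀ w₁ φ ψ w →
      ∀ t, 0 ≤ t → energy l ρ₁ ρ₂ k k₂ k (polyKernel a q) φ ψ w t ≤ c / (1 + t) ^ q := by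
  obtain ⟨K, hK, hdec⟩ := exists_modeEnergy_decay H
  set E₀ := 1 / 2 * (ρ₁ * ‖φ₁‖ ^ 2 + ρ₂ * ‖(ψ₁ : L2 L)‖ ^ 2 + ρ₁ * ‖(w₁ : L2 L)‖ ^ 2
    + k₂ * ‖dx ψ₀‖ ^ 2 + k * ‖axial l φ₀ w₀‖ ^ 2 + k * ‖shear l φ₀ ψ₀ w₀‖ ^ 2) with hE₀
  -- `E₀` is the initial energy written in terms of the data, so the constant is fixed before the
  -- solution; the absolute value and the `+ 1` give positivity, also for zero data.
  refine ⟨|K * E₀| + 1, by positivity, fun φ ψ w h t ht => ?_⟩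
  have h0 := h.hasSum_energy hL H.a_pos le_rfl
  have ht' := h.hasSum_energy hL H.a_pos ht
  have he : energy l ρ₁ ρ₂ k k₂ k (polyKernel a q) φ ψ w 0 = E₀ := by
    rw [energy, memory, h.φ_init.1, h.φ_init.2, h.ψ_init.1, h.ψ_init.2, h.w_init.1, h.w_init.2,
      intervalIntegral.integral_same, intervalIntegral.integral_same, hE₀]
    ring
  rw [he] at h0
  have hpow : 0 < (1 + t) ^ q := Real.rpow_pos_of_pos (by linarith) q
  have hle := hasSum_le (fun n => ?_) ht' (h0.mul_left (K / (1 + t) ^ q))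
  · refine hle.trans ?_
    rw [div_mul_eq_mul_div]
    gcongr
    linarith [le_abs_self (K * E₀)]
  · rw [div_mul_eq_mul_div, le_div_iff₀ hpow]
    exact hdec _ _ _ _ _ _ _ (two_mul_le_freq hL hl n)
      (h.isMode hL H.ρ₁_pos.ne' H.ρ₂_pos.ne' n) t ht

theorem eq_zero_of_inner_sin (hL : 0 < L) {v : L2 L} (h : ∀ n, inner ℝ v (sinL2 L n) = 0) :
    v = 0 := by
  have h1 := hasSum_inner_sin hL v
  simp only [h, ne_eq, OfNat.ofNat_ne_zero, not_false_eq_true, zero_pow] at h1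
  simpa using h1.unique hasSum_zero

theorem eq_zero_of_inner_cos (hL : 0 < L) {v : L2 L} (hv : inner ℝ v (constL2 L) = 0)
    (h : ∀ n, inner ℝ v (cosL2 L n) = 0) : v = 0 := by
  have h1 := hasSum_inner_cos hL hv
  simp only [h, ne_eq, OfNat.ofNat_ne_zero, not_false_eq_true, zero_pow] at h1
  simpa using h1.unique hasSum_zero

theorem H10_eq_zero (hL : 0 < L) {φ : H10 L} (h : ∀ n, inner ℝ (val φ) (sinL2 L n) = 0) :
    φ = 0 := by
  refine Subtype.ext (Prod.ext (eq_zero_of_inner_sin hL h) ?_)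
  refine eq_zero_of_inner_cos hL (inner_dx_const hL φ.2) fun n => ?_
  rw [inner_dx_cos hL φ.2]
  exact mul_eq_zero_of_right _ (h n)

theorem H1s_eq_zero (hL : 0 < L) {ψ : H1s L} (h : ∀ n, inner ℝ (val ψ) (cosL2 L n) = 0) :
    ψ = 0 := by
  refine Subtype.ext (Prod.ext (eq_zero_of_inner_cos hL (inner_val_const ψ) h) ?_)
  refine eq_zero_of_inner_sin hL fun n => ?_
  rw [inner_dx_sin hL ψ.2.1]
  exact neg_eq_zero.2 (mul_eq_zero_of_right _ (h n))

/-- The energy of a nonzero solution decays no faster than the relaxation function. -/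
theorem exists_le_energy (H : Admissible l ρ₁ ρ₂ k k₂ a q) (hL : 0 < L)
    (hl : l < Real.pi / (2 * L))
    (hne : ¬(φ₀ = 0 ∧ φ₁ = 0 ∧ ψ₀ = 0 ∧ ψ₁ = 0 ∧ w₀ = 0 ∧ w₁ = 0)) :
    ∃ c, 0 < c ∧ ∀ (φ : ℝ → H10 L) (ψ w : ℝ → H1s L),
      IsWeakSolution L l ρ₁ ρ₂ k k₂ k (polyKernel a q) φ₀ φ₁ ψ₀ ψ₁ w₀ w₁ φ ψ w →
      ∀ t, 0 ≤ t → c / (1 + t) ^ q ≤ energy l ρ₁ ρ₂ k k₂ k (polyKernel a q) φ ψ w t := by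
  -- The constant must precede the solution. It is read off from one solution, if there is any, and
  -- carried to every other by uniqueness of the selected mode.
  by_cases hex : ∃ (φ : ℝ → H10 L) (ψ w : ℝ → H1s L),
      IsWeakSolution L l ρ₁ ρ₂ k k₂ k (polyKernel a q) φ₀ φ₁ ψ₀ ψ₁ w₀ w₁ φ ψ w
  swap
  · exact ⟨1, one_pos, fun φ ψ w h => absurd ⟨φ, ψ, w, h⟩ hex⟩
  obtain ⟨φ, ψ, w, h⟩ := hex
  have hmode := fun n => h.isMode hL H.ρ₁_pos.ne' H.ρ₂_pos.ne' n
  obtain ⟨n, hn⟩ : ∃ n, modeEnergy l (freq L n) ρ₁ ρ₂ k k₂ a q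
      (fun t => inner ℝ (val (φ t)) (sinL2 L n))
      (fun t => inner ℝ (val (ψ t)) (cosL2 L n)) (fun t => inner ℝ (val (w t)) (cosL2 L n))
      (fun t => inner ℝ (dt φ t) (sinL2 L n)) (fun t => inner ℝ (dt ψ t) (cosL2 L n))
      (fun t => inner ℝ (dt w t) (cosL2 L n)) 0 ≠ 0 := by
    by_contra! hall
    have hz := fun n => eq_zero_of_modeEnergy_eq_zero H (two_mul_le_freq hL hl n) le_rfl (hall n)
    simp only [h.φ_init, h.ψ_init, h.w_init] at hz
    exact hne ⟨H10_eq_zero hL fun n => (hz n).1,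
      eq_zero_of_inner_sin hL fun n => (hz n).2.2.2.1,
      H1s_eq_zero hL fun n => (hz n).2.1,
      Subtype.ext (eq_zero_of_inner_cos hL (inner_constL2_of_mem_L2s ψ₁.2)
        fun n => (hz n).2.2.2.2.1),
      H1s_eq_zero hL fun n => (hz n).2.2.1,
      Subtype.ext (eq_zero_of_inner_cos hL (inner_constL2_of_mem_L2s w₁.2)
        fun n => (hz n).2.2.2.2.2)⟩
  have hlam := two_mul_le_freq hL hl n
  obtain ⟨c, hc, hle⟩ := (hmode n).exists_le_modeEnergy H hlam hn
  refine ⟨c, hc, fun φ' ψ' w' h' t ht => (hle t ht).trans ?_⟩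
  have hmode' := fun n => h'.isMode hL H.ρ₁_pos.ne' H.ρ₂_pos.ne' n
  have heq := fun (s : ℝ) (hs : 0 ≤ s) => (hmode n).eq_of_initial H hlam (hmode' n)
    (by simp only [h.φ_init, h'.φ_init]) (by simp only [h.ψ_init, h'.ψ_init])
    (by simp only [h.w_init, h'.w_init]) (by simp only [h.φ_init, h'.φ_init])
    (by simp only [h.ψ_init, h'.ψ_init]) (by simp only [h.w_init, h'.w_init]) hs
  rw [modeEnergy_congr heq ht]
  exact le_hasSum (h'.hasSum_energy hL H.a_pos ht) n fun m _ => modeEnergy_nonneg H _ _ _ _ _ _ _ ht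

end Decay

/-! ### Exponents -/

theorem hasDerivAt_polyKernel_rpow {a q p ξ : ℝ} (ha : 0 < a) (hq : 0 < q)
    (hp : p = (q + 1) / q) (hξ : ξ = q / a ^ (1 / q)) {t : ℝ} (ht : 0 ≤ t) :
    HasDerivAt (polyKernel a q) (-(ξ * polyKernel a q t ^ p)) t := by
  refine (hasDerivAt_polyKernel a q (by linarith)).congr_deriv ?_
  have h1 : (0 : ℝ) < 1 + t := by linarith
  have e1 : polyKernel a q t ^ p = a * a ^ (1 / q) / (1 + t) ^ (q + 1) := by
    rw [polyKernel, Real.div_rpow ha.le (Real.rpow_pos_of_pos h1 q).le, ← Real.rpow_mul h1.le, hp,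
      ← Real.rpow_one_add' ha.le (by positivity)]
    congr 2 <;> field_simp
  rw [e1, hξ, polyKernel]
  have := (Real.rpow_pos_of_pos ha (1 / q)).ne'
  have := (Real.rpow_pos_of_pos h1 (q + 1)).ne'
  field_simp

/-- With `m = min b (1/t₀)` one has `m t ≤ 1 + b (t - t₀)`, so the integrand is dominated by a
multiple of `t^(-r)`. -/
theorem integrableOn_rpow_affine {b r t₀ : ℝ} (hb : 0 < b) (hr : 1 < r) (ht₀ : 0 < t₀) :
    IntegrableOn (fun t : ℝ => (1 / (1 + ∫ _s in t₀..t, b)) ^ r) (Ioi t₀) := by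
  simp only [intervalIntegral.integral_const, smul_eq_mul]
  obtain ⟨m, hm, hm1, hm2⟩ : ∃ m, 0 < m ∧ m ≤ b ∧ m * t₀ ≤ 1 :=
    ⟨min b (1 / t₀), by positivity, min_le_left _ _, by
      rw [← le_div_iff₀ ht₀]; exact min_le_right _ _⟩
  have h1 := (integrableOn_Ioi_rpow_of_lt (a := -r) (by linarith) ht₀).const_mul ((1 / m) ^ r)
  have hpos : ∀ t ∈ Ioi t₀, 0 < 1 + (t - t₀) * b := fun t ht =>
    add_pos_of_pos_of_nonneg one_pos (mul_nonneg (sub_nonneg.2 (le_of_lt ht)) hb.le)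
  refine Integrable.mono' h1 ?_ ?_
  · refine ContinuousOn.aestronglyMeasurable (fun t ht => ?_) measurableSet_Ioi
    have h2 := hpos t ht
    have h3 : ContinuousAt (fun t : ℝ => 1 / (1 + (t - t₀) * b)) t :=
      ContinuousAt.div₀ continuousAt_const (by fun_prop) h2.ne'
    exact (h3.rpow_const (Or.inl (by positivity))).continuousWithinAt
  · filter_upwards [ae_restrict_mem measurableSet_Ioi] with t ht
    have h2 := hpos t ht
    have ht0 : 0 < t := lt_trans ht₀ ht
    rw [Real.norm_of_nonneg (by positivity), Real.rpow_neg ht0.le, ← Real.inv_rpow ht0.le,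
      ← Real.mul_rpow (by positivity) (by positivity)]
    refine Real.rpow_le_rpow (by positivity) ?_ (by linarith)
    rw [one_div_mul_eq_div, ← one_div, div_div]
    refine one_div_le_one_div_of_le (by positivity) ?_
    have h3 := mul_le_mul_of_nonneg_right hm1 (sub_nonneg.2 (le_of_lt ht))
    linarith

/-- It rests on `1 + b (t - t₀) ≤ (1 + b)(1 + t)`, and converts the explicit rate into the form with
the integral of a constant. -/
theorem div_rpow_le_rpow_affine {c b q t₀ t : ℝ} (hc : 0 < c) (hb : 0 < b) (hq : 0 < q)
    (ht₀ : 0 < t₀) (ht : t₀ < t) :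
    c / (1 + t) ^ q ≤ c * (1 + b) ^ q * (1 / (1 + ∫ _s in t₀..t, b)) ^ q := by
  rw [intervalIntegral.integral_const, smul_eq_mul]
  have h1 : 0 < 1 + (t - t₀) * b :=
    add_pos_of_pos_of_nonneg one_pos (mul_nonneg (sub_nonneg.2 ht.le) hb.le)
  have h2 : (0 : ℝ) < 1 + t := by linarith
  rw [mul_assoc, ← Real.mul_rpow (by positivity) (by positivity), div_eq_mul_inv,
    ← Real.inv_rpow h2.le]
  refine mul_le_mul_of_nonneg_left (Real.rpow_le_rpow (by positivity) ?_ hq.le) hc.le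
  rw [mul_one_div, ← one_div, div_le_div_iff₀ h2 h1]
  nlinarith [mul_pos hb ht₀]

end Bresse

end

theorem mainTheorem3
    (L ρ₁ ρ₂ k₁ k₂ k₃ a q p ξ : ℝ)
    (hL : 0 < L) (hρ₁ : 0 < ρ₁) (hρ₂ : 0 < ρ₂) (hk₁ : 0 < k₁) (hk₂ : 0 < k₂) (hk₃ : 0 < k₃)
    (hspeed : k₁ / ρ₁ = k₂ / ρ₂) (hk : k₁ = k₃)
    (ha : 0 < a) (hq : 2 < q)
    (hg : Bresse.IsRelaxation k₂ (Bresse.polyKernel a q))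
    (hp : p = (q + 1) / q) (hξ : ξ = q / a ^ (1 / q)) :
    -- the relaxation function satisfies `g' = -ξ g^p` with `1 < p < 3/2`
    (1 < p ∧ p < 3 / 2 ∧ 0 < ξ ∧
      ∀ t : ℝ, 0 ≤ t →
        HasDerivAt (Bresse.polyKernel a q) (-(ξ * Bresse.polyKernel a q t ^ p)) t) ∧
    -- the integrability condition behind the improved estimate
    (∀ t₀ : ℝ, 0 < t₀ →
      MeasureTheory.IntegrableOn
        (fun t : ℝ => (1 / (1 + ∫ _s in t₀..t, ξ ^ (2 * p - 1))) ^ (1 / (2 * p - 2)))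
        (Set.Ioi t₀)) ∧
    -- the decay of the energy for small `l`
    ∃ l₀ : ℝ, 0 < l₀ ∧ ∀ l : ℝ, 0 < l → l < l₀ →
      ∀ (φ₀ : Bresse.H10 L) (φ₁ : Bresse.L2 L) (ψ₀ : Bresse.H1s L) (ψ₁ : Bresse.L2s L)
        (w₀ : Bresse.H1s L) (w₁ : Bresse.L2s L) (t₀ : ℝ), 0 < t₀ →
        (∃ C : ℝ, 0 < C ∧ ∀ (φ : ℝ → Bresse.H10 L) (ψ w : ℝ → Bresse.H1s L),
          Bresse.IsWeakSolution L l ρ₁ ρ₂ k₁ k₂ k₃ (Bresse.polyKernel a q)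
            φ₀ φ₁ ψ₀ ψ₁ w₀ w₁ φ ψ w →
          ∀ t : ℝ, t₀ < t →
            Bresse.energy l ρ₁ ρ₂ k₁ k₂ k₃ (Bresse.polyKernel a q) φ ψ w t
              ≤ C * (1 / (1 + ∫ _s in t₀..t, ξ ^ p)) ^ (1 / (p - 1))) ∧
        (∃ c : ℝ, 0 < c ∧ ∀ (φ : ℝ → Bresse.H10 L) (ψ w : ℝ → Bresse.H1s L),
          Bresse.IsWeakSolution L l ρ₁ ρ₂ k₁ k₂ k₃ (Bresse.polyKernel a q)
            φ₀ φ₁ ψ₀ ψ₁ w₀ w₁ φ ψ w →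
          ∀ t : ℝ, t₀ < t →
            Bresse.energy l ρ₁ ρ₂ k₁ k₂ k₃ (Bresse.polyKernel a q) φ ψ w t
              ≤ c / (1 + t) ^ q) ∧
        -- the rate is exactly that of the relaxation function, except for the zero solution
        (¬(φ₀ = 0 ∧ φ₁ = 0 ∧ ψ₀ = 0 ∧ ψ₁ = 0 ∧ w₀ = 0 ∧ w₁ = 0) →
          ∃ c : ℝ, 0 < c ∧ ∀ (φ : ℝ → Bresse.H10 L) (ψ w : ℝ → Bresse.H1s L),
            Bresse.IsWeakSolution L l ρ₁ ρ₂ k₁ k₂ k₃ (Bresse.polyKernel a q)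
              φ₀ φ₁ ψ₀ ψ₁ w₀ w₁ φ ψ w →
            ∀ t : ℝ, t₀ < t →
              c / (1 + t) ^ q
                ≤ Bresse.energy l ρ₁ ρ₂ k₁ k₂ k₃ (Bresse.polyKernel a q) φ ψ w t) := by
  have hq0 : 0 < q := by linarith
  have hp1 : p - 1 = 1 / q := by rw [hp]; field_simp; ring
  have h1q : 1 / q < 1 / 2 := one_div_lt_one_div_of_lt two_pos hq
  have h0q : 0 < 1 / q := by positivity
  have hξ0 : 0 < ξ := by rw [hξ]; positivity
  have hpq : 1 / (p - 1) = q := by rw [hp1, one_div_one_div]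
  refine ⟨⟨by linarith, by linarith, hξ0, fun t ht =>
    Bresse.hasDerivAt_polyKernel_rpow ha hq0 hp hξ ht⟩, fun t₀ ht₀ => ?_, ?_⟩
  -- The exponent exceeds 1 exactly because `q > 2`.
  · have he : 1 / (2 * p - 2) = q / 2 := by
      have : 2 * p - 2 = 2 * (p - 1) := by ring
      rw [this, hp1]
      field_simp
    rw [he]
    exact Bresse.integrableOn_rpow_affine (by positivity) (by linarith) ht₀
  subst hk
  -- Half the lowest frequency.
  refine ⟨Real.pi / (2 * L), by positivity, fun l hl hl₀ φ₀ φ₁ ψ₀ ψ₁ w₀ w₁ t₀ ht₀ => ?_⟩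
  have H := hg.admissible hl hρ₁ hρ₂ hk₁ hk₂ hspeed ha hq
  obtain ⟨c, hc, hup⟩ := Bresse.exists_energy_le (φ₀ := φ₀) (φ₁ := φ₁) (ψ₀ := ψ₀) (ψ₁ := ψ₁)
    (w₀ := w₀) (w₁ := w₁) H hL hl₀
  refine ⟨⟨c * (1 + ξ ^ p) ^ q, by positivity, fun φ ψ w h t ht => ?_⟩,
    ⟨c, hc, fun φ ψ w h t ht => hup φ ψ w h t (ht₀.le.trans ht.le)⟩, fun hne => ?_⟩
  · rw [hpq]
    exact (hup φ ψ w h t (ht₀.le.trans ht.le)).trans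
      (Bresse.div_rpow_le_rpow_affine hc (by positivity) hq0 ht₀ ht)
  · obtain ⟨c', hc', hlow⟩ := Bresse.exists_le_energy H hL hl₀ hne
    exact ⟨c', hc', fun φ ψ w h t ht => hlow φ ψ w h t (ht₀.le.trans ht.le)⟩
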